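/- An instance $I=(G,\mathcal C,\omega,\ell,b)$ of \textsc{Stars NWS} consists of a finite simple graph $G=(V,E)$ with $n$ vertices and $m$ edges, a finite collection $\mathcal C=\{C_1,\dots,C_c\}$ of subsets of $V$ (communities), an edge-weight function $\omega:E\to\mathbb R_{\ge 0}$, an integer $\ell$ and a real number $b>0$. The question is whether there is a graph $G'=(V,E')$ with $E'\subseteq E$, $|E'|\le\ell$ and $\sum_{e\in E'}\omega(e)\le b$ such that for every $i$ the subgraph $G'[C_i]$ induced by $C_i$ contains a spanning star (for some $z\in C_i$, every $v\in C_i\setminus\{z\}$ is adjacent to $z$ in $G'$). Let $x$ be the number of connected components of the hypergraph $(V,\mathcal C)$ (a vertex in no community is a component of its own; $x$ is also the number of connected components of every inclusion-minimal solution). The parameter is $t=\max\{0,\ \ell-n+x\}$, the bound that $\ell$ puts on the feedback edge number of an inclusion-minimal solution. Put $|I|=n+m+c+\sum_i|C_i|+1$. The machine is a random access machine under the uniform cost measure with registers and arrays of natural numbers (addition, truncated subtraction, comparison) and arrays of real numbers for the weights (the constant $0$, addition, comparison). It is given $n$, $c$, the sign and the absolute value of $\ell$, the number $b$, the adjacency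 matrix and the weight matrix of $G$, and the community–vertex incidence matrix. \textbf{Theorem.} \textsc{Stars NWS} can be solved in $m^{4t}\cdot\mathrm{poly}(|I|)$ time: there are one program and constants $a,k\in\mathbb N$ such that on every instance $I$ the program halts with the correct yes/no answer after at most $\max\{1,m\}^{4t}\cdot a\,|I|^{k}$ steps. In particular, on instances with $t=0$ it takes at most $a\,|I|^{k}$ steps, that is, polynomial time. -/

import Mathlib

/-! ### The problem Stars NWS -/

/-- `H` contains a spanning star: for some centre `z`, the graph whose edges are exactly the pairs
`{z, v}` with `v ≠ z` is a subgraph of `H`. -/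
def ContainsSpanningStar {U : Type*} (H : SimpleGraph U) : Prop :=
  ∃ z : U, SimpleGraph.starGraph z ≤ H

/-- An instance `(G, 𝒞, ω, ℓ, b)` of Stars NWS. -/
structure StarsNWS where
  /-- the number of vertices; the vertex set is `{0, …, n - 1}` -/
  n : ℕ
  /-- the input graph -/
  G : SimpleGraph (Fin n)
  /-- the number of communities -/
  c : ℕ
  /-- the communities -/
  C : Fin c → Finset (Fin n)
  /-- the edge weights -/
  ω : G.edgeSet → NNReal
  /-- the bound on the number of edges -/
  ℓ : ℤ
  /-- the bound on the total weight -/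
  b : ℝ
  b_pos : 0 < b

namespace StarsNWS

variable (I : StarsNWS)

/-- The number of edges of the input graph. -/
noncomputable def m : ℕ := I.G.edgeSet.ncard

open Classical in
/-- The total weight of the edges of `G` that belong to `G'`. -/
noncomputable def weight (G' : SimpleGraph (Fin I.n)) : ℝ :=
  ∑ e : I.G.edgeSet, if (e : Sym2 (Fin I.n)) ∈ G'.edgeSet then (I.ω e : ℝ) else 0

/-- `G'` is a solution: a spanning subgraph of `G` with at most `ℓ` edges and total weight at most
`b` such that the subgraph of `G'` induced by each community contains a spanning star. -/
def IsSolution (G' : SimpleGraph (Fin I.n)) : Prop :=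
  G' ≤ I.G ∧ (G'.edgeSet.ncard : ℤ) ≤ I.ℓ ∧ I.weight G' ≤ I.b ∧
    ∀ i : Fin I.c, ContainsSpanningStar (G'.induce (I.C i : Set (Fin I.n)))

/-- `I` is a yes-instance. -/
def IsYes : Prop := ∃ G' : SimpleGraph (Fin I.n), I.IsSolution G'

/-- Two distinct vertices are adjacent when they share a community; the connected components of
this graph are the connected components of the hypergraph `(V, 𝒞)`. -/
def communityGraph : SimpleGraph (Fin I.n) :=
  SimpleGraph.fromRel fun u v => ∃ i : Fin I.c, u ∈ I.C i ∧ v ∈ I.C i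

/-- The number of connected components of the hypergraph `(V, 𝒞)` (a vertex that lies in no
community is a component of its own). -/
noncomputable def x : ℕ := Nat.card I.communityGraph.ConnectedComponent

/-- The parameter `t = ℓ - n + x`, read as `0` when this number is negative (there is no solution
in that case). -/
noncomputable def t : ℕ := (I.ℓ - I.n + I.x).toNat

/-- The size `|I|` of the instance: vertices, edges, communities, and the sizes of the communities;
one is added so that it is positive. -/
noncomputable def size : ℕ := I.n + I.m + I.c + ∑ i, (I.C i).card + 1

end StarsNWS

/-! ### The machine model

A random access machine with natural-number registers, natural-number arrays and arrays of real
numbers, under the uniform cost measure. On natural numbers it has addition, truncated subtraction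
and comparison; on real numbers it has the constant `0`, addition and comparison only. A program is
a finite text, so it mentions finitely many registers and arrays. -/

namespace RAM

/-- A memory state. -/
structure Store where
  /-- the registers -/
  reg : ℕ → ℕ
  /-- `arr a i` is the cell `i` of the array `a` -/
  arr : ℕ → ℕ → ℕ
  /-- `warr a i` is the cell `i` of the array `a` of real numbers -/
  warr : ℕ → ℕ → ℝ

/-- Expressions with values in the natural numbers. -/
inductive Expr : Type
  | const (k : ℕ)
  | reg (r : ℕ)
  | get (a : ℕ) (e : Expr)
  | add (e f : Expr)
  | sub (e f : Expr)

namespace Expr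

def eval (s : Store) : Expr → ℕ
  | const k => k
  | reg r => s.reg r
  | get a e => s.arr a (e.eval s)
  | add e f => e.eval s + f.eval s
  | sub e f => e.eval s - f.eval s

/-- The number of operations performed when the expression is evaluated. -/
def cost : Expr → ℕ
  | const _ => 1
  | reg _ => 1
  | get _ e => e.cost + 1
  | add e f => e.cost + f.cost + 1
  | sub e f => e.cost + f.cost + 1

end Expr

/-- Expressions with real values. -/
inductive WExpr : Type
  | zero
  | get (a : ℕ) (e : Expr)
  | add (e f : WExpr)

namespace WExpr

noncomputable def eval (s : Store) : WExpr → ℝ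
  | zero => 0
  | get a e => s.warr a (e.eval s)
  | add e f => e.eval s + f.eval s

def cost : WExpr → ℕ
  | zero => 1
  | get _ e => e.cost + 1
  | add e f => e.cost + f.cost + 1

end WExpr

/-- Tests. -/
inductive Test : Type
  | lt (e f : Expr)
  | eq (e f : Expr)
  | wle (e f : WExpr)
  | not (p : Test)
  | and (p q : Test)

namespace Test

def Holds (s : Store) : Test → Prop
  | lt e f => e.eval s < f.eval s
  | eq e f => e.eval s = f.eval s
  | wle e f => e.eval s ≤ f.eval s
  | not p => ¬ p.Holds s
  | and p q => p.Holds s ∧ q.Holds s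

def cost : Test → ℕ
  | lt e f => e.cost + f.cost + 1
  | eq e f => e.cost + f.cost + 1
  | wle e f => e.cost + f.cost + 1
  | not p => p.cost + 1
  | and p q => p.cost + q.cost + 1

end Test

/-- Programs. -/
inductive Program : Type
  | skip
  | assign (r : ℕ) (e : Expr)
  | put (a : ℕ) (e f : Expr)
  | wput (a : ℕ) (e : Expr) (f : WExpr)
  | seq (P Q : Program)
  | ite (p : Test) (P Q : Program)
  | loop (p : Test) (P : Program)

/-- `Exec P s s' T`: started in the memory state `s`, the program `P` halts after exactly `T` steps
in the memory state `s'`. -/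
inductive Exec : Program → Store → Store → ℕ → Prop
  | skip (s : Store) : Exec Program.skip s s 1
  | assign (s : Store) (r : ℕ) (e : Expr) :
      Exec (Program.assign r e) s
        { s with reg := Function.update s.reg r (e.eval s) } (e.cost + 1)
  | put (s : Store) (a : ℕ) (e f : Expr) :
      Exec (Program.put a e f) s
        { s with
          arr := Function.update s.arr a (Function.update (s.arr a) (e.eval s) (f.eval s)) } (e.cost + f.cost + 1)
  | wput (s : Store) (a : ℕ) (e : Expr) (f : WExpr) :
      Exec (Program.wput a e f) s
        { s with
          warr := Function.update s.warr a (Function.update (s.warr a) (e.eval s) (f.eval s)) } (e.cost + f.cost + 1)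
  | seq {P Q : Program} {s₁ s₂ s₃ : Store} {T U : ℕ} :
      Exec P s₁ s₂ T → Exec Q s₂ s₃ U → Exec (Program.seq P Q) s₁ s₃ (T + U)
  | ite_true {p : Test} {P Q : Program} {s s' : Store} {T : ℕ} :
      p.Holds s → Exec P s s' T → Exec (Program.ite p P Q) s s' (p.cost + T + 1)
  | ite_false {p : Test} {P Q : Program} {s s' : Store} {T : ℕ} :
      ¬ p.Holds s → Exec Q s s' T → Exec (Program.ite p P Q) s s' (p.cost + T + 1)
  | loop_true {p : Test} {P : Program} {s₁ s₂ s₃ : Store} {T U : ℕ} :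
      p.Holds s₁ → Exec P s₁ s₂ T → Exec (Program.loop p P) s₂ s₃ U →
      Exec (Program.loop p P) s₁ s₃ (p.cost + T + U + 1)
  | loop_false {p : Test} {P : Program} {s : Store} :
      ¬ p.Holds s → Exec (Program.loop p P) s s (p.cost + 1)

end RAM

namespace StarsNWS

variable (I : StarsNWS)

open Classical in
/-- The memory state in which the machine receives the instance; everything not listed is `0`.
* registers `0`, `1`, `2`, `3`: `n`, `c`, the sign of `ℓ` (`1` if `ℓ < 0`), `|ℓ|`;
* array `0`, cell `u * n + v`: `1` if `u` and `v` are adjacent in `G`;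
* array `1`, cell `i * n + v`: `1` if `v` belongs to the community `i`;
* real array `0`, cell `u * n + v`: the weight of the edge `{u, v}` if `u` and `v` are adjacent
  (the sum has at most one nonzero term, since the cell determines `u` and `v`);
* real array `1`, cell `0`: `b`. -/
noncomputable def input : RAM.Store where
  reg r :=
    if r = 0 then I.n
    else if r = 1 then I.c
    else if r = 2 then (if I.ℓ < 0 then 1 else 0)
    else if r = 3 then I.ℓ.natAbs
    else 0
  arr a j :=
    if a = 0 then
      (if ∃ u v : Fin I.n, j = (u : ℕ) * I.n + (v : ℕ) ∧ I.G.Adj u v then 1 else 0)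
    else if a = 1 then
      (if ∃ (i : Fin I.c) (v : Fin I.n), j = (i : ℕ) * I.n + (v : ℕ) ∧ v ∈ I.C i then 1 else 0)
    else 0
  warr a j :=
    if a = 0 then
      ∑ e : I.G.edgeSet,
        (if ∃ u v : Fin I.n, j = (u : ℕ) * I.n + (v : ℕ) ∧ (e : Sym2 (Fin I.n)) = s(u, v)
          then (I.ω e : ℝ) else 0)
    else if a = 1 then (if j = 0 then I.b else 0)
    else 0

/-- Started on the instance `I`, the program `P` halts after at most `T` steps and answers
correctly: register `0` then holds `1` if `I` is a yes-instance and `0` otherwise. -/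
def SolvedBy (P : RAM.Program) (T : ℕ) : Prop :=
  ∃ (s : RAM.Store) (T' : ℕ), RAM.Exec P I.input s T' ∧ T' ≤ T ∧
    (I.IsYes → s.reg 0 = 1) ∧ (¬ I.IsYes → s.reg 0 = 0)

end StarsNWS

/-! Fix a solution `H` and let `S` consist of its edges that lie on triangles or 4-cycles. The proof
rests on two facts about `S`.

First, `S` is small. Build a subgraph of `H` by adding short cycles as long as one of their edges is
missing: each addition costs at most four edges and raises the feedback edge number by at least one.
Hence `S` has at most four times as many edges as the feedback edge number of `H`
(`ncard_shortCycles_le`), so at most `4t`, and about `m ^ (4t)` guesses contain the right `S`.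

Second, once `S` is known, the choice of the centres decomposes. If two communities with at least
two common members have different centres, the common members close triangles or 4-cycles with the
centres. So the edges from a centre to the common members lie in `S`, unless the intersection is
exactly the pair of centres (`Certificate.eq_or_inter_eq`). Whether these edges lie in `S` does not
depend on the candidate centre (`Cand.of_free`), so it can be tested without knowing `H`. If the
test fails, three or more common members force equal centres, which generates the groups, and
exactly two common members force the centre into the intersection. In a solution, an edge outside
`S` used by two groups is such a two-element intersection (`Certificate.mem_linkEdges`), and every
admissible centre uses that edge anyway (`linkEdges_subset`). Up to this fixed part costs add up
over the groups, so the cheapest centre of each group is optimal (`Certificate.sum_biUnion_le`). The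
number of edges does not suffer, because all admissible centres of a group need equally many edges
outside `S` (`card_leaves_le`). So the right guess is accepted (`exists_accepts`), and any accepted
guess yields a solution (`Accepts.isYes`).

For the machine, a trial is written with bounded sums and bounded loops. Compilation respects the
semantics (`Cmd.runs`), and the running time is polynomial because only registers with small
contents bound sums and loops (`Cmd.time_le`). The single long loop runs over the guesses, coded as
digit sequences in radix `max 1 m`. -/

namespace RAM

/-! ### Stores -/

namespace Store

/-- The store with register `r` set to `x`. -/
def upd (s : Store) (r x : ℕ) : Store := { s with reg := Function.update s.reg r x }

/-- The store with cell `i` of the array `a` set to `x`. -/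
def updArr (s : Store) (a i x : ℕ) : Store :=
  { s with arr := Function.update s.arr a (Function.update (s.arr a) i x) }

/-- The store with cell `i` of the real array `a` set to `x`. -/
noncomputable def updW (s : Store) (a i : ℕ) (x : ℝ) : Store :=
  { s with warr := Function.update s.warr a (Function.update (s.warr a) i x) }

variable (s : Store) (r a i j x y : ℕ) (w : ℝ)

theorem upd_reg (r' : ℕ) : (s.upd r x).reg r' = if r' = r then x else s.reg r' := by
  simp [upd, Function.update_apply]
@[simp] theorem upd_arr : (s.upd r x).arr = s.arr := rfl
@[simp] theorem upd_warr : (s.upd r x).warr = s.warr := rfl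
theorem updArr_arr (a' j : ℕ) :
    (s.updArr a i x).arr a' j = if a' = a ∧ j = i then x else s.arr a' j := by
  by_cases h : a' = a <;> simp [updArr, Function.update_apply, h]
theorem updW_warr (a' j : ℕ) :
    (s.updW a i w).warr a' j = if a' = a ∧ j = i then w else s.warr a' j := by
  by_cases h : a' = a <;> simp [updW, Function.update_apply, h]

/-- The stores agree on all arrays and on the registers below `v`. -/
structure Agree (v : ℕ) (s t : Store) : Prop where
  reg : ∀ r < v, s.reg r = t.reg r
  arr : s.arr = t.arr
  warr : s.warr = t.warr

theorem Agree.refl (v : ℕ) (s : Store) : Agree v s s := ⟨fun _ _ => rfl, rfl, rfl⟩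

theorem Agree.upd_left {v r : ℕ} {s t : Store} (h : Agree v s t) (hr : v ≤ r) (x : ℕ) :
    Agree v (s.upd r x) t :=
  ⟨fun r' hr' => by rw [upd_reg, if_neg (by omega)]; exact h.reg r' hr', h.arr, h.warr⟩

theorem Agree.upd {v : ℕ} {s t : Store} (h : Agree v s t) (r x : ℕ) :
    Agree v (s.upd r x) (t.upd r x) :=
  ⟨fun r' hr' => by rw [upd_reg, upd_reg, h.reg r' hr'], h.arr, h.warr⟩

theorem Agree.upd_succ {v : ℕ} {s t : Store} (h : Agree v s t) {x : ℕ} (hx : s.reg v = x) :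
    Agree (v + 1) s (t.upd v x) := by
  refine ⟨fun r hr => ?_, h.arr, h.warr⟩
  rw [upd_reg]
  split_ifs with h'
  · rw [h', hx]
  · exact h.reg r (by omega)

end Store

/-- The running time `f` is bounded by a polynomial in any bound for the contents of the registers
with `isB`. -/
def PolyBounded (isB : ℕ → Bool) (f : (ℕ → ℕ) → ℕ) : Prop :=
  ∃ a k : ℕ, ∀ (β : ℕ → ℕ) (N : ℕ), 1 ≤ N → (∀ b, isB b = true → β b ≤ N) → f β ≤ a * N ^ k

theorem PolyBounded.add_add {isB : ℕ → Bool} {f g : (ℕ → ℕ) → ℕ} (hf : PolyBounded isB f)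
    (hg : PolyBounded isB g) (h : ℕ) : PolyBounded isB fun β => f β + g β + h := by
  obtain ⟨a, k, hf⟩ := hf
  obtain ⟨a', k', hg⟩ := hg
  refine ⟨a + a' + h, k + k', fun β N hN hβ => ?_⟩
  have h1 : a * N ^ k ≤ a * N ^ (k + k') :=
    Nat.mul_le_mul_left _ (Nat.pow_le_pow_right hN (by omega))
  have h2 : a' * N ^ k' ≤ a' * N ^ (k + k') :=
    Nat.mul_le_mul_left _ (Nat.pow_le_pow_right hN (by omega))
  have h3 : h * 1 ≤ h * N ^ (k + k') := Nat.mul_le_mul_left _ (Nat.one_le_pow _ _ hN)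
  have h4 := hf β N hN hβ
  have h5 := hg β N hN hβ
  calc f β + g β + h ≤ a * N ^ (k + k') + a' * N ^ (k + k') + h * N ^ (k + k') := by omega
    _ = (a + a' + h) * N ^ (k + k') := by ring

theorem PolyBounded.add_const {isB : ℕ → Bool} {f : (ℕ → ℕ) → ℕ} (hf : PolyBounded isB f)
    (h : ℕ) : PolyBounded isB fun β => f β + h := by
  simpa using hf.add_add (g := fun _ => 0) ⟨0, 0, by simp⟩ h

/-! ### Terms with bounded sums -/

/-- Terms with values in the natural numbers; truth values are numbers, and the nonzero ones count
as true. In `sum r b t` the register `r` runs over the numbers below the value of register `b`. -/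
inductive Term : Type
  | const (k : ℕ)
  | var (r : ℕ)
  | get (a : ℕ) (t : Term)
  | add (t u : Term)
  | sub (t u : Term)
  | lt (t u : Term)
  | wle (a : ℕ) (t : Term) (b : ℕ) (u : Term)
  | sum (r b : ℕ) (t : Term)

/-- The registers from this one on are scratch memory of compiled terms. -/
abbrev scratch : ℕ := 100

/-- The registers below this one are the registers of programs; the ones between it and `scratch`
are the bound variables of terms. -/
abbrev base : ℕ := 24

namespace Term

open Classical in
noncomputable def eval : Term → Store → ℕ
  | const k, _ => k
  | var r, s => s.reg r
  | get a t, s => s.arr a (t.eval s)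
  | add t u, s => t.eval s + u.eval s
  | sub t u, s => t.eval s - u.eval s
  | lt t u, s => if t.eval s < u.eval s then 1 else 0
  | wle a t b u, s => if s.warr a (t.eval s) ≤ s.warr b (u.eval s) then 1 else 0
  | sum r b t, s => ∑ x ∈ Finset.range (s.reg b), t.eval (s.upd r x)

/-- The program that computes the value of a term in the register `scratch + d`. -/
def comp : Term → ℕ → Program
  | const k, d => .assign (scratch + d) (.const k)
  | var r, d => .assign (scratch + d) (.reg r)
  | get a t, d => .seq (t.comp d) (.assign (scratch + d) (.get a (.reg (scratch + d))))
  | add t u, d => .seq (t.comp d) (.seq (u.comp (d + 1))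
      (.assign (scratch + d) (.add (.reg (scratch + d)) (.reg (scratch + (d + 1))))))
  | sub t u, d => .seq (t.comp d) (.seq (u.comp (d + 1))
      (.assign (scratch + d) (.sub (.reg (scratch + d)) (.reg (scratch + (d + 1))))))
  | lt t u, d => .seq (t.comp d) (.seq (u.comp (d + 1))
      (.ite (.lt (.reg (scratch + d)) (.reg (scratch + (d + 1))))
        (.assign (scratch + d) (.const 1)) (.assign (scratch + d) (.const 0))))
  | wle a t b u, d => .seq (t.comp d) (.seq (u.comp (d + 1))
      (.ite (.wle (.get a (.reg (scratch + d))) (.get b (.reg (scratch + (d + 1)))))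
        (.assign (scratch + d) (.const 1)) (.assign (scratch + d) (.const 0))))
  | sum r b t, d => .seq (.assign (scratch + d) (.const 0)) (.seq (.assign r (.const 0))
      (.loop (.lt (.reg r) (.reg b)) (.seq (t.comp (d + 1))
        (.seq (.assign (scratch + d) (.add (.reg (scratch + d)) (.reg (scratch + (d + 1)))))
          (.assign r (.add (.reg r) (.const 1)))))))

/-- A bound on the running time of the compiled term, `β b` bounding the contents of the registers
`b` that bound the sums. -/
def time (β : ℕ → ℕ) : Term → ℕ
  | const _ => 2
  | var _ => 2
  | get _ t => t.time β + 3
  | add t u => t.time β + u.time β + 4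
  | sub t u => t.time β + u.time β + 4
  | lt t u => t.time β + u.time β + 6
  | wle _ t _ u => t.time β + u.time β + 8
  | sum _ b t => β b * (t.time β + 12) + 8

/-- The term reads only registers below `v` and its bound variables, the bound variables are named by
their level, and the registers bounding the sums satisfy `isB`. -/
def WF (isB : ℕ → Bool) : Term → ℕ → Bool
  | const _, _ => true
  | var r, v => decide (r < v)
  | get _ t, v => t.WF isB v
  | add t u, v => t.WF isB v && u.WF isB v
  | sub t u, v => t.WF isB v && u.WF isB v
  | lt t u, v => t.WF isB v && u.WF isB v
  | wle _ t _ u, v => t.WF isB v && u.WF isB v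
  | sum r b t, v => decide (r = v) && decide (v < scratch) && decide (b < base) &&
      decide (base ≤ v) && isB b && t.WF isB (v + 1)

/-- The scratch registers act as a stack: cells below `d` hold the values of pending subterms and
must survive. A bound variable is named by its nesting level `v`, so a loop destroys only registers
from `v` on. This is why `s` need agree with the reference store `s₀` only below `v`. -/
theorem exec {isB : ℕ → Bool} {β : ℕ → ℕ} (t : Term) :
    ∀ {v d : ℕ} {s s₀ : Store}, t.WF isB v = true → v ≤ scratch → Store.Agree v s s₀ →
      (∀ b, b < base → isB b = true → s₀.reg b ≤ β b) →
      ∃ s' T, Exec (t.comp d) s s' T ∧ T ≤ t.time β ∧ s'.reg (scratch + d) = t.eval s₀ ∧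
        Store.Agree v s' s₀ ∧ ∀ k < d, s'.reg (scratch + k) = s.reg (scratch + k) := by
  induction t with
  | const k =>
    intro v d s s₀ _ hv hs _
    refine ⟨_, _, .assign _ _ _, le_rfl, by simp [eval, Expr.eval], hs.upd_left (by omega) _, ?_⟩
    intro k hk
    exact Function.update_of_ne (by omega) _ _
  | var r =>
    intro v d s s₀ hw hv hs _
    refine ⟨_, _, .assign _ _ _, le_rfl, ?_, hs.upd_left (by omega) _, ?_⟩
    · simp only [WF, decide_eq_true_eq] at hw
      simp [eval, Expr.eval, hs.reg r hw]
    intro k hk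
    exact Function.update_of_ne (by omega) _ _
  | get a t ih =>
    intro v d s s₀ hw hv hs hβ
    obtain ⟨s', T, he, hT, hr, ha, hk⟩ := ih (d := d) hw hv hs hβ
    refine ⟨_, _, .seq he (.assign _ _ _), Nat.add_le_add_right hT 3, ?_,
      ha.upd_left (by omega) _, ?_⟩
    · simp [eval, Expr.eval, hr, ha.arr]
    intro k hk'
    rw [← hk k hk']
    exact Function.update_of_ne (by omega) _ _
  | add t u iht ihu =>
    intro v d s s₀ hw hv hs hβ
    simp only [WF, Bool.and_eq_true] at hw
    obtain ⟨s₁, T₁, he₁, hT₁, hr₁, ha₁, hk₁⟩ := iht (d := d) hw.1 hv hs hβ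
    obtain ⟨s₂, T₂, he₂, hT₂, hr₂, ha₂, hk₂⟩ := ihu (d := d + 1) hw.2 hv ha₁ hβ
    refine ⟨_, _, .seq he₁ (.seq he₂ (.assign _ _ _)), ?_, ?_, ha₂.upd_left (by omega) _, ?_⟩
    · simp only [time, Expr.cost]; omega
    · simp [eval, Expr.eval, hr₂, hk₂ d (by omega), hr₁]
    intro k hk'
    rw [← hk₁ k hk', ← hk₂ k (by omega)]
    exact Function.update_of_ne (by omega) _ _
  | sub t u iht ihu =>
    intro v d s s₀ hw hv hs hβ
    simp only [WF, Bool.and_eq_true] at hw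
    obtain ⟨s₁, T₁, he₁, hT₁, hr₁, ha₁, hk₁⟩ := iht (d := d) hw.1 hv hs hβ
    obtain ⟨s₂, T₂, he₂, hT₂, hr₂, ha₂, hk₂⟩ := ihu (d := d + 1) hw.2 hv ha₁ hβ
    refine ⟨_, _, .seq he₁ (.seq he₂ (.assign _ _ _)), ?_, ?_, ha₂.upd_left (by omega) _, ?_⟩
    · simp only [time, Expr.cost]; omega
    · simp [eval, Expr.eval, hr₂, hk₂ d (by omega), hr₁]
    intro k hk'
    rw [← hk₁ k hk', ← hk₂ k (by omega)]
    exact Function.update_of_ne (by omega) _ _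
  | lt t u iht ihu =>
    intro v d s s₀ hw hv hs hβ
    simp only [WF, Bool.and_eq_true] at hw
    obtain ⟨s₁, T₁, he₁, hT₁, hr₁, ha₁, hk₁⟩ := iht (d := d) hw.1 hv hs hβ
    obtain ⟨s₂, T₂, he₂, hT₂, hr₂, ha₂, hk₂⟩ := ihu (d := d + 1) hw.2 hv ha₁ hβ
    have hdd : s₂.reg (scratch + d) = t.eval s₀ := by rw [hk₂ d (by omega), hr₁]
    by_cases hlt : t.eval s₀ < u.eval s₀
    · refine ⟨_, _, .seq he₁ (.seq he₂ (.ite_true ?_ (.assign _ _ _))), ?_, ?_,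
        ha₂.upd_left (by omega) _, ?_⟩
      · simp only [Test.Holds, Expr.eval, hdd, hr₂]; exact hlt
      · simp only [time, Expr.cost, Test.cost]; omega
      · simp [eval, Expr.eval, hlt]
      intro k hk'
      rw [← hk₁ k hk', ← hk₂ k (by omega)]
      exact Function.update_of_ne (by omega) _ _
    · refine ⟨_, _, .seq he₁ (.seq he₂ (.ite_false ?_ (.assign _ _ _))), ?_, ?_,
        ha₂.upd_left (by omega) _, ?_⟩
      · simp only [Test.Holds, Expr.eval, hdd, hr₂]; exact hlt
      · simp only [time, Expr.cost, Test.cost]; omega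
      · simp [eval, Expr.eval, hlt]
      intro k hk'
      rw [← hk₁ k hk', ← hk₂ k (by omega)]
      exact Function.update_of_ne (by omega) _ _
  | wle a t b u iht ihu =>
    intro v d s s₀ hw hv hs hβ
    simp only [WF, Bool.and_eq_true] at hw
    obtain ⟨s₁, T₁, he₁, hT₁, hr₁, ha₁, hk₁⟩ := iht (d := d) hw.1 hv hs hβ
    obtain ⟨s₂, T₂, he₂, hT₂, hr₂, ha₂, hk₂⟩ := ihu (d := d + 1) hw.2 hv ha₁ hβ
    have hdd : s₂.reg (scratch + d) = t.eval s₀ := by rw [hk₂ d (by omega), hr₁]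
    by_cases hlt : s₀.warr a (t.eval s₀) ≤ s₀.warr b (u.eval s₀)
    · refine ⟨_, _, .seq he₁ (.seq he₂ (.ite_true ?_ (.assign _ _ _))), ?_, ?_,
        ha₂.upd_left (by omega) _, ?_⟩
      · simp only [Test.Holds, WExpr.eval, Expr.eval, hdd, hr₂, ha₂.warr]; exact hlt
      · simp only [time, Expr.cost, WExpr.cost, Test.cost]; omega
      · simp [eval, Expr.eval, hlt]
      intro k hk'
      rw [← hk₁ k hk', ← hk₂ k (by omega)]
      exact Function.update_of_ne (by omega) _ _
    · refine ⟨_, _, .seq he₁ (.seq he₂ (.ite_false ?_ (.assign _ _ _))), ?_, ?_,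
        ha₂.upd_left (by omega) _, ?_⟩
      · simp only [Test.Holds, WExpr.eval, Expr.eval, hdd, hr₂, ha₂.warr]; exact hlt
      · simp only [time, Expr.cost, WExpr.cost, Test.cost]; omega
      · simp [eval, Expr.eval, hlt]
      intro k hk'
      rw [← hk₁ k hk', ← hk₂ k (by omega)]
      exact Function.update_of_ne (by omega) _ _
  | sum r b t ih =>
    intro v d s s₀ hw hv hs hβ
    simp only [WF, Bool.and_eq_true, decide_eq_true_eq] at hw
    obtain ⟨⟨⟨⟨⟨rfl, hvs⟩, hb⟩, hvb⟩, hB⟩, hw⟩ := hw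
    -- Loop invariant after `x` rounds, with `j` rounds to come: the accumulator holds the partial
    -- sum over the numbers below `x`.
    have key : ∀ (j x : ℕ) (s₁ : Store), x + j = s₀.reg b → Store.Agree r s₁ s₀ → s₁.reg r = x →
        s₁.reg (scratch + d) = ∑ y ∈ Finset.range x, t.eval (s₀.upd r y) →
        (∀ k < d, s₁.reg (scratch + k) = s.reg (scratch + k)) →
        ∃ s' T, Exec (.loop (.lt (.reg r) (.reg b)) (.seq (t.comp (d + 1))
          (.seq (.assign (scratch + d) (.add (.reg (scratch + d)) (.reg (scratch + (d + 1)))))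
          (.assign r (.add (.reg r) (.const 1)))))) s₁ s' T ∧ T ≤ j * (t.time β + 12) + 4 ∧
          s'.reg (scratch + d) = (Term.sum r b t).eval s₀ ∧
          Store.Agree r s' s₀ ∧ ∀ k < d, s'.reg (scratch + k) = s.reg (scratch + k) := by
      intro j
      induction j with
      | zero =>
        intro x s₁ hx ha hr hacc hk
        refine ⟨s₁, _, .loop_false ?_, ?_, ?_, ha, hk⟩
        · simp only [Test.Holds, Expr.eval, hr, ha.reg b (by omega)]; omega
        · simp [Test.cost, Expr.cost]
        · rw [hacc, eval]; congr 2
      | succ j ihj =>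
        intro x s₁ hx ha hr hacc hk
        obtain ⟨s₂, T₂, he₂, hT₂, hr₂, ha₂, hk₂⟩ := ih (d := d + 1) (s₀ := s₀.upd r x) hw
          (by omega) (ha.upd_succ hr) (by
            intro b' hb' hB'
            rw [Store.upd_reg, if_neg (by omega)]
            exact hβ b' hb' hB')
        have hd := hk₂ d (by omega)
        have hr2 : s₂.reg r = x := by
          rw [ha₂.reg r (by omega), Store.upd_reg, if_pos rfl]
        have ha2 : Store.Agree r s₂ s₀ := by
          refine ⟨fun r' hr' => ?_, ha₂.arr, ha₂.warr⟩
          rw [ha₂.reg r' (by omega), Store.upd_reg, if_neg (by omega)]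
        obtain ⟨s', T', he', hT', hr', ha', hk'⟩ := ihj (x + 1)
          ((s₂.upd (scratch + d) (s₂.reg (scratch + d) + s₂.reg (scratch + (d + 1)))).upd r (x + 1))
          (by omega) ((ha2.upd_left (by omega) _).upd_left le_rfl _) (by simp [Store.upd_reg])
          (by
            rw [Store.upd_reg, if_neg (by omega), Store.upd_reg, if_pos rfl, hr₂, hd, hacc,
              Finset.sum_range_succ])
          (by
            intro k hkd
            rw [Store.upd_reg, if_neg (by omega), Store.upd_reg, if_neg (by omega),
              hk₂ k (by omega), hk k hkd])
        have hne : r ≠ scratch + d := by omega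
        have e1 := Exec.assign s₂ (scratch + d)
          (.add (.reg (scratch + d)) (.reg (scratch + (d + 1))))
        have e2 := Exec.assign (s₂.upd (scratch + d)
          (s₂.reg (scratch + d) + s₂.reg (scratch + (d + 1)))) r (.add (.reg r) (.const 1))
        have hx1 : (Expr.add (.reg r) (.const 1)).eval (s₂.upd (scratch + d)
          (s₂.reg (scratch + d) + s₂.reg (scratch + (d + 1)))) = x + 1 := by
          simp only [Expr.eval]
          rw [Store.upd_reg, if_neg hne, hr2]
        rw [hx1] at e2
        refine ⟨s', _, .loop_true ?_ (.seq he₂ (.seq e1 e2)) he', ?_, hr', ha', hk'⟩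
        · simp only [Test.Holds, Expr.eval, hr, ha.reg b (by omega)]; omega
        · simp only [Test.cost, Expr.cost]
          have : (j + 1) * (t.time β + 12) = j * (t.time β + 12) + (t.time β + 12) := by ring
          omega
    obtain ⟨s', T', he', hT', hr', ha', hk'⟩ := key (s₀.reg b) 0
      ((s.upd (scratch + d) 0).upd r 0) (by omega)
      ((hs.upd_left (by omega) _).upd_left le_rfl _) (by simp [Store.upd_reg])
      (by rw [Store.upd_reg, if_neg (by omega), Store.upd_reg, if_pos rfl]; simp)
      (by
        intro k hk
        rw [Store.upd_reg, if_neg (by omega), Store.upd_reg, if_neg (by omega)])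
    refine ⟨s', _, .seq (.assign _ _ _) (.seq (.assign _ _ _) he'), ?_, hr', ha', hk'⟩
    have : s₀.reg b * (t.time β + 12) ≤ β b * (t.time β + 12) :=
      Nat.mul_le_mul_right _ (hβ b hb hB)
    simp only [time, Expr.cost]
    omega

/-- Every bounded sum multiplies the time by at most `N`, up to constants, so the number of sums in
the term serves as the exponent. -/
theorem time_le {isB : ℕ → Bool} (t : Term) {v : ℕ} (hw : t.WF isB v = true) :
    PolyBounded isB fun β => t.time β := by
  induction t generalizing v with
  | const k => exact ⟨2, 0, fun β N hN hβ => by simp [time]⟩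
  | var r => exact ⟨2, 0, fun β N hN hβ => by simp [time]⟩
  | get a t ih =>
    exact (ih hw).add_const 3
  | add t u iht ihu =>
    simp only [WF, Bool.and_eq_true] at hw
    exact (iht hw.1).add_add (ihu hw.2) 4
  | sub t u iht ihu =>
    simp only [WF, Bool.and_eq_true] at hw
    exact (iht hw.1).add_add (ihu hw.2) 4
  | lt t u iht ihu =>
    simp only [WF, Bool.and_eq_true] at hw
    exact (iht hw.1).add_add (ihu hw.2) 6
  | wle a t b u iht ihu =>
    simp only [WF, Bool.and_eq_true] at hw
    exact (iht hw.1).add_add (ihu hw.2) 8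
  | sum r b t ih =>
    simp only [WF, Bool.and_eq_true, decide_eq_true_eq] at hw
    obtain ⟨a, k, h⟩ := (ih hw.2).add_const 12
    refine ⟨a + 8, k + 1, fun β N hN hβ => ?_⟩
    have h1 : β b * (t.time β + 12) ≤ N * (a * N ^ k) :=
      Nat.mul_le_mul (hβ b hw.1.2) (h β N hN hβ)
    have h3 : 8 * 1 ≤ 8 * N ^ (k + 1) := Nat.mul_le_mul_left _ (Nat.one_le_pow _ _ hN)
    calc β b * (t.time β + 12) + 8 ≤ N * (a * N ^ k) + 8 * N ^ (k + 1) := by omega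
      _ = (a + 8) * N ^ (k + 1) := by ring

end Term

/-! ### Running programs up to scratch memory -/

/-- Started in a store that agrees with `s₀`, the program halts after at most `T` steps in a store
that agrees with `s₁`. -/
def Runs (P : Program) (s₀ s₁ : Store) (T : ℕ) : Prop :=
  ∀ s, Store.Agree base s s₀ → ∃ s' T', Exec P s s' T' ∧ T' ≤ T ∧ Store.Agree base s' s₁

theorem Runs.seq {P Q : Program} {s₀ s₁ s₂ : Store} {T U : ℕ} (h : Runs P s₀ s₁ T)
    (h' : Runs Q s₁ s₂ U) : Runs (.seq P Q) s₀ s₂ (T + U) := by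
  intro s hs
  obtain ⟨s', T', he, hT, ha⟩ := h s hs
  obtain ⟨s'', U', he', hU, ha'⟩ := h' s' ha
  exact ⟨s'', _, .seq he he', by omega, ha'⟩

/-- The program `for r < b do P`. -/
def forProg (r b : ℕ) (P : Program) : Program :=
  .seq (.assign r (.const 0)) (.loop (.lt (.reg r) (.reg b))
    (.seq P (.assign r (.add (.reg r) (.const 1)))))

/-- Here `f k` is the store after `k` rounds. Nothing is assumed about the size of `K`, so the rule
covers the loop over all trials as well as the short loops of commands. -/
theorem Runs.forProg {r b K T : ℕ} {P : Program} (f : ℕ → Store) (hb : b < base) (hr : r < base)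
    (hrb : b ≠ r) (hf : ∀ k ≤ K, (f k).reg b = K) (hfr : ∀ k < K, (f (k + 1)).reg r = k)
    (h : ∀ k < K, Runs P ((f k).upd r k) (f (k + 1)) T) :
    Runs (forProg r b P) (f 0) ((f K).upd r K) (K * (T + 8) + 6) := by
  have key : ∀ (j k : ℕ) (s : Store), k + j = K → Store.Agree base s ((f k).upd r k) →
      ∃ s' T', Exec (.loop (.lt (.reg r) (.reg b))
        (.seq P (.assign r (.add (.reg r) (.const 1))))) s s' T' ∧ T' ≤ j * (T + 8) + 4 ∧
        Store.Agree base s' ((f K).upd r K) := by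
    intro j
    induction j with
    | zero =>
      intro k s hk ha
      obtain rfl : k = K := by omega
      refine ⟨s, _, .loop_false ?_, ?_, ha⟩
      · simp only [Test.Holds, Expr.eval, ha.reg r hr, ha.reg b hb, Store.upd_reg, if_neg hrb,
          hf k le_rfl, if_true]
        omega
      · simp [Test.cost, Expr.cost]
    | succ j ih =>
      intro k s hk ha
      obtain ⟨s₁, T₁, he₁, hT₁, ha₁⟩ := h k (by omega) s ha
      obtain ⟨s₂, T₂, he₂, hT₂, ha₂⟩ := ih (k + 1) (s₁.upd r (k + 1)) (by omega) (ha₁.upd r (k + 1))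
      have e1 := Exec.assign s₁ r (.add (.reg r) (.const 1))
      have hx : (Expr.add (.reg r) (.const 1)).eval s₁ = k + 1 := by
        simp only [Expr.eval, ha₁.reg r hr, hfr k (by omega)]
      rw [hx] at e1
      refine ⟨s₂, _, .loop_true ?_ (.seq he₁ e1) he₂, ?_, ha₂⟩
      · simp only [Test.Holds, Expr.eval, ha.reg r hr, ha.reg b hb, Store.upd_reg, if_neg hrb,
          hf k (by omega), if_true]
        omega
      · simp only [Test.cost, Expr.cost]
        have : (j + 1) * (T + 8) = j * (T + 8) + (T + 8) := by ring
        omega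
  intro s hs
  obtain ⟨s', T', he, hT, ha⟩ := key K 0 (s.upd r 0) (by omega) (hs.upd r 0)
  refine ⟨s', _, .seq (.assign _ _ _) he, ?_, ha⟩
  simp only [Expr.cost]
  omega

/-! ### Commands -/

/-- Structured programs, with bounded loops only. -/
inductive Cmd : Type
  | assign (r : ℕ) (t : Term)
  | put (a : ℕ) (t u : Term)
  | wzero (a : ℕ) (t : Term)
  | wadd (a : ℕ) (t : Term) (b : ℕ) (u : Term)
  | seq (P Q : Cmd)
  | ite (t : Term) (P : Cmd)
  | loop (r b : ℕ) (P : Cmd)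

/-- The store after `k` rounds of a loop with loop variable `r`. -/
def iter (f : Store → Store) (r : ℕ) (s : Store) : ℕ → Store
  | 0 => s
  | k + 1 => f ((iter f r s k).upd r k)

namespace Cmd

/-- The store after the execution of a command. -/
noncomputable def den : Cmd → Store → Store
  | assign r t, s => s.upd r (t.eval s)
  | put a t u, s => s.updArr a (t.eval s) (u.eval s)
  | wzero a t, s => s.updW a (t.eval s) 0
  | wadd a t b u, s => s.updW a (t.eval s) (s.warr a (t.eval s) + s.warr b (u.eval s))
  | seq P Q, s => Q.den (P.den s)
  | ite t P, s => if t.eval s = 0 then s else P.den s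
  | .loop r b P, s => (iter P.den r s (s.reg b)).upd r (s.reg b)

/-- The command may change register `r`. -/
def mods (r : ℕ) : Cmd → Bool
  | assign r' _ => decide (r = r')
  | put _ _ _ => false
  | wzero _ _ => false
  | wadd _ _ _ _ => false
  | seq P Q => P.mods r || Q.mods r
  | ite _ P => P.mods r
  | .loop r' _ P => decide (r = r') || P.mods r

def comp : Cmd → Program
  | assign r t => .seq (t.comp 0) (.assign r (.reg scratch))
  | put a t u => .seq (t.comp 0) (.seq (u.comp 1) (.put a (.reg scratch) (.reg (scratch + 1))))
  | wzero a t => .seq (t.comp 0) (.wput a (.reg scratch) .zero)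
  | wadd a t b u => .seq (t.comp 0) (.seq (u.comp 1) (.wput a (.reg scratch)
      (.add (.get a (.reg scratch)) (.get b (.reg (scratch + 1))))))
  | seq P Q => .seq P.comp Q.comp
  | ite t P => .seq (t.comp 0) (.ite (.lt (.const 0) (.reg scratch)) P.comp .skip)
  | .loop r b P => forProg r b P.comp

def time (β : ℕ → ℕ) : Cmd → ℕ
  | assign _ t => t.time β + 2
  | put _ t u => t.time β + u.time β + 3
  | wzero _ t => t.time β + 3
  | wadd _ t _ u => t.time β + u.time β + 8
  | seq P Q => P.time β + Q.time β
  | ite t P => t.time β + P.time β + 6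
  | .loop _ b P => β b * (P.time β + 8) + 6

/-- The terms are well formed, and the registers with `isB` that bound loops are not changed. -/
def WF (isB : ℕ → Bool) : Cmd → Bool
  | assign r t => decide (r < base) && !isB r && t.WF isB base
  | put _ t u => t.WF isB base && u.WF isB base
  | wzero _ t => t.WF isB base
  | wadd _ t _ u => t.WF isB base && u.WF isB base
  | seq P Q => P.WF isB && Q.WF isB
  | ite t P => t.WF isB base && P.WF isB
  | .loop r b P => decide (r < base) && !isB r && decide (b < base) && isB b && !P.mods r && P.WF isB

theorem iter_reg {P : Cmd} {r r' : ℕ} (hr : r' ≠ r)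
    (h : ∀ s, (P.den s).reg r' = s.reg r') (s : Store) (k : ℕ) :
    (iter P.den r s k).reg r' = s.reg r' := by
  induction k with
  | zero => rfl
  | succ k ih => rw [iter, h, Store.upd_reg, if_neg hr, ih]

theorem den_reg (P : Cmd) {r : ℕ} (h : P.mods r = false) (s : Store) :
    (P.den s).reg r = s.reg r := by
  induction P generalizing s with
  | assign r' t =>
    simp only [mods, decide_eq_false_iff_not] at h
    rw [den, Store.upd_reg, if_neg h]
  | put a t u => rfl
  | wzero a t => rfl
  | wadd a t b u => rfl
  | seq P Q ihP ihQ =>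
    simp only [mods, Bool.or_eq_false_iff] at h
    rw [den, ihQ h.2, ihP h.1]
  | ite t P ih =>
    rw [den]
    split_ifs
    · rfl
    · exact ih h s
  | loop r' b P ih =>
    simp only [mods, Bool.or_eq_false_iff, decide_eq_false_iff_not] at h
    rw [den, Store.upd_reg, if_neg h.1, iter_reg h.1 (fun s => ih h.2 s)]

theorem WF.mods {isB : ℕ → Bool} {P : Cmd} (h : P.WF isB = true) {r : ℕ} (hr : isB r = true) :
    P.mods r = false := by
  induction P with
  | assign r' t =>
    simp only [WF, Bool.and_eq_true, Bool.not_eq_true'] at h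
    simp only [Cmd.mods, decide_eq_false_iff_not]
    rintro rfl
    simp [hr] at h
  | put a t u => rfl
  | wzero a t => rfl
  | wadd a t b u => rfl
  | seq P Q ihP ihQ =>
    simp only [WF, Bool.and_eq_true] at h
    simp [Cmd.mods, ihP h.1, ihQ h.2]
  | ite t P ih =>
    simp only [WF, Bool.and_eq_true] at h
    simp [Cmd.mods, ih h.2]
  | loop r' b P ih =>
    simp only [WF, Bool.and_eq_true, Bool.not_eq_true'] at h
    simp only [Cmd.mods, Bool.or_eq_false_iff, decide_eq_false_iff_not]
    refine ⟨?_, ih h.2⟩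
    rintro rfl
    simp [hr] at h

/-- No well-formed command changes a register with `isB`. Bounds that hold at the start therefore
still hold at the second part of a sequence and in every round of a loop, and the induction
hypotheses apply there. -/
theorem runs {isB : ℕ → Bool} {β : ℕ → ℕ} (P : Cmd) (hw : P.WF isB = true) (s₀ : Store)
    (hβ : ∀ b, isB b = true → s₀.reg b ≤ β b) : Runs P.comp s₀ (P.den s₀) (P.time β) := by
  have hbs : base ≤ scratch := by decide
  induction P generalizing s₀ with
  | assign r t =>
    intro s hs
    simp only [WF, Bool.and_eq_true, decide_eq_true_eq] at hw
    obtain ⟨s₁, T₁, he₁, hT₁, hr₁, ha₁, -⟩ := t.exec (d := 0) hw.2 hbs hs (fun b _ => hβ b)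
    refine ⟨_, _, .seq he₁ (.assign _ _ _), by simp only [time, Expr.cost]; omega, ?_⟩
    have : (Expr.reg scratch).eval s₁ = t.eval s₀ := hr₁
    rw [this]
    exact ha₁.upd r (t.eval s₀)
  | put a t u =>
    intro s hs
    simp only [WF, Bool.and_eq_true] at hw
    obtain ⟨s₁, T₁, he₁, hT₁, hr₁, ha₁, -⟩ := t.exec (d := 0) hw.1 hbs hs (fun b _ => hβ b)
    obtain ⟨s₂, T₂, he₂, hT₂, hr₂, ha₂, hk₂⟩ := u.exec (d := 1) hw.2 hbs ha₁ (fun b _ => hβ b)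
    have h0 := hk₂ 0 (by omega)
    simp only [Nat.add_zero] at h0 hr₁
    refine ⟨_, _, .seq he₁ (.seq he₂ (.put _ _ _ _)), by simp only [time, Expr.cost]; omega,
      ha₂.reg, ?_, ha₂.warr⟩
    simp only [Expr.eval, den, Store.updArr, h0, hr₁, hr₂, ha₂.arr]
  | wzero a t =>
    intro s hs
    obtain ⟨s₁, T₁, he₁, hT₁, hr₁, ha₁, -⟩ := t.exec (d := 0) hw hbs hs (fun b _ => hβ b)
    simp only [Nat.add_zero] at hr₁
    refine ⟨_, _, .seq he₁ (.wput _ _ _ _), by simp only [time, Expr.cost, WExpr.cost]; omega,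
      ha₁.reg, ha₁.arr, ?_⟩
    simp only [Expr.eval, WExpr.eval, den, Store.updW, hr₁, ha₁.warr]
  | wadd a t b u =>
    intro s hs
    simp only [WF, Bool.and_eq_true] at hw
    obtain ⟨s₁, T₁, he₁, hT₁, hr₁, ha₁, -⟩ := t.exec (d := 0) hw.1 hbs hs (fun b _ => hβ b)
    obtain ⟨s₂, T₂, he₂, hT₂, hr₂, ha₂, hk₂⟩ := u.exec (d := 1) hw.2 hbs ha₁ (fun b _ => hβ b)
    have h0 := hk₂ 0 (by omega)
    simp only [Nat.add_zero] at h0 hr₁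
    refine ⟨_, _, .seq he₁ (.seq he₂ (.wput _ _ _ _)),
      by simp only [time, Expr.cost, WExpr.cost]; omega, ha₂.reg, ha₂.arr, ?_⟩
    simp only [Expr.eval, WExpr.eval, den, Store.updW, h0, hr₁, hr₂, ha₂.warr]
  | seq P Q ihP ihQ =>
    simp only [WF, Bool.and_eq_true] at hw
    refine (ihP hw.1 s₀ hβ).seq (ihQ hw.2 _ fun b hb => ?_)
    rw [den_reg P (WF.mods hw.1 hb)]
    exact hβ b hb
  | ite t P ih =>
    intro s hs
    simp only [WF, Bool.and_eq_true] at hw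
    obtain ⟨s₁, T₁, he₁, hT₁, hr₁, ha₁, -⟩ := t.exec (d := 0) hw.1 hbs hs (fun b _ => hβ b)
    simp only [Nat.add_zero] at hr₁
    by_cases h : t.eval s₀ = 0
    · refine ⟨_, _, .seq he₁ (.ite_false ?_ (.skip _)), ?_, ?_⟩
      · simp [Test.Holds, Expr.eval, hr₁, h]
      · simp only [time, Expr.cost, Test.cost]; omega
      · simpa [den, h] using ha₁
    · obtain ⟨s₂, T₂, he₂, hT₂, ha₂⟩ := ih hw.2 s₀ hβ s₁ ha₁
      refine ⟨_, _, .seq he₁ (.ite_true ?_ he₂), ?_, ?_⟩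
      · simp only [Test.Holds, Expr.eval, hr₁]; omega
      · simp only [time, Expr.cost, Test.cost]; omega
      · simpa [den, h] using ha₂
  | loop r b P ih =>
    simp only [WF, Bool.and_eq_true, decide_eq_true_eq, Bool.not_eq_true'] at hw
    obtain ⟨⟨⟨⟨⟨hr, hrB⟩, hb⟩, hbB⟩, hm⟩, hw⟩ := hw
    have hbr : ∀ b, isB b = true → b ≠ r := by
      rintro b hb rfl
      simp [hb] at hrB
    have hreg : ∀ b, isB b = true → ∀ k, (iter P.den r s₀ k).reg b = s₀.reg b := fun b hb k =>
      iter_reg (hbr b hb) (fun s => den_reg P (WF.mods hw hb) s) s₀ k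
    have := Runs.forProg (K := s₀.reg b) (T := P.time β) (P := P.comp) (iter P.den r s₀) hb hr
      (hbr b hbB) (fun k _ => hreg b hbB k)
      (fun k _ => by rw [iter, den_reg P hm, Store.upd_reg, if_pos rfl])
      (fun k _ => ih hw _ fun b' hb' => by
        rw [Store.upd_reg, if_neg (hbr b' hb'), hreg b' hb']
        exact hβ b' hb')
    intro s hs
    obtain ⟨s', T, he, hT, ha⟩ := this s hs
    refine ⟨s', T, he, hT.trans ?_, ha⟩
    have := Nat.mul_le_mul_right (P.time β + 8) (hβ b hbB)
    simp only [time]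
    omega

theorem time_le {isB : ℕ → Bool} (P : Cmd) (hw : P.WF isB = true) :
    PolyBounded isB fun β => P.time β := by
  induction P with
  | assign r t =>
    simp only [WF, Bool.and_eq_true] at hw
    exact (t.time_le hw.2).add_const 2
  | put a t u =>
    simp only [WF, Bool.and_eq_true] at hw
    exact (t.time_le hw.1).add_add (u.time_le hw.2) 3
  | wzero a t =>
    exact (t.time_le hw).add_const 3
  | wadd a t b u =>
    simp only [WF, Bool.and_eq_true] at hw
    exact (t.time_le hw.1).add_add (u.time_le hw.2) 8
  | seq P Q ihP ihQ =>
    simp only [WF, Bool.and_eq_true] at hw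
    exact (ihP hw.1).add_add (ihQ hw.2) 0
  | ite t P ih =>
    simp only [WF, Bool.and_eq_true] at hw
    exact (t.time_le hw.1).add_add (ih hw.2) 6
  | loop r b P ih =>
    simp only [WF, Bool.and_eq_true] at hw
    obtain ⟨a, k, h⟩ := (ih hw.2).add_const 8
    refine ⟨a + 6, k + 1, fun β N hN hβ => ?_⟩
    have h1 : β b * (P.time β + 8) ≤ N * (a * N ^ k) :=
      Nat.mul_le_mul (hβ b hw.1.1.2) (h β N hN hβ)
    have h3 : 6 * 1 ≤ 6 * N ^ (k + 1) := Nat.mul_le_mul_left _ (Nat.one_le_pow _ _ hN)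
    calc β b * (P.time β + 8) + 6 ≤ N * (a * N ^ k) + 6 * N ^ (k + 1) := by omega
      _ = (a + 6) * N ^ (k + 1) := by ring

end Cmd

namespace Term

/-! ### Logical connectives -/

/-- The truth value of a term. -/
def Holds (t : Term) (s : Store) : Prop := t.eval s ≠ 0

/-- Since nonzero means true, addition is disjunction and a bounded sum is a bounded existential
quantifier. Negation always returns `0` or `1`, and the other connectives are derived from these. -/
def neg (t : Term) : Term := .lt t (.const 1)
def disj (t u : Term) : Term := .add t u
def conj (t u : Term) : Term := neg (disj (neg t) (neg u))
def eqv (t u : Term) : Term := neg (.add (.sub t u) (.sub u t))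
def ex (r b : ℕ) (t : Term) : Term := .sum r b t
def all (r b : ℕ) (t : Term) : Term := neg (ex r b (neg t))

/-- The truth value as a number. -/
def ind (t : Term) : Term := neg (neg t)

/-- An entry of a two-dimensional table, array `2` containing the positions of the rows. -/
def cell (a : ℕ) (t u : Term) : Term := .get a (.add (.get 2 t) u)

variable (s : Store)

theorem eval_const (k : ℕ) : (const k).eval s = k := rfl
theorem eval_var (r : ℕ) : (var r).eval s = s.reg r := rfl
theorem eval_add (t u : Term) : (add t u).eval s = t.eval s + u.eval s := rfl
theorem eval_sub (t u : Term) : (sub t u).eval s = t.eval s - u.eval s := rfl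
theorem eval_get (a : ℕ) (t : Term) : (get a t).eval s = s.arr a (t.eval s) := rfl
theorem eval_cell (a : ℕ) (t u : Term) :
    (cell a t u).eval s = s.arr a (s.arr 2 (t.eval s) + u.eval s) := rfl
theorem eval_sum (r b : ℕ) (t : Term) :
    (sum r b t).eval s = ∑ x ∈ Finset.range (s.reg b), t.eval (s.upd r x) := rfl

theorem holds_cell (a : ℕ) (t u : Term) :
    (cell a t u).Holds s ↔ s.arr a (s.arr 2 (t.eval s) + u.eval s) ≠ 0 := Iff.rfl
theorem holds_lt (t u : Term) : (lt t u).Holds s ↔ t.eval s < u.eval s := by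
  simp [Holds, eval]
theorem holds_wle (a : ℕ) (t : Term) (b : ℕ) (u : Term) :
    (wle a t b u).Holds s ↔ s.warr a (t.eval s) ≤ s.warr b (u.eval s) := by
  simp [Holds, eval]
theorem holds_neg (t : Term) : t.neg.Holds s ↔ ¬ t.Holds s := by
  simp [Holds, neg, eval]
theorem holds_disj (t u : Term) : (disj t u).Holds s ↔ t.Holds s ∨ u.Holds s := by
  simp only [Holds, disj, eval]
  omega
theorem holds_conj (t u : Term) : (conj t u).Holds s ↔ t.Holds s ∧ u.Holds s := by
  simp [conj, holds_neg, holds_disj]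
theorem holds_eqv (t u : Term) : (eqv t u).Holds s ↔ t.eval s = u.eval s := by
  rw [eqv, holds_neg]
  simp only [Holds, eval]
  omega
theorem holds_ex {k : ℕ} (r b : ℕ) (t : Term) (h : s.reg b = k) :
    (ex r b t).Holds s ↔ ∃ x : Fin k, t.Holds (s.upd r x) := by
  subst h
  simp [Holds, ex, eval, Fin.exists_iff]
theorem holds_all {k : ℕ} (r b : ℕ) (t : Term) (h : s.reg b = k) :
    (all r b t).Holds s ↔ ∀ x : Fin k, t.Holds (s.upd r x) := by
  rw [all, holds_neg, holds_ex s r b _ h]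
  simp [holds_neg]

open Classical in
theorem eval_ind (t : Term) : t.ind.eval s = if t.Holds s then 1 else 0 := by
  have : t.ind.eval s = if t.neg.eval s < 1 then 1 else 0 := by simp [ind, neg, eval]
  rw [this]
  by_cases h : t.Holds s
  · have : t.neg.eval s = 0 := by simpa [Holds] using (not_congr (holds_neg s t)).2 (not_not.2 h)
    simp [this, h]
  · have : t.neg.eval s ≠ 0 := (holds_neg s t).2 h
    rw [if_neg (by omega), if_neg h]

theorem eval_sum_fin {k : ℕ} (r b : ℕ) (t : Term) (h : s.reg b = k) :
    (sum r b t).eval s = ∑ x : Fin k, t.eval (s.upd r x) := by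
  subst h
  rw [eval_sum, Finset.sum_range]

open Classical in
theorem eval_sum_ind {k : ℕ} (r b : ℕ) (t : Term) (h : s.reg b = k) :
    (sum r b t.ind).eval s = (Finset.univ.filter fun x : Fin k => t.Holds (s.upd r x)).card := by
  rw [eval_sum_fin s r b _ h, Finset.card_filter]
  exact Finset.sum_congr rfl fun x _ => eval_ind _ _

/-- The term reads array `a`. -/
def usesArr (a : ℕ) : Term → Bool
  | const _ => false
  | var _ => false
  | get a' t => decide (a' = a) || t.usesArr a
  | add t u => t.usesArr a || u.usesArr a
  | sub t u => t.usesArr a || u.usesArr a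
  | lt t u => t.usesArr a || u.usesArr a
  | wle _ t _ u => t.usesArr a || u.usesArr a
  | sum _ _ t => t.usesArr a

/-- The term reads the real array `a`. -/
def usesW (a : ℕ) : Term → Bool
  | const _ => false
  | var _ => false
  | get _ t => t.usesW a
  | add t u => t.usesW a || u.usesW a
  | sub t u => t.usesW a || u.usesW a
  | lt t u => t.usesW a || u.usesW a
  | wle a' t b' u => decide (a' = a) || decide (b' = a) || t.usesW a || u.usesW a
  | sum _ _ t => t.usesW a

/-- Frame property: in a loop that writes an array its terms do not read, every round can be
evaluated in the store from before the loop. -/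
theorem eval_congr (t : Term) {s s' : Store} (hr : s.reg = s'.reg)
    (ha : ∀ a, t.usesArr a = true → s.arr a = s'.arr a)
    (hw : ∀ a, t.usesW a = true → s.warr a = s'.warr a) : t.eval s = t.eval s' := by
  induction t generalizing s s' with
  | const k => rfl
  | var r => simp [eval, hr]
  | get a t ih =>
    simp only [usesArr, usesW, Bool.or_eq_true, decide_eq_true_eq] at ha hw
    rw [eval, eval, ih hr (fun a h => ha a (.inr h)) hw, ha a (.inl rfl)]
  | add t u iht ihu =>
    simp only [usesArr, usesW, Bool.or_eq_true] at ha hw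
    rw [eval, eval, iht hr (fun a h => ha a (.inl h)) (fun a h => hw a (.inl h)),
      ihu hr (fun a h => ha a (.inr h)) (fun a h => hw a (.inr h))]
  | sub t u iht ihu =>
    simp only [usesArr, usesW, Bool.or_eq_true] at ha hw
    rw [eval, eval, iht hr (fun a h => ha a (.inl h)) (fun a h => hw a (.inl h)),
      ihu hr (fun a h => ha a (.inr h)) (fun a h => hw a (.inr h))]
  | lt t u iht ihu =>
    simp only [usesArr, usesW, Bool.or_eq_true] at ha hw
    rw [eval, eval, iht hr (fun a h => ha a (.inl h)) (fun a h => hw a (.inl h)),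
      ihu hr (fun a h => ha a (.inr h)) (fun a h => hw a (.inr h))]
  | wle a t b u iht ihu =>
    simp only [usesArr, usesW, Bool.or_eq_true, decide_eq_true_eq] at ha hw
    rw [eval, eval, iht hr (fun a h => ha a (.inl h)) (fun a h => hw a (.inl (.inr h))),
      ihu hr (fun a h => ha a (.inr h)) (fun a h => hw a (.inr h)),
      hw a (.inl (.inl (.inl rfl))), hw b (.inl (.inl (.inr rfl)))]
  | sum r b t ih =>
    rw [eval, eval, hr]
    refine Finset.sum_congr rfl fun x _ => ih ?_ ha hw
    simp [Store.upd, hr]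

end Term

/-! ### Tables -/

theorem iter_induct {f : Store → Store} {r K : ℕ} {s : Store} (Inv : ℕ → Store → Prop)
    (h0 : Inv 0 s) (h : ∀ k < K, ∀ st, Inv k st → Inv (k + 1) (f (st.upd r k))) :
    Inv K (iter f r s K) := by
  induction K with
  | zero => exact h0
  | succ K ih => exact h K (by omega) _ (ih fun k hk => h k (by omega))

/-- A loop that fills an array `A` block by block. -/
theorem iter_blocks {α : Type*} {f : Store → Store} {r K : ℕ} {s : Store} (A : Store → ℕ → α)
    (Rest : Store → Prop) (block : ℕ → ℕ → Prop) (val : ℕ → ℕ → α)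
    (hblock : ∀ k k' p, k < K → k' < K → block k p → block k' p → k = k') (h0 : Rest s)
    (h : ∀ k < K, ∀ st, Rest st → Rest (f (st.upd r k)) ∧
      (∀ p, block k p → A (f (st.upd r k)) p = val k p) ∧
      ∀ p, ¬ block k p → A (f (st.upd r k)) p = A st p) :
    Rest (iter f r s K) ∧ (∀ k < K, ∀ p, block k p → A (iter f r s K) p = val k p) ∧
      ∀ p, (∀ k < K, ¬ block k p) → A (iter f r s K) p = A s p := by
  suffices ∀ j ≤ K, Rest (iter f r s j) ∧
      (∀ k < j, ∀ p, block k p → A (iter f r s j) p = val k p) ∧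
      ∀ p, (∀ k < j, ¬ block k p) → A (iter f r s j) p = A s p from this K le_rfl
  intro j hj
  induction j with
  | zero => exact ⟨h0, by simp, fun p _ => rfl⟩
  | succ j ih =>
    obtain ⟨ih1, ih2, ih3⟩ := ih (by omega)
    obtain ⟨h1, h2, h3⟩ := h j (by omega) _ ih1
    refine ⟨h1, fun k hk p hp => ?_, fun p hp => ?_⟩
    · by_cases hkj : k = j
      · subst hkj; exact h2 p hp
      · rw [iter, h3 p fun hp' => hkj (hblock _ _ p (by omega) (by omega) hp hp')]
        exact ih2 k (by omega) p hp
    · rw [iter, h3 p (hp j (by omega))]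
      exact ih3 p fun k hk => hp k (by omega)

/-- The stores agree, except for the array `a` and the registers in `J`. -/
structure SameA (J : List ℕ) (a : ℕ) (st s : Store) : Prop where
  reg : ∀ r, r ∉ J → st.reg r = s.reg r
  arr : ∀ a', a' ≠ a → st.arr a' = s.arr a'
  warr : st.warr = s.warr

/-- The stores agree, except for the real array `a` and the registers in `J`. -/
structure SameW (J : List ℕ) (a : ℕ) (st s : Store) : Prop where
  reg : ∀ r, r ∉ J → st.reg r = s.reg r
  arr : st.arr = s.arr
  warr : ∀ a', a' ≠ a → st.warr a' = s.warr a'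

theorem SameA.refl (J : List ℕ) (a : ℕ) (s : Store) : SameA J a s s :=
  ⟨fun _ _ => rfl, fun _ _ => rfl, rfl⟩

theorem SameW.refl (J : List ℕ) (a : ℕ) (s : Store) : SameW J a s s :=
  ⟨fun _ _ => rfl, rfl, fun _ _ => rfl⟩

theorem SameA.trans {J : List ℕ} {a : ℕ} {s t u : Store} (h : SameA J a s t)
    (h' : SameA J a t u) : SameA J a s u :=
  ⟨fun r hr => (h.reg r hr).trans (h'.reg r hr), fun b hb => (h.arr b hb).trans (h'.arr b hb),
    h.warr.trans h'.warr⟩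

theorem SameW.trans {J : List ℕ} {a : ℕ} {s t u : Store} (h : SameW J a s t)
    (h' : SameW J a t u) : SameW J a s u :=
  ⟨fun r hr => (h.reg r hr).trans (h'.reg r hr), h.arr.trans h'.arr,
    fun b hb => (h.warr b hb).trans (h'.warr b hb)⟩

theorem SameA.upd {J : List ℕ} {a r : ℕ} {s t : Store} (h : SameA J a s t) (hr : r ∈ J) (x : ℕ) :
    SameA J a (s.upd r x) t :=
  ⟨fun r' hr' => by
    rw [Store.upd_reg, if_neg (by rintro rfl; exact hr' hr)]; exact h.reg r' hr', h.arr, h.warr⟩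

theorem SameW.upd {J : List ℕ} {a r : ℕ} {s t : Store} (h : SameW J a s t) (hr : r ∈ J) (x : ℕ) :
    SameW J a (s.upd r x) t :=
  ⟨fun r' hr' => by
    rw [Store.upd_reg, if_neg (by rintro rfl; exact hr' hr)]; exact h.reg r' hr', h.arr, h.warr⟩

theorem SameA.mono {J J' : List ℕ} {a : ℕ} {s t : Store} (h : SameA J a s t) (hJ : J ⊆ J') :
    SameA J' a s t :=
  ⟨fun r hr => h.reg r fun h' => hr (hJ h'), h.arr, h.warr⟩

theorem SameW.mono {J J' : List ℕ} {a : ℕ} {s t : Store} (h : SameW J a s t) (hJ : J ⊆ J') :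
    SameW J' a s t :=
  ⟨fun r hr => h.reg r fun h' => hr (hJ h'), h.arr, h.warr⟩

/-- Once the registers in `J` are known, a term that does not read the array `a` has the same
value. -/
theorem SameA.eval {J : List ℕ} {a : ℕ} {s s' : Store} (h : SameA J a s s')
    (hJ : ∀ r ∈ J, s.reg r = s'.reg r) {t : Term} (ht : t.usesArr a = false) :
    t.eval s = t.eval s' := by
  refine t.eval_congr (funext fun r => ?_) (fun a' ha' => h.arr a' ?_) fun _ _ => by rw [h.warr]
  · by_cases hr : r ∈ J
    · exact hJ r hr
    · exact h.reg r hr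
  · rintro rfl
    simp [ht] at ha'

theorem SameW.eval {J : List ℕ} {a : ℕ} {s s' : Store} (h : SameW J a s s')
    (hJ : ∀ r ∈ J, s.reg r = s'.reg r) {t : Term} (ht : t.usesW a = false) :
    t.eval s = t.eval s' := by
  refine t.eval_congr (funext fun r => ?_) (fun _ _ => by rw [h.arr]) (fun a' ha' => h.warr a' ?_)
  · by_cases hr : r ∈ J
    · exact hJ r hr
    · exact h.reg r hr
  · rintro rfl
    simp [ht] at ha'

theorem SameA.upd_upd {J : List ℕ} {a : ℕ} {s s' : Store} (h : SameA J a s s') (r x : ℕ) :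
    SameA J a (s.upd r x) (s'.upd r x) :=
  ⟨fun r' hr' => by rw [Store.upd_reg, Store.upd_reg, h.reg r' hr'], h.arr, h.warr⟩

theorem SameW.upd_upd {J : List ℕ} {a : ℕ} {s s' : Store} (h : SameW J a s s') (r x : ℕ) :
    SameW J a (s.upd r x) (s'.upd r x) :=
  ⟨fun r' hr' => by rw [Store.upd_reg, Store.upd_reg, h.reg r' hr'], h.arr, h.warr⟩

/-! ### Loops that fill arrays, tables and tables of real sums -/

namespace Cmd

/-- `a[u + r] := t` for all `r` below register `b`. -/
def fill (a : ℕ) (u : Term) (r b : ℕ) (t : Term) : Cmd := .loop r b (.put a (.add u (.var r)) t)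

/-- Neither `t` nor `u` reads `a`, so earlier rounds do not influence later ones. The offset `u`
does not depend on the loop variable, so distinct rounds write distinct cells. -/
theorem den_fill {a r b : ℕ} {u t : Term} (ht : t.usesArr a = false) (hu : u.usesArr a = false)
    (hur : ∀ s k, u.eval (s.upd r k) = u.eval s) (s : Store) :
    SameA [r] a ((fill a u r b t).den s) s ∧
      (∀ k < s.reg b, ((fill a u r b t).den s).arr a (u.eval s + k) = t.eval (s.upd r k)) ∧
      ∀ p, (∀ k < s.reg b, p ≠ u.eval s + k) →
        ((fill a u r b t).den s).arr a p = s.arr a p := by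
  obtain ⟨h1, h2, h3⟩ := iter_blocks (f := (Cmd.put a (.add u (.var r)) t).den) (r := r)
    (K := s.reg b) (s := s) (fun st => st.arr a) (fun st => SameA [r] a st s)
    (fun k p => p = u.eval s + k) (fun k _ => t.eval (s.upd r k)) (fun k k' p _ _ h h' => by omega)
    (SameA.refl _ _ _) (by
      intro k _ st hst
      have hu' : u.eval (st.upd r k) = u.eval s := by
        rw [(hst.upd_upd r k).eval (by simp [Store.upd_reg]) hu, hur]
      have ht' : t.eval (st.upd r k) = t.eval (s.upd r k) :=
        (hst.upd_upd r k).eval (by simp [Store.upd_reg]) ht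
      have hden : (Cmd.put a (.add u (.var r)) t).den (st.upd r k) =
          (st.upd r k).updArr a (u.eval s + k) (t.eval (s.upd r k)) := by
        simp [den, Term.eval, hu', ht', Store.upd_reg]
      rw [hden]
      refine ⟨⟨fun r' hr' => ?_, fun a' ha' => ?_, hst.warr⟩, ?_, ?_⟩
      · exact (hst.upd (by simp) k).reg r' hr'
      · funext p
        rw [Store.updArr_arr, if_neg (by tauto)]
        exact congrFun (hst.arr a' ha') p
      · rintro p rfl
        simp [Store.updArr_arr]
      · intro p hp
        simp [Store.updArr_arr, hp])
  exact ⟨h1.upd (by simp) _, fun k hk => h2 k hk _ rfl, h3⟩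

/-- `a[i, j] := t` for all `i` below register `b` and `j` below register `b'`; in `t`, register `20`
contains `i` and register `21` contains `j`. -/
def table (a b b' : ℕ) (t : Term) : Cmd := .loop 20 b (fill a (.get 2 (.var 20)) 21 b' t)

/-- Array `2` contains the positions of the rows of length `Q` of tables with `Q` rows. -/
def Grid (Q : ℕ) (s : Store) : Prop := ∀ i < Q, s.arr 2 i = i * Q

/-- Division by `Q` recovers the row, provided that columns are below `Q` too. With `Q = n + c` one
grid serves tables indexed by vertices or communities on either side. -/
theorem Grid.inj {Q i i' j j' : ℕ} {s : Store} (h : Grid Q s) (hi : i < Q) (hi' : i' < Q)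
    (hj : j < Q) (hj' : j' < Q) (he : s.arr 2 i + j = s.arr 2 i' + j') : i = i' ∧ j = j' := by
  rw [h i hi, h i' hi'] at he
  have h1 : i = i' := by
    have : (j + i * Q) / Q = (j' + i' * Q) / Q := by rw [add_comm j, add_comm j', he]
    rwa [Nat.add_mul_div_right _ _ (by omega), Nat.add_mul_div_right _ _ (by omega),
      Nat.div_eq_of_lt hj, Nat.div_eq_of_lt hj', zero_add, zero_add] at this
  subst h1
  exact ⟨rfl, by omega⟩

theorem den_table {Q a b b' : ℕ} {t : Term} {s : Store} (hQ : Grid Q s) (hb : s.reg b ≤ Q)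
    (hb' : s.reg b' ≤ Q) (ht : t.usesArr a = false := by rfl) (ha : a ≠ 2 := by decide)
    (hbn : b ≠ 20 ∧ b ≠ 21 ∧ b' ≠ 20 ∧ b' ≠ 21 := by decide) :
    SameA [20, 21] a ((table a b b' t).den s) s ∧
      ∀ i < s.reg b, ∀ j < s.reg b',
        ((table a b b' t).den s).arr a (s.arr 2 i + j) = t.eval ((s.upd 20 i).upd 21 j) := by
  have hu : (Term.get 2 (.var 20)).usesArr a = false := by
    simp [Term.usesArr, ha.symm]
  obtain ⟨h1, h2, -⟩ := iter_blocks (f := (fill a (.get 2 (.var 20)) 21 b' t).den) (r := 20)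
    (K := s.reg b) (s := s) (fun st => st.arr a) (fun st => SameA [20, 21] a st s)
    (fun i p => ∃ j < s.reg b', p = s.arr 2 i + j)
    -- Round `i` writes row `i`; the column is recovered from the position by subtracting the start
    -- of the row.
    (fun i p => t.eval ((s.upd 20 i).upd 21 (p - s.arr 2 i)))
    (fun i i' p hi hi' h h' => by
      obtain ⟨j, hj, rfl⟩ := h
      obtain ⟨j', hj', h⟩ := h'
      exact (hQ.inj (by omega) (by omega) (by omega) (by omega) h).1)
    (SameA.refl _ _ _) (by
      intro i _ st hst
      obtain ⟨g1, g2, g3⟩ := den_fill (b := b') ht hu (r := 21)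
        (by intro s k; simp [Term.eval, Store.upd_reg]) (st.upd 20 i)
      have hst' : SameA [20, 21] a (st.upd 20 i) s := hst.upd (by simp) i
      have hreg : (st.upd 20 i).reg b' = s.reg b' := hst'.reg b' (by simp; tauto)
      have hbase : (Term.get 2 (.var 20)).eval (st.upd 20 i) = s.arr 2 i := by
        simp [Term.eval, Store.upd_reg, hst.arr 2 ha.symm]
      rw [hreg, hbase] at g2 g3
      refine ⟨(g1.mono (by simp)).trans hst', ?_, ?_⟩
      · rintro p ⟨j, hj, rfl⟩
        rw [g2 j hj, Nat.add_sub_cancel_left]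
        refine ((hst.upd_upd 20 i).upd_upd 21 j).eval ?_ ht
        simp [Store.upd_reg]
      · intro p hp
        rw [g3 p fun j hj hp' => hp ⟨j, hj, hp'⟩]
        rfl)
  refine ⟨h1.upd (by simp) _, fun i hi j hj => ?_⟩
  have := h2 i hi _ ⟨j, hj, rfl⟩
  rwa [Nat.add_sub_cancel_left] at this

/-- Put into cell `u` of the real array `a` the sum of the entries `v` of the real array `a'` over
all values of `r` below register `b` for which `t` is true. -/
def wsum (a : ℕ) (u : Term) (r b : ℕ) (t : Term) (a' : ℕ) (v : Term) : Cmd :=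
  .seq (.wzero a u) (.loop r b (.ite t (.wadd a u a' v)))

open Classical in
theorem den_wsum {a a' r b : ℕ} {u t v : Term} (ht : t.usesW a = false) (hv : v.usesW a = false)
    (hu : u.usesW a = false) (haa : a' ≠ a) (hur : ∀ s k, u.eval (s.upd r k) = u.eval s)
    (s : Store) :
    SameW [r] a ((wsum a u r b t a' v).den s) s ∧
      ((wsum a u r b t a' v).den s).warr a (u.eval s) =
        ∑ k ∈ Finset.range (s.reg b), (if t.Holds (s.upd r k) then
          s.warr a' (v.eval (s.upd r k)) else 0) ∧
      ∀ p, p ≠ u.eval s → ((wsum a u r b t a' v).den s).warr a p = s.warr a p := by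
  have hs : SameW [r] a (s.updW a (u.eval s) 0) s := by
    refine ⟨fun _ _ => rfl, rfl, fun b hb => ?_⟩
    funext p
    rw [Store.updW_warr, if_neg (by tauto)]
  have key := iter_induct (f := (Cmd.ite t (.wadd a u a' v)).den) (r := r) (K := s.reg b)
    (s := s.updW a (u.eval s) 0) (fun k st => SameW [r] a st s ∧
      st.warr a (u.eval s) = ∑ k ∈ Finset.range k, (if t.Holds (s.upd r k) then
          s.warr a' (v.eval (s.upd r k)) else 0) ∧
      ∀ p, p ≠ u.eval s → st.warr a p = s.warr a p)
    ⟨hs, by simp [Store.updW_warr], fun p hp => by simp [Store.updW_warr, hp]⟩ (by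
      rintro k hk st ⟨h1, h2, h3⟩
      have h1' : SameW [r] a (st.upd r k) s := h1.upd (by simp) k
      have hu' : u.eval (st.upd r k) = u.eval s := by
        rw [(h1.upd_upd r k).eval (by simp [Store.upd_reg]) hu, hur]
      have ht' : t.eval (st.upd r k) = t.eval (s.upd r k) :=
        (h1.upd_upd r k).eval (by simp [Store.upd_reg]) ht
      have hv' : v.eval (st.upd r k) = v.eval (s.upd r k) :=
        (h1.upd_upd r k).eval (by simp [Store.upd_reg]) hv
      rw [Finset.sum_range_succ, ← h2]
      by_cases h : t.eval (s.upd r k) = 0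
      · have hden : (Cmd.ite t (.wadd a u a' v)).den (st.upd r k) = st.upd r k := by
          simp [den, ht', h]
        rw [hden]
        refine ⟨h1', ?_, h3⟩
        simp [Term.Holds, h]
      · have hden : (Cmd.ite t (.wadd a u a' v)).den (st.upd r k) =
            (st.upd r k).updW a (u.eval s)
              (st.warr a (u.eval s) + s.warr a' (v.eval (s.upd r k))) := by
          simp [den, ht', h, hu', hv', h1.warr a' haa]
        rw [hden]
        refine ⟨⟨h1'.reg, h1'.arr, fun b hb => ?_⟩, ?_, fun p hp => ?_⟩
        · funext p
          rw [Store.updW_warr, if_neg (by tauto)]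
          exact congrFun (h1'.warr b hb) p
        · simp [Store.updW_warr, Term.Holds, h]
        · rw [Store.updW_warr, if_neg (by tauto)]
          exact h3 p hp)
  have hden : (wsum a u r b t a' v).den s = (iter (Cmd.ite t (.wadd a u a' v)).den r
      (s.updW a (u.eval s) 0) (s.reg b)).upd r (s.reg b) := rfl
  rw [hden]
  exact ⟨key.1.upd (by simp) _, key.2.1, key.2.2⟩

/-- `wsum` for all cells `u + r` with `r` below register `b`, summing over `r'`. -/
def wfill (a : ℕ) (u : Term) (r b r' b' : ℕ) (t : Term) (a' : ℕ) (v : Term) : Cmd :=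
  .loop r b (wsum a (.add u (.var r)) r' b' t a' v)

open Classical in
theorem den_wfill {a a' r b r' b' : ℕ} {u t v : Term} (ht : t.usesW a = false)
    (hv : v.usesW a = false) (hu : u.usesW a = false) (haa : a' ≠ a)
    (hur : ∀ s k, u.eval (s.upd r k) = u.eval s) (hur' : ∀ s k, u.eval (s.upd r' k) = u.eval s)
    (hrr : r ≠ r') (hb : b' ≠ r ∧ b' ≠ r') (s : Store) :
    SameW [r, r'] a ((wfill a u r b r' b' t a' v).den s) s ∧
      (∀ k < s.reg b, ((wfill a u r b r' b' t a' v).den s).warr a (u.eval s + k) =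
        ∑ l ∈ Finset.range (s.reg b'), (if t.Holds ((s.upd r k).upd r' l) then
          s.warr a' (v.eval ((s.upd r k).upd r' l)) else 0)) ∧
      ∀ p, (∀ k < s.reg b, p ≠ u.eval s + k) →
        ((wfill a u r b r' b' t a' v).den s).warr a p = s.warr a p := by
  obtain ⟨h1, h2, h3⟩ := iter_blocks (f := (wsum a (.add u (.var r)) r' b' t a' v).den) (r := r)
    (K := s.reg b) (s := s) (fun st => st.warr a) (fun st => SameW [r, r'] a st s)
    (fun k p => p = u.eval s + k) (fun k _ => ∑ l ∈ Finset.range (s.reg b'),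
      (if t.Holds ((s.upd r k).upd r' l) then s.warr a' (v.eval ((s.upd r k).upd r' l)) else 0))
    (fun k k' p _ _ h h' => by omega) (SameW.refl _ _ _) (by
      intro k _ st hst
      obtain ⟨g1, g2, g3⟩ := den_wsum (b := b') (r := r') ht hv (u := .add u (.var r))
        (by simpa [Term.usesW] using hu) haa
        (by intro s k; simp [Term.eval, Store.upd_reg, hur', hrr]) (st.upd r k)
      have hst' : SameW [r, r'] a (st.upd r k) s := hst.upd (by simp) k
      have hreg : (st.upd r k).reg b' = s.reg b' := hst'.reg b' (by simp; tauto)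
      have hbase : (Term.add u (.var r)).eval (st.upd r k) = u.eval s + k := by
        have : u.eval (st.upd r k) = u.eval s := by
          -- The two stores may differ in `r` and `r'`. As `u` depends on neither, both registers
          -- are overwritten by equal values before the comparison.
          rw [← hur' _ 0, ← hur' s 0, ← hur (s.upd r' 0) k]
          refine SameW.eval (J := [r, r']) (a := a) ?_ ?_ hu
          · refine (hst'.upd (by simp) 0).trans ?_
            exact ⟨fun x hx => by
              simp only [List.mem_cons, List.not_mem_nil, or_false, not_or] at hx
              rw [Store.upd_reg, if_neg hx.1, Store.upd_reg, if_neg hx.2], rfl, fun _ _ => rfl⟩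
          · simp [Store.upd_reg, hrr, hrr.symm]
        simp [Term.eval, Store.upd_reg, this]
      rw [hreg, hbase] at g2
      rw [hbase] at g3
      refine ⟨(g1.mono (by simp)).trans hst', ?_, ?_⟩
      · rintro p rfl
        rw [g2]
        refine Finset.sum_congr rfl fun l _ => ?_
        have hsame := (hst.upd_upd r k).upd_upd r' l
        have hJ : ∀ x ∈ [r, r'], ((st.upd r k).upd r' l).reg x = ((s.upd r k).upd r' l).reg x := by
          simp [Store.upd_reg]
        have e1 := hsame.eval hJ ht
        have e2 := hsame.eval hJ hv
        refine if_congr (by rw [Term.Holds, Term.Holds, e1]) ?_ rfl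
        rw [e2, Store.upd_warr, hst.warr a' haa]
      · intro p hp
        rw [g3 p hp]
        rfl)
  exact ⟨h1.upd (by simp) _, fun k hk => h2 k hk _ rfl, h3⟩

/-- `wsum` for all entries of a table. -/
def wtable (a b b' b'' : ℕ) (t : Term) (a' : ℕ) (v : Term) : Cmd :=
  .loop 20 b (wfill a (.get 2 (.var 20)) 21 b' 22 b'' t a' v)

open Classical in
theorem den_wtable {Q a a' b b' b'' : ℕ} {t v : Term} {s : Store} (hQ : Grid Q s)
    (hb : s.reg b ≤ Q) (hb' : s.reg b' ≤ Q) (ht : t.usesW a = false := by rfl)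
    (hv : v.usesW a = false := by rfl) (haa : a' ≠ a := by decide)
    (hbn : (b' ≠ 20 ∧ b' ≠ 21 ∧ b' ≠ 22) ∧ b'' ≠ 20 ∧ b'' ≠ 21 ∧ b'' ≠ 22 := by decide) :
    SameW [20, 21, 22] a ((wtable a b b' b'' t a' v).den s) s ∧
      ∀ i < s.reg b, ∀ j < s.reg b',
        ((wtable a b b' b'' t a' v).den s).warr a (s.arr 2 i + j) =
          ∑ l ∈ Finset.range (s.reg b''), (if t.Holds (((s.upd 20 i).upd 21 j).upd 22 l) then
            s.warr a' (v.eval (((s.upd 20 i).upd 21 j).upd 22 l)) else 0) := by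
  obtain ⟨h1, h2, -⟩ := iter_blocks
    (f := (wfill a (.get 2 (.var 20)) 21 b' 22 b'' t a' v).den) (r := 20)
    (K := s.reg b) (s := s) (fun st => st.warr a) (fun st => SameW [20, 21, 22] a st s)
    (fun i p => ∃ j < s.reg b', p = s.arr 2 i + j)
    (fun i p => ∑ l ∈ Finset.range (s.reg b''),
      (if t.Holds (((s.upd 20 i).upd 21 (p - s.arr 2 i)).upd 22 l) then
        s.warr a' (v.eval (((s.upd 20 i).upd 21 (p - s.arr 2 i)).upd 22 l)) else 0))
    (fun i i' p hi hi' h h' => by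
      obtain ⟨j, hj, rfl⟩ := h
      obtain ⟨j', hj', h⟩ := h'
      exact (hQ.inj (by omega) (by omega) (by omega) (by omega) h).1)
    (SameW.refl _ _ _) (by
      intro i _ st hst
      obtain ⟨g1, g2, g3⟩ := den_wfill (b := b') (b' := b'') (r := 21) (r' := 22)
        (u := .get 2 (.var 20)) ht hv rfl haa
        (by intro s k; simp [Term.eval, Store.upd_reg])
        (by intro s k; simp [Term.eval, Store.upd_reg]) (by decide) hbn.2.2 (st.upd 20 i)
      have hst' : SameW [20, 21, 22] a (st.upd 20 i) s := hst.upd (by simp) i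
      have hreg : (st.upd 20 i).reg b' = s.reg b' := hst'.reg b' (by simp; tauto)
      have hreg' : (st.upd 20 i).reg b'' = s.reg b'' := hst'.reg b'' (by simp; tauto)
      have hbase : (Term.get 2 (.var 20)).eval (st.upd 20 i) = s.arr 2 i := by
        simp [Term.eval, Store.upd_reg, hst.arr]
      rw [hreg, hbase] at g2 g3
      rw [hreg'] at g2
      refine ⟨(g1.mono (by simp)).trans hst', ?_, ?_⟩
      · rintro p ⟨j, hj, rfl⟩
        rw [g2 j hj, Nat.add_sub_cancel_left]
        refine Finset.sum_congr rfl fun l _ => ?_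
        have hsame := ((hst.upd_upd 20 i).upd_upd 21 j).upd_upd 22 l
        have hJ : ∀ x ∈ [20, 21, 22], (((st.upd 20 i).upd 21 j).upd 22 l).reg x =
            (((s.upd 20 i).upd 21 j).upd 22 l).reg x := by
          simp [Store.upd_reg]
        have e1 := hsame.eval hJ ht
        have e2 := hsame.eval hJ hv
        refine if_congr (by rw [Term.Holds, Term.Holds, e1]) ?_ rfl
        rw [e2, Store.upd_warr, hst.warr a' haa]
      · intro p hp
        rw [g3 p fun j hj hp' => hp ⟨j, hj, hp'⟩]
        rfl)
  refine ⟨h1.upd (by simp) _, fun i hi j hj => ?_⟩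
  have := h2 i hi _ ⟨j, hj, rfl⟩
  rwa [Nat.add_sub_cancel_left] at this

end Cmd

end RAM

/-! ### Choosing centres when the edges in short cycles are known -/

namespace SpanningStars

open Finset

variable {V ι : Type*} [DecidableEq V] (G S : SimpleGraph V) (C : ι → Finset V)

/-- `z` can be the centre of community `i` in a subgraph of `G` in which all edges in triangles and
4-cycles belong to `S`. -/
def Cand (i : ι) (z : V) : Prop :=
  z ∈ C i ∧ (∀ w ∈ C i, w ≠ z → G.Adj z w) ∧
    ∀ u ∈ C i, ∀ v ∈ C i, S.Adj u v → u ≠ z → v ≠ z → S.Adj z u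

/-- Some candidate of `i` is joined by `S` to all other common members of `i` and `j`. -/
def Free (i j : ι) : Prop :=
  ∃ z, Cand G S C i z ∧ ∀ w, w ∈ C i → w ∈ C j → w ≠ z → S.Adj z w

/-- The communities must have the same centre. -/
def Tied (i j : ι) : Prop := 3 ≤ #(C i ∩ C j) ∧ ¬ Free G S C i j

/-- The communities must have their centres in their intersection, which has two elements. -/
def Linked (i j : ι) : Prop := #(C i ∩ C j) = 2 ∧ ¬ Free G S C i j

/-- `z` is a candidate of `i` that respects the links of `i`. -/
def LinkCand (i : ι) (z : V) : Prop :=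
  Cand G S C i z ∧ ∀ j, Linked G S C i j → z ∈ C j

/-- The communities that must have the same centre, directly or indirectly. -/
abbrev Group : ι → ι → Prop := Relation.EqvGen (Tied G S C)

/-- `z` can be the common centre of the group of `i`. -/
def GroupCand (i : ι) (z : V) : Prop :=
  ∀ j, Group G S C i j → LinkCand G S C j z

/-- `w` belongs to some community in the group of `i`. -/
def GroupMem (i : ι) (w : V) : Prop := ∃ j, Group G S C i j ∧ w ∈ C j

section cost

open Classical

variable [Fintype V]

/-- The leaves for which the star of the group of `i` with centre `z` needs edges outside `S`. -/
noncomputable def leaves (i : ι) (z : V) : Finset V :=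
  univ.filter fun w => GroupMem G S C i w ∧ w ≠ z ∧ ¬ S.Adj z w

/-- The edges outside `S` of the star of the group of `i` with centre `z`. -/
noncomputable def starEdges (i : ι) (z : V) : Finset (Sym2 V) :=
  (leaves G S C i z).image fun w => s(z, w)

noncomputable def cost (f : Sym2 V → ℝ) (i : ι) (z : V) : ℝ :=
  ∑ w ∈ leaves G S C i z, f s(z, w)

/-- `z` is the first among the cheapest centres of the group of `i`. -/
def Chosen {n : ℕ} (G S : SimpleGraph (Fin n)) (C : ι → Finset (Fin n)) (f : Sym2 (Fin n) → ℝ)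
    (i : ι) (z : Fin n) : Prop :=
  GroupCand G S C i z ∧ ∀ y, GroupCand G S C i y →
    cost G S C f i z ≤ cost G S C f i y ∧ (cost G S C f i y ≤ cost G S C f i z → z ≤ y)

/-- The edges forced by the links of the group of `i`. -/
noncomputable def linkEdges [Fintype ι] (i : ι) : Finset (Sym2 V) :=
  univ.filter fun e => ∃ j k p q, Group G S C i j ∧ Linked G S C j k ∧ C j ∩ C k = {p, q} ∧
    e = s(p, q) ∧ ¬ S.Adj p q

end cost

/-- `H` with the centres `z` is a solution in which all edges in triangles and 4-cycles belong
to `S`. -/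
structure Certificate (H : SimpleGraph V) (z : ι → V) : Prop where
  le : H ≤ G
  mem : ∀ i, z i ∈ C i
  adj : ∀ i, ∀ w ∈ C i, w ≠ z i → H.Adj (z i) w
  le_H : S ≤ H
  triangle : ∀ a b c, H.Adj a b → H.Adj b c → H.Adj c a → S.Adj a b
  square : ∀ a b c d, a ≠ c → b ≠ d → H.Adj a b → H.Adj b c → H.Adj c d → H.Adj d a → S.Adj a b

/-! ### Candidates, freeness and groups, without reference to a solution -/

variable {G S C}

/-- The third clause of `Cand` carries `S`-edges from one candidate to another: an `S`-edge between
two members other than `z` forces `S`-edges from `z` to both. So freeness holds for all candidates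
as soon as it holds for one, and it can be decided before the centre is known. -/
theorem Cand.of_free {i j : ι} (hcard : 2 ≤ #(C i ∩ C j)) {y z w : V} (hy : Cand G S C i y)
    (h : ∀ w, w ∈ C i → w ∈ C j → w ≠ y → S.Adj y w) (hz : Cand G S C i z) (hwi : w ∈ C i)
    (hwj : w ∈ C j) (hwz : w ≠ z) : S.Adj z w := by
  by_cases hyz : y = z
  · subst hyz
    exact h w hwi hwj hwz
  by_cases hwy : w = y
  · subst hwy
    by_cases hzj : z ∈ C j
    · exact (h z hz.1 hzj (Ne.symm hwz)).symm
    -- Here `w` is the old candidate and `z` is outside `C j`. A second common member `u` is needed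
    -- to supply an `S`-edge at `w` that avoids `z`.
    · obtain ⟨u, hu, huw⟩ : ∃ u ∈ C i ∩ C j, u ≠ w := exists_mem_ne (by omega) w
      rw [mem_inter] at hu
      have huz : u ≠ z := by
        rintro rfl
        exact hzj hu.2
      exact hz.2.2 w hwi u hu.1 (h u hu.1 hu.2 huw) hwz huz
  · exact hz.2.2 w hwi y hy.1 (h w hwi hwj hwy).symm hwz hyz

theorem not_free_of_mem {i j : ι} (hcard : 2 ≤ #(C i ∩ C j)) {z w : V} (hz : Cand G S C i z)
    (hwi : w ∈ C i) (hwj : w ∈ C j) (hwz : w ≠ z) (hS : ¬ S.Adj z w) : ¬ Free G S C i j := by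
  rintro ⟨y, hy, h⟩
  exact hS (hy.of_free hcard h hz hwi hwj hwz)

theorem GroupCand.of_group {i j : ι} {z : V} (h : GroupCand G S C i z)
    (hij : Group G S C i j) : GroupCand G S C j z :=
  fun k hk => h k (.trans _ _ _ hij hk)

theorem groupMem_congr {i j : ι} (hij : Group G S C i j) (w : V) :
    GroupMem G S C i w ↔ GroupMem G S C j w :=
  ⟨fun ⟨k, hk, hw⟩ => ⟨k, .trans _ _ _ (.symm _ _ hij) hk, hw⟩,
    fun ⟨k, hk, hw⟩ => ⟨k, .trans _ _ _ hij hk, hw⟩⟩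

theorem groupCand_congr {i j : ι} (hij : Group G S C i j) (z : V) :
    GroupCand G S C i z ↔ GroupCand G S C j z :=
  ⟨fun h => h.of_group hij, fun h => h.of_group (.symm _ _ hij)⟩

/-- Within a group, the number of vertices joined by `S` to the centre does not depend on the
centre. -/
theorem card_leaves_le [Fintype V] {i : ι} {y z : V} (hy : GroupCand G S C i y)
    (hz : GroupCand G S C i z) : #(leaves G S C i y) ≤ #(leaves G S C i z) := by
  classical
  set U : Finset V := univ.filter (GroupMem G S C i) with hU
  have key (x : V) : leaves G S C i x = U \ univ.filter (fun w => w = x ∨ S.Adj x w) := by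
    ext w
    simp [leaves, hU]
  have hyU : y ∈ U := by simpa [hU] using ⟨i, .refl _, (hy i (.refl _)).1.1⟩
  have hzU : z ∈ U := by simpa [hU] using ⟨i, .refl _, (hz i (.refl _)).1.1⟩
  -- If `y` and `z` are joined in `S`, their closed `S`-neighbourhoods in `U` are comparable: both
  -- centres lie in every community of the group, and an `S`-edge `zw` inside one of them forces the
  -- edge `yw`.
  have hsub : S.Adj y z → ∀ w ∈ U, w = z ∨ S.Adj z w → w = y ∨ S.Adj y w := by
    rintro hyz w hw (rfl | hzw)
    · exact .inr hyz
    · by_cases hwy : w = y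
      · exact .inl hwy
      obtain ⟨j, hj, hwj⟩ : GroupMem G S C i w := by simpa [hU] using hw
      exact .inr ((hy j hj).1.2.2 w hwj z (hz j hj).1.1 hzw.symm hwy hyz.ne')
  by_cases hyz : y = z
  · rw [hyz]
  by_cases h : S.Adj y z
  · rw [key, key]
    refine card_le_card fun w hw => ?_
    simp only [mem_sdiff, mem_filter, mem_univ, true_and] at hw ⊢
    exact ⟨hw.1, fun h' => hw.2 (hsub h w hw.1 h')⟩
  -- If they are not joined, `z` has no `S`-neighbour in `U`: such a neighbour shares a community of
  -- the group with `z`, and candidacy of `y` there would join `y` to `z`. So `z` has the largest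
  -- possible number of leaves.
  · have hz' : leaves G S C i z = U \ {z} := by
      rw [key]
      ext w
      simp only [mem_sdiff, mem_filter, mem_univ, true_and, mem_singleton]
      refine and_congr_right fun hw => not_congr ⟨?_, .inl⟩
      rintro (rfl | hzw)
      · rfl
      exfalso
      have hwy : w ≠ y := by
        rintro rfl
        exact h hzw.symm
      obtain ⟨j, hj, hwj⟩ : GroupMem G S C i w := by simpa [hU] using hw
      exact h ((hy j hj).1.2.2 z (hz j hj).1.1 w hwj hzw (Ne.symm hyz) hwy)
    rw [hz', key, card_sdiff_of_subset (t := U) (s := {z}) (singleton_subset_iff.2 hzU), card_singleton]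
    have : U \ univ.filter (fun w => w = y ∨ S.Adj y w) ⊆ U \ {y} := by
      refine sdiff_subset_sdiff le_rfl ?_
      simp
    refine (card_le_card this).trans ?_
    rw [card_sdiff_of_subset (singleton_subset_iff.2 hyU), card_singleton]

/-! ### What a solution imposes on its centres, and the comparison of costs -/

section Certificate

variable {H : SimpleGraph V} {z : ι → V}

omit [DecidableEq V] in
theorem Certificate.cand (h : Certificate G S C H z) (i : ι) : Cand G S C i (z i) := by
  refine ⟨h.mem i, fun w hw hwz => h.le (h.adj i w hw hwz), fun u hu v hv huv huz hvz => ?_⟩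
  -- The centre and two leaves joined by an edge of `S` form a triangle of `H`.
  exact h.triangle _ _ _ (h.adj i u hu huz) (h.le_H huv) (h.adj i v hv hvz).symm

/-- Both centres are joined in `H` to all other common members, so distinct centres create triangles
or 4-cycles through each edge from `z i` to a common member. This makes `z i` a witness of freeness.
Only when the intersection is exactly the pair of centres need no short cycle arise. -/
theorem Certificate.eq_or_inter_eq (h : Certificate G S C H z) {i j : ι}
    (hcard : 2 ≤ #(C i ∩ C j)) (hF : ¬ Free G S C i j) :
    z i = z j ∨ C i ∩ C j = {z i, z j} := by
  by_contra! hne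
  obtain ⟨hij, hne⟩ := hne
  refine hF ⟨z i, h.cand i, fun w hwi hwj hwz => ?_⟩
  have hw : w ∈ C i ∩ C j := mem_inter.2 ⟨hwi, hwj⟩
  by_cases hwj' : w = z j
  -- The edge between the two centres: a common member different from both closes a triangle over
  -- it.
  · have : ∃ u ∈ C i ∩ C j, u ≠ z i ∧ u ≠ z j := by
      by_contra! hcon
      refine hne (eq_of_subset_of_card_le (fun u hu => ?_) ?_)
      · have := hcon u hu
        simp only [mem_insert, mem_singleton]
        tauto
      · rw [card_pair hij]; exact hcard
    obtain ⟨u, hu, hui, huj⟩ := this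
    rw [mem_inter] at hu
    have hzw := h.adj i w hwi hwz
    have h2 := h.adj j u hu.2 huj
    rw [← hwj'] at h2
    exact h.triangle _ _ _ hzw h2 (h.adj i u hu.1 hui).symm
  -- For `w` different from both centres, take any second common member `u`. It gives a triangle if
  -- it is one of the centres and the 4-cycle `z i, w, z j, u` otherwise.
  · obtain ⟨u, hu, huw⟩ : ∃ u ∈ C i ∩ C j, u ≠ w := exists_mem_ne (by omega) w
    have hu' := mem_inter.1 hu
    have hiw := h.adj i w hwi hwz
    have hjw := h.adj j w hwj hwj'
    by_cases hui : u = z i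
    · have hju := h.adj j u hu'.2 (hui ▸ hij)
      rw [hui] at hju
      exact h.triangle _ _ _ hiw hjw.symm hju
    by_cases huj : u = z j
    · have hiu := h.adj i u hu'.1 hui
      rw [huj] at hiu
      exact h.triangle _ _ _ hiw hjw.symm hiu.symm
    · exact h.square _ _ _ _ hij huw.symm hiw hjw.symm (h.adj j u hu'.2 huj)
        (h.adj i u hu'.1 hui).symm

theorem Certificate.eq_of_tied (h : Certificate G S C H z) {i j : ι} (hij : Tied G S C i j) :
    z i = z j := by
  have h3 := hij.1
  refine (h.eq_or_inter_eq (by omega) hij.2).resolve_right fun hc => ?_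
  rw [hc] at h3
  have := card_le_two (a := z i) (b := z j)
  omega

theorem Certificate.eq_of_group (h : Certificate G S C H z) {i j : ι} (hij : Group G S C i j) :
    z i = z j := by
  induction hij with
  | rel _ _ h' => exact h.eq_of_tied h'
  | refl _ => rfl
  | symm _ _ _ ih => exact ih.symm
  | trans _ _ _ _ _ ih ih' => exact ih.trans ih'

theorem Certificate.groupCand (h : Certificate G S C H z) (i : ι) :
    GroupCand G S C i (z i) := by
  intro j hij
  rw [h.eq_of_group hij]
  refine ⟨h.cand j, fun k hk => ?_⟩
  -- Both alternatives, equal centres and an intersection made of the two centres, place the centre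
  -- of `j` in `C k`.
  rcases h.eq_or_inter_eq (by rw [hk.1]) hk.2 with he | he
  · rw [he]; exact h.mem k
  · have : z j ∈ C j ∩ C k := by rw [he]; simp
    exact (mem_inter.1 this).2

variable [Fintype V]

theorem mem_starEdges {i : ι} {y : V} {e : Sym2 V} :
    e ∈ starEdges G S C i y ↔ ∃ w, (GroupMem G S C i w ∧ w ≠ y ∧ ¬ S.Adj y w) ∧ s(y, w) = e := by
  simp [starEdges, leaves]

theorem sum_starEdges (f : Sym2 V → ℝ) (i : ι) (y : V) :
    ∑ e ∈ starEdges G S C i y, f e = cost G S C f i y := by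
  rw [starEdges, sum_image, cost]
  exact fun a _ b _ hab => Sym2.congr_right.1 hab

theorem starEdges_congr {i j : ι} (hij : Group G S C i j) (y : V) :
    starEdges G S C i y = starEdges G S C j y := by
  ext e
  simp only [mem_starEdges, groupMem_congr hij]

omit [DecidableEq V] [Fintype V] in
theorem sum_biUnion_le_sum {κ : Type*} (R : Finset ι) (t : ι → Finset κ)
    [DecidableEq κ] {f : κ → ℝ} (hf : ∀ e, 0 ≤ f e) :
    ∑ e ∈ R.biUnion t, f e ≤ ∑ i ∈ R, ∑ e ∈ t i, f e := by
  classical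
  induction R using Finset.induction_on with
  | empty => simp
  | insert i R hi ih =>
    rw [biUnion_insert, sum_insert hi]
    refine le_trans ?_ (add_le_add_right ih _)
    rw [← sum_union_inter]
    exact le_add_of_nonneg_right (sum_nonneg fun e _ => hf e)

variable [Fintype ι]

theorem mem_linkEdges {i : ι} {e : Sym2 V} :
    e ∈ linkEdges G S C i ↔ ∃ j k p q, Group G S C i j ∧ Linked G S C j k ∧
      C j ∩ C k = {p, q} ∧ e = s(p, q) ∧ ¬ S.Adj p q := by
  simp [linkEdges]

/-- A link confines `y` to the pair `{p, q}`. Whichever of the two `y` is, the other one belongs to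
a community of the group, so the star of `y` contains the edge `pq`. -/
theorem linkEdges_subset {i : ι} {y : V} (hy : GroupCand G S C i y) :
    linkEdges G S C i ⊆ starEdges G S C i y := by
  intro e he
  obtain ⟨j, k, p, q, hij, hjk, hpq, rfl, hS⟩ := mem_linkEdges.1 he
  have hyj := hy j hij
  have hyk : y ∈ C j ∩ C k := mem_inter.2 ⟨hyj.1.1, hyj.2 k hjk⟩
  have hp : p ∈ C j ∩ C k := by rw [hpq]; simp
  have hq : q ∈ C j ∩ C k := by rw [hpq]; simp
  have hne : p ≠ q := by
    rintro rfl
    have := hjk.1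
    rw [hpq] at this
    simp at this
  rw [mem_inter] at hp hq
  rw [mem_starEdges]
  rw [hpq, mem_insert, mem_singleton] at hyk
  rcases hyk with rfl | rfl
  · exact ⟨q, ⟨⟨j, hij, hq.1⟩, hne.symm, hS⟩, rfl⟩
  · exact ⟨p, ⟨⟨j, hij, hp.1⟩, hne, fun h => hS h.symm⟩, Sym2.eq_swap⟩

/-- Two communities whose stars share an edge contain both of its ends. Since the edge is not in
`S`, the pair is not free. A third common member would tie the communities into one group, so the
intersection is exactly this edge. -/
theorem Certificate.mem_linkEdges (h : Certificate G S C H z) {i j : ι} {e : Sym2 V}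
    (hi : e ∈ starEdges G S C i (z i)) (hj : e ∈ starEdges G S C j (z j))
    (hij : ¬ Group G S C i j) : e ∈ linkEdges G S C i := by
  obtain ⟨w, ⟨⟨i', hi', hw⟩, hwz, hS⟩, rfl⟩ := mem_starEdges.1 hi
  obtain ⟨w', ⟨⟨j', hj', hw'⟩, hwz', hS'⟩, hww⟩ := mem_starEdges.1 hj
  rw [h.eq_of_group hi'] at hwz hww hS ⊢
  rw [h.eq_of_group hj'] at hwz' hww hS'
  have hmem : z i' ∈ C j' ∧ w ∈ C j' := by
    rw [Sym2.eq_iff] at hww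
    rcases hww with ⟨h1, h2⟩ | ⟨h1, h2⟩
    · rw [← h1, ← h2]; exact ⟨h.mem j', hw'⟩
    · rw [← h1, ← h2]; exact ⟨hw', h.mem j'⟩
  have hsub : {z i', w} ⊆ C i' ∩ C j' := by
    intro x hx
    rw [mem_insert, mem_singleton] at hx
    rcases hx with rfl | rfl
    · exact mem_inter.2 ⟨h.mem i', hmem.1⟩
    · exact mem_inter.2 ⟨hw, hmem.2⟩
  have hcard : 2 ≤ #(C i' ∩ C j') := by
    rw [← card_pair hwz.symm]
    exact card_le_card hsub
  have hF : ¬ Free G S C i' j' := not_free_of_mem hcard (h.cand i') hw hmem.2 hwz hS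
  have h2 : #(C i' ∩ C j') = 2 := by
    by_contra h2
    refine hij (.trans _ _ _ hi' (.trans _ _ _ (.rel _ _ ⟨by omega, hF⟩) (.symm _ _ hj')))
  refine SpanningStars.mem_linkEdges.2 ⟨i', j', z i', w, hi', ⟨h2, hF⟩, ?_, rfl, hS⟩
  exact (eq_of_subset_of_card_le hsub (by rw [h2, card_pair hwz.symm])).symm

/-- Cheaper centres of the groups give a cheaper union of stars. -/
theorem Certificate.sum_biUnion_le (h : Certificate G S C H z) {y : ι → V}
    (hy : ∀ i, GroupCand G S C i (y i)) (hyg : ∀ i j, Group G S C i j → y i = y j)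
    {f : Sym2 V → ℝ} (hf : ∀ e, 0 ≤ f e)
    (hc : ∀ i, cost G S C f i (y i) ≤ cost G S C f i (z i)) :
    ∑ e ∈ univ.biUnion (fun i => starEdges G S C i (y i)), f e ≤
      ∑ e ∈ univ.biUnion (fun i => starEdges G S C i (z i)), f e := by
  classical
  let st : Setoid ι := ⟨Group G S C, .refl, .symm _ _, .trans _ _ _⟩
  -- All communities of a group have the same star, so one representative per group suffices and
  -- costs can be summed over `R`.
  let rep : ι → ι := fun i => (Quotient.mk st i).out
  have hrep (i : ι) : Group G S C i (rep i) :=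
    .symm _ _ (Quotient.exact (Quotient.out_eq (Quotient.mk st i)))
  have hrep_eq {i j : ι} (hij : Group G S C i j) : rep i = rep j := by
    have : Quotient.mk st i = Quotient.mk st j := Quotient.sound hij
    simp only [rep, this]
  set R : Finset ι := univ.image rep with hR
  have hmemR (i : ι) : rep i ∈ R := mem_image_of_mem _ (mem_univ i)
  have hRR {i j : ι} (hi : i ∈ R) (hj : j ∈ R) (hij : Group G S C i j) : i = j := by
    obtain ⟨i, -, rfl⟩ := mem_image.1 hi
    obtain ⟨j, -, rfl⟩ := mem_image.1 hj
    exact hrep_eq (.trans _ _ _ (hrep i) (.trans _ _ _ hij (.symm _ _ (hrep j))))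
  set M : Finset (Sym2 V) := R.biUnion (linkEdges G S C) with hM
  set L := linkEdges G S C with hL
  have hz := h.groupCand
  -- The forced part `M` is the same for every admissible choice of centres; only the rest depends
  -- on `x`.
  have split (x : ι → V) (hx : ∀ i, GroupCand G S C i (x i))
      (hxg : ∀ i j, Group G S C i j → x i = x j) :
      univ.biUnion (fun i => starEdges G S C i (x i)) =
        M ∪ R.biUnion (fun i => starEdges G S C i (x i) \ L i) := by
    ext e
    simp only [mem_biUnion, mem_union, mem_univ, true_and, hM, mem_sdiff]
    constructor
    · rintro ⟨i, hi⟩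
      rw [starEdges_congr (hrep i), hxg _ _ (hrep i)] at hi
      by_cases he : e ∈ L (rep i)
      · exact .inl ⟨_, hmemR i, he⟩
      · exact .inr ⟨_, hmemR i, hi, he⟩
    · rintro (⟨i, -, hi⟩ | ⟨i, -, hi, -⟩)
      · exact ⟨i, linkEdges_subset (hx i) hi⟩
      · exact ⟨i, hi⟩
  have diff (x : ι → V) (hx : ∀ i, GroupCand G S C i (x i)) (i : ι) :
      ∑ e ∈ starEdges G S C i (x i) \ L i, f e = cost G S C f i (x i) - ∑ e ∈ L i, f e := by
    rw [← sum_starEdges, ← sum_sdiff (linkEdges_subset (hx i))]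
    ring
  rw [split y hy hyg, split z hz fun i j => h.eq_of_group]
  -- For the centres `z` of the solution the decomposition is disjoint and gives an equality. For
  -- `y` overlaps may occur, but they only lower the sum, and an inequality is enough.
  have hdisj : Disjoint M (R.biUnion fun i => starEdges G S C i (z i) \ L i) := by
    rw [disjoint_left]
    intro e he he'
    simp only [hM, mem_biUnion, mem_sdiff] at he he'
    obtain ⟨j, hj, hej⟩ := he
    obtain ⟨i, hi, hei, hei'⟩ := he'
    by_cases hij : Group G S C i j
    · rw [hRR hi hj hij] at hei'
      exact hei' hej
    · exact hei' (h.mem_linkEdges hei (linkEdges_subset (hz j) hej) hij)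
  have hpair : ((R : Finset ι) : Set ι).PairwiseDisjoint
      fun i => starEdges G S C i (z i) \ L i := by
    intro i hi j hj hij
    simp only [Function.onFun]
    rw [disjoint_left]
    intro e he he'
    rw [mem_sdiff] at he he'
    exact he.2 (h.mem_linkEdges he.1 he'.1 fun hg => hij (hRR hi hj hg))
  rw [sum_union hdisj, sum_biUnion hpair]
  calc ∑ e ∈ M ∪ R.biUnion (fun i => starEdges G S C i (y i) \ L i), f e
      ≤ ∑ e ∈ M, f e + ∑ e ∈ R.biUnion (fun i => starEdges G S C i (y i) \ L i), f e := by
        rw [← sum_union_inter]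
        exact le_add_of_nonneg_right (sum_nonneg fun e _ => hf e)
    _ ≤ ∑ e ∈ M, f e + ∑ i ∈ R, ∑ e ∈ starEdges G S C i (y i) \ L i, f e := by
        gcongr
        exact sum_biUnion_le_sum R _ hf
    _ ≤ _ := by
        refine add_le_add_right (sum_le_sum fun i _ => ?_) _
        rw [diff y hy, diff z hz]
        exact sub_le_sub_right (hc i) _

end Certificate

/-! ### Canonical cheapest centres -/

section Chosen

variable {n : ℕ} {G S : SimpleGraph (Fin n)} {C : ι → Finset (Fin n)} {f : Sym2 (Fin n) → ℝ}

theorem cost_congr {i j : ι} (hij : Group G S C i j) (z : Fin n) :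
    cost G S C f i z = cost G S C f j z := by
  have : leaves G S C i z = leaves G S C j z := by
    ext w
    simp [leaves, groupMem_congr hij]
  rw [cost, cost, this]

theorem Chosen.unique {i : ι} {y z : Fin n} (hy : Chosen G S C f i y) (hz : Chosen G S C f i z) :
    y = z :=
  le_antisymm ((hy.2 z hz.1).2 (hz.2 y hy.1).1) ((hz.2 y hy.1).2 (hy.2 z hz.1).1)

theorem chosen_congr {i j : ι} (hij : Group G S C i j) (z : Fin n) :
    Chosen G S C f i z ↔ Chosen G S C f j z := by
  simp only [Chosen, groupCand_congr hij, cost_congr hij]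

theorem exists_chosen {i : ι} {z : Fin n} (hz : GroupCand G S C i z) : ∃ y, Chosen G S C f i y := by
  classical
  -- Minimising cost and index lexicographically matches the rule for ties, which makes the centre
  -- unique and hence common to the whole group.
  obtain ⟨y, hy, hmin⟩ := exists_min_image (univ.filter (GroupCand G S C i))
    (fun y => toLex (cost G S C f i y, y)) ⟨z, by simpa using hz⟩
  refine ⟨y, by simpa using hy, fun x hx => ?_⟩
  have := hmin x (by simpa using hx)
  rw [Prod.Lex.toLex_le_toLex] at this
  rcases this with h | ⟨h, h'⟩
  · exact ⟨h.le, fun h' => absurd h' (not_le.2 h)⟩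
  · exact ⟨h.le, fun _ => h'⟩

end Chosen

end SpanningStars

/-! ### Edges in short cycles -/

namespace SimpleGraph

variable {V : Type*}

/-- The number of edges plus the number of connected components. -/
noncomputable def edgesAddComponents (H : SimpleGraph V) : ℕ :=
  H.edgeSet.ncard + Nat.card H.ConnectedComponent

theorem reachable_sup_edge {H : SimpleGraph V} {u v a b : V}
    (h : (H ⊔ edge u v).Reachable a b) : H.Reachable a b ∨
      (H.Reachable a u ∧ H.Reachable v b) ∨ (H.Reachable a v ∧ H.Reachable u b) := by
  rw [reachable_iff_reflTransGen] at h
  induction h with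
  | refl => exact .inl (.refl _)
  | @tail c d _ hcd ih =>
    rw [sup_adj, edge_adj] at hcd
    rcases hcd with hcd | ⟨⟨rfl, rfl⟩ | ⟨rfl, rfl⟩, -⟩
    · have := hcd.reachable
      rcases ih with ih | ih | ih
      · exact .inl (ih.trans this)
      · exact .inr (.inl ⟨ih.1, ih.2.trans this⟩)
      · exact .inr (.inr ⟨ih.1, ih.2.trans this⟩)
    · rcases ih with ih | ih | ih
      · exact .inr (.inl ⟨ih, .refl _⟩)
      · exact .inr (.inl ⟨ih.1, .refl _⟩)
      · exact .inl ih.1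
    · rcases ih with ih | ih | ih
      · exact .inr (.inr ⟨ih, .refl _⟩)
      · exact .inl ih.1
      · exact .inr (.inr ⟨ih.1, .refl _⟩)

theorem edgeSet_sup_edge {H : SimpleGraph V} {u v : V} (huv : u ≠ v) :
    (H ⊔ edge u v).edgeSet = H.edgeSet ∪ {s(u, v)} := by
  ext e
  induction e using Sym2.ind with | h a b
  simp only [mem_edgeSet, sup_adj, edge_adj, Set.mem_union, Set.mem_singleton_iff, Sym2.eq_iff]
  refine or_congr_right ⟨fun h => by tauto, fun h => ⟨by tauto, ?_⟩⟩
  rintro rfl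
  exact huv (h.elim (fun h => h.1.symm.trans h.2) fun h => h.2.symm.trans h.1)

variable [Finite V]

theorem ncard_edgeSet_sup_edge {H : SimpleGraph V} {u v : V} (huv : u ≠ v) (h : ¬ H.Adj u v) :
    (H ⊔ edge u v).edgeSet.ncard = H.edgeSet.ncard + 1 := by
  rw [edgeSet_sup_edge huv, Set.union_singleton, Set.ncard_insert_of_notMem (by simpa using h)]

/-- A new edge merges at most two components. With the component of `u` sent to `none`, the
remaining ones stay distinct. -/
theorem card_connectedComponent_le_sup_edge (H : SimpleGraph V) (u v : V) :
    Nat.card H.ConnectedComponent ≤ Nat.card (H ⊔ edge u v).ConnectedComponent + 1 := by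
  classical
  let f : H.ConnectedComponent → Option (H ⊔ edge u v).ConnectedComponent := fun c =>
    if c = H.connectedComponentMk u then none else some (c.map (Hom.ofLE le_sup_left))
  have hf : Function.Injective f := by
    intro c d
    induction c using ConnectedComponent.ind with | h a
    induction d using ConnectedComponent.ind with | h b
    intro hcd
    simp only [f] at hcd
    split_ifs at hcd with h1 h2 h2
    · rw [h1, h2]
    · simp only [Option.some.injEq, ConnectedComponent.map_mk, ConnectedComponent.eq] at hcd h1 h2 ⊢
      rcases reachable_sup_edge hcd with h | h | h
      · exact h
      · exact absurd h.1 h1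
      · exact absurd h.2.symm h2
  have := Nat.card_le_card_of_injective f hf
  simpa [Finite.card_option] using this

theorem card_connectedComponent_sup_edge_of_reachable {H : SimpleGraph V} {u v : V}
    (h : H.Reachable u v) :
    Nat.card H.ConnectedComponent ≤ Nat.card (H ⊔ edge u v).ConnectedComponent := by
  refine Nat.card_le_card_of_injective (ConnectedComponent.map (Hom.ofLE le_sup_left)) ?_
  intro c d
  induction c using ConnectedComponent.ind with | h a
  induction d using ConnectedComponent.ind with | h b
  intro hcd
  simp only [ConnectedComponent.map_mk, ConnectedComponent.eq] at hcd ⊢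
  rcases reachable_sup_edge hcd with h' | h' | h'
  · exact h'
  · exact h'.1.trans (h.trans h'.2)
  · exact h'.1.trans (h.symm.trans h'.2)

theorem edgesAddComponents_le_sup_edge (H : SimpleGraph V) (u v : V) :
    H.edgesAddComponents ≤ (H ⊔ edge u v).edgesAddComponents := by
  by_cases huv : u = v
  · subst huv; rw [sup_edge_self]
  by_cases h : H.Adj u v
  · rw [sup_edge_of_adj _ h]
  have h1 := card_connectedComponent_le_sup_edge H u v
  have h2 := ncard_edgeSet_sup_edge huv h
  unfold edgesAddComponents
  omega

/-- An edge between vertices that are already connected closes a cycle: it adds one to the edge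
count and merges nothing. The sum of edges and components is the feedback edge number plus the
number of vertices. -/
theorem edgesAddComponents_lt_sup_edge {H : SimpleGraph V} {u v : V} (huv : u ≠ v)
    (h : ¬ H.Adj u v) (hr : H.Reachable u v) :
    H.edgesAddComponents + 1 ≤ (H ⊔ edge u v).edgesAddComponents := by
  have h1 := card_connectedComponent_sup_edge_of_reachable hr
  have h2 := ncard_edgeSet_sup_edge huv h
  unfold edgesAddComponents
  omega

theorem edgesAddComponents_mono {H H' : SimpleGraph V} (h : H ≤ H') :
    H.edgesAddComponents ≤ H'.edgesAddComponents := by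
  obtain ⟨k, hk⟩ : ∃ k, k = (H'.edgeSet \ H.edgeSet).ncard := ⟨_, rfl⟩
  induction k generalizing H with
  | zero =>
    have : H'.edgeSet ⊆ H.edgeSet := by
      rw [← Set.sdiff_eq_empty, ← Set.ncard_eq_zero (Set.toFinite _)]
      exact hk.symm
    rw [le_antisymm h (edgeSet_subset_edgeSet.1 this)]
  | succ k ih =>
    obtain ⟨e, he⟩ : (H'.edgeSet \ H.edgeSet).Nonempty := by
      rw [← Set.ncard_pos (Set.toFinite _)]; omega
    induction e using Sym2.ind with | h u v
    have huv : u ≠ v := he.1.ne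
    refine (edgesAddComponents_le_sup_edge H u v).trans (ih ?_ ?_)
    · refine sup_le h ?_
      rw [edge_le_iff]
      exact .inr he.1
    · rw [edgeSet_sup_edge huv, ← Set.sdiff_sdiff]
      have := Set.ncard_sdiff_singleton_add_one he (Set.toFinite _)
      omega

/-- The edges of `H` in triangles and 4-cycles. -/
def shortCycles (H : SimpleGraph V) : SimpleGraph V where
  Adj a b := H.Adj a b ∧ ∃ c d, (c = d ∨ H.Adj c d) ∧ H.Adj b c ∧ H.Adj d a ∧ a ≠ c ∧ b ≠ d
  symm := ⟨fun _ _ ⟨h, c, d, hcd, hbc, hda, hac, hbd⟩ =>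
    ⟨h.symm, d, c, hcd.imp Eq.symm Adj.symm, hda.symm, hbc.symm, hbd, hac⟩⟩
  loopless := ⟨fun _ h => h.1.ne rfl⟩

/-- There are at most four times as many edges in triangles and 4-cycles as feedback edges. -/
theorem ncard_shortCycles_le (H : SimpleGraph V) :
    H.shortCycles.edgeSet.ncard + 4 * Nat.card V ≤ 4 * H.edgesAddComponents := by
  classical
  -- Grow `F` inside `H` until it contains all short-cycle edges, keeping the inequality claimed for
  -- `H`, with the edges of `F` in place of the short-cycle edges. The induction is on the number of
  -- edges of `H` still missing.
  have key : ∀ (k : ℕ) (F : SimpleGraph V), k = (H.edgeSet \ F.edgeSet).ncard → F ≤ H →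
      F.edgeSet.ncard + 4 * Nat.card V ≤ 4 * F.edgesAddComponents →
      ∃ F, F ≤ H ∧ H.shortCycles ≤ F ∧
        F.edgeSet.ncard + 4 * Nat.card V ≤ 4 * F.edgesAddComponents := by
    intro k
    induction k using Nat.strong_induction_on with | _ k ih
    intro F hk hF hle
    by_cases hS : H.shortCycles ≤ F
    · exact ⟨F, hF, hS, hle⟩
    simp only [le_iff_adj, not_forall] at hS
    obtain ⟨a, b, ⟨hab, c, d, hcd, hbc, hda, hac, hbd⟩, hn⟩ := hS
    -- The other edges of a short cycle through the missing edge `ab` go in first; for a triangle,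
    -- `c = d` and `edge c d` is empty.
    set F₁ := F ⊔ edge b c ⊔ edge c d ⊔ edge d a with hF₁
    have hcd' : edge c d ≤ H := by
      rw [edge_le_iff]; tauto
    have hF₁H : F₁ ≤ H := by
      refine sup_le (sup_le (sup_le hF ?_) hcd') ?_
      · rw [edge_le_iff]; tauto
      · rw [edge_le_iff]; tauto
    have hn₁ : ¬ F₁.Adj a b := by
      simp only [hF₁, sup_adj, edge_adj]
      rintro (((h | ⟨⟨h, -⟩ | ⟨h, -⟩, -⟩) | ⟨⟨h, -⟩ | ⟨h, -⟩, -⟩) | ⟨⟨h, -⟩ | ⟨-, h⟩, -⟩)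
      · exact hn h
      · exact hab.ne h
      · exact hac h
      · exact hac h
      · exact hda.ne h.symm
      · exact hda.ne h.symm
      · exact hbd h
    have hr : F₁.Reachable a b := by
      have h1 : F₁.Reachable b c :=
        Adj.reachable (by simp [hF₁, edge_adj, hbc.ne])
      have h2 : F₁.Reachable c d := by
        by_cases hcd : c = d
        · rw [hcd]
        · exact Adj.reachable (by simp [hF₁, edge_adj, hcd])
      have h3 : F₁.Reachable d a :=
        Adj.reachable (by simp [hF₁, edge_adj, hda.ne])
      exact (h1.trans (h2.trans h3)).symm
    -- Adding `ab` last closes a cycle. This gain of one pays for all the new edges, of which there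
    -- are at most four.
    have hlt := edgesAddComponents_lt_sup_edge hab.ne hn₁ hr
    have hmono : F.edgesAddComponents ≤ F₁.edgesAddComponents :=
      edgesAddComponents_mono (le_sup_left.trans (le_sup_left.trans le_sup_left))
    have hone (F : SimpleGraph V) (u v : V) :
        (F ⊔ edge u v).edgeSet.ncard ≤ F.edgeSet.ncard + 1 := by
      by_cases huv : u = v
      · subst huv; rw [sup_edge_self]; omega
      · rw [edgeSet_sup_edge huv, Set.union_singleton]
        exact Set.ncard_insert_le _ _
    have h1 := hone F b c
    have h2 := hone (F ⊔ edge b c) c d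
    have h3 := hone (F ⊔ edge b c ⊔ edge c d) d a
    have h4 := hone F₁ a b
    rw [← hF₁] at h3
    refine ih _ ?_ (F₁ ⊔ edge a b) rfl (sup_le hF₁H (by rw [edge_le_iff]; tauto)) (by omega)
    rw [hk]
    refine Set.ncard_lt_ncard ?_ (Set.toFinite _)
    have hFF : F ≤ F₁ ⊔ edge a b :=
      (le_sup_left.trans (le_sup_left.trans le_sup_left)).trans le_sup_left
    refine ⟨Set.sdiff_subset_sdiff_right (edgeSet_subset_edgeSet.2 hFF), fun hsub => ?_⟩
    have := hsub (show s(a, b) ∈ H.edgeSet \ F.edgeSet from ⟨hab, hn⟩)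
    refine this.2 ?_
    simp [hab.ne]
  have hbot : Nat.card (⊥ : SimpleGraph V).ConnectedComponent = Nat.card V := by
    refine (Nat.card_congr (Equiv.ofBijective (⊥ : SimpleGraph V).connectedComponentMk
      ⟨fun a b hab => ?_, fun c => c.exists_rep⟩)).symm
    simpa using hab
  -- The edgeless graph satisfies the invariant with equality: no edges, and as many components as
  -- vertices.
  obtain ⟨F, hF, hS, hle⟩ := key _ ⊥ rfl bot_le (by simp [edgesAddComponents, hbot])
  have h1 := Set.ncard_le_ncard (edgeSet_subset_edgeSet.2 hS) (Set.toFinite _)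
  have h2 := edgesAddComponents_mono hF
  omega

end SimpleGraph

/-! ### Trials -/

namespace StarsNWS

open SpanningStars Finset

variable (I : StarsNWS)

open Classical in
/-- The weight of a pair of vertices, `0` for pairs that are not edges. -/
noncomputable def pairWeight (e : Sym2 (Fin I.n)) : ℝ :=
  if h : e ∈ I.G.edgeSet then I.ω ⟨e, h⟩ else 0

theorem pairWeight_nonneg (e : Sym2 (Fin I.n)) : 0 ≤ I.pairWeight e := by
  unfold pairWeight
  split_ifs
  · exact NNReal.coe_nonneg _
  · exact le_rfl

open Classical in
theorem weight_eq (H : SimpleGraph (Fin I.n)) :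
    I.weight H = ∑ e with e ∈ H.edgeSet, I.pairWeight e := by
  rw [weight, sum_filter, ← sum_subset (subset_univ (univ.filter (· ∈ I.G.edgeSet))),
    Finset.sum_subtype (p := (· ∈ I.G.edgeSet)) _ (by simp)]
  · refine Fintype.sum_congr _ _ fun e => ?_
    have : I.pairWeight e = I.ω e := by simp [pairWeight]
    rw [this]
  · intro e _ he
    have : e ∉ I.G.edgeSet := by simpa using he
    simp [pairWeight, this]

/-- The graph that consists of `S` and the stars with the chosen centres. -/
def trialGraph (S : SimpleGraph (Fin I.n)) : SimpleGraph (Fin I.n) :=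
  S ⊔ SimpleGraph.fromRel fun u v => ∃ i, Chosen I.G S I.C I.pairWeight i u ∧ v ∈ I.C i

theorem trialGraph_adj (S : SimpleGraph (Fin I.n)) (a b : Fin I.n) :
    (I.trialGraph S).Adj a b ↔ S.Adj a b ∨ a ≠ b ∧
      ((∃ i, Chosen I.G S I.C I.pairWeight i a ∧ b ∈ I.C i) ∨
        ∃ i, Chosen I.G S I.C I.pairWeight i b ∧ a ∈ I.C i) := by
  rw [trialGraph, SimpleGraph.sup_adj, SimpleGraph.fromRel_adj]

/-- The trial with the set `S` of edges succeeds. -/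
def Accepts (S : SimpleGraph (Fin I.n)) : Prop :=
  (∀ i, ∃ z, Chosen I.G S I.C I.pairWeight i z) ∧
    ((I.trialGraph S).edgeSet.ncard : ℤ) ≤ I.ℓ ∧ I.weight (I.trialGraph S) ≤ I.b

variable {I}

/-- Soundness needs nothing about `S` except that it lies in `G`: a chosen centre is a candidate,
and the star of a candidate lies in `G`. -/
theorem Accepts.isYes {S : SimpleGraph (Fin I.n)} (hS : S ≤ I.G) (h : I.Accepts S) : I.IsYes := by
  have hle : I.trialGraph S ≤ I.G := by
    refine sup_le hS fun u v huv => ?_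
    have key : ∀ u v, u ≠ v → (∃ i, Chosen I.G S I.C I.pairWeight i u ∧ v ∈ I.C i) →
        I.G.Adj u v := by
      rintro u v hne ⟨i, hi, hv⟩
      exact (hi.1 i (.refl _)).1.2.1 v hv hne.symm
    rw [SimpleGraph.fromRel_adj] at huv
    rcases huv.2 with h | h
    · exact key u v huv.1 h
    · exact (key v u huv.1.symm h).symm
  refine ⟨I.trialGraph S, hle, h.2.1, h.2.2, fun i => ?_⟩
  obtain ⟨z, hz⟩ := h.1 i
  refine ⟨⟨z, (hz.1 i (.refl _)).1.1⟩, fun u v huv => ?_⟩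
  rw [SimpleGraph.starGraph_adj] at huv
  refine .inr ?_
  simp only [SimpleGraph.fromRel_adj, Function.Embedding.subtype_apply]
  obtain ⟨hne, rfl | rfl⟩ := huv
  · exact ⟨fun h' => hne (Subtype.ext h'), .inl ⟨i, hz, v.2⟩⟩
  · exact ⟨fun h' => hne (Subtype.ext h'), .inr ⟨i, hz, u.2⟩⟩

theorem exists_certificate {H : SimpleGraph (Fin I.n)} (hH : I.IsSolution H) :
    ∃ z, Certificate I.G H.shortCycles I.C H z := by
  obtain ⟨hle, -, -, hC⟩ := hH
  choose z hz using hC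
  refine ⟨fun i => z i, hle, fun i => (z i).2, fun i w hw hwz => ?_, fun a b h => h.1, ?_, ?_⟩
  · have : (SimpleGraph.starGraph (z i)).Adj (z i) ⟨w, hw⟩ := by
      rw [SimpleGraph.starGraph_adj]
      exact ⟨fun h => hwz (congrArg Subtype.val h).symm, .inl rfl⟩
    exact hz i this
  · intro a b c hab hbc hca
    -- A triangle is the case of two equal further vertices in the definition of `shortCycles`.
    exact ⟨hab, c, c, .inl rfl, hbc, hca, hca.ne', hbc.ne⟩
  · intro a b c d hac hbd hab hbc hcd hda
    exact ⟨hab, c, d, .inr hcd, hbc, hda, hac, hbd⟩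

/-- Members of a community are connected in `H` through its centre, so every component of `H` is a
union of components of the hypergraph. -/
theorem card_connectedComponent_le {H : SimpleGraph (Fin I.n)} (hH : I.IsSolution H) :
    Nat.card H.ConnectedComponent ≤ I.x := by
  have key : ∀ u v, I.communityGraph.Reachable u v → H.Reachable u v := by
    obtain ⟨z, hz⟩ := exists_certificate hH
    intro u v huv
    rw [SimpleGraph.reachable_iff_reflTransGen] at huv
    induction huv with
    | refl => rfl
    | tail _ h ih =>
      refine ih.trans ?_
      have hc (i : Fin I.c) (w) (hw : w ∈ I.C i) : H.Reachable (z i) w := by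
        by_cases hwz : w = z i
        · rw [hwz]
        · exact (hz.adj i w hw hwz).reachable
      rw [communityGraph, SimpleGraph.fromRel_adj] at h
      rcases h.2 with ⟨i, h1, h2⟩ | ⟨i, h1, h2⟩
      · exact (hc i _ h1).symm.trans (hc i _ h2)
      · exact (hc i _ h2).symm.trans (hc i _ h1)
  refine Nat.card_le_card_of_injective
    (fun c : H.ConnectedComponent => I.communityGraph.connectedComponentMk c.out) ?_
  intro c d hcd
  rw [SimpleGraph.ConnectedComponent.eq] at hcd
  exact (Quot.out_eq c).symm.trans
    ((SimpleGraph.ConnectedComponent.sound (key _ _ hcd)).trans (Quot.out_eq d))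

open Classical in
/-- On a yes-instance, the trial with the edges in short cycles of a solution succeeds. -/
theorem exists_accepts (h : I.IsYes) : ∃ S : SimpleGraph (Fin I.n), S ≤ I.G ∧
    (S.edgeSet.ncard : ℤ) ≤ 4 * (min I.ℓ I.m - I.n + I.x) ∧ I.Accepts S := by
  obtain ⟨H, hH⟩ := h
  obtain ⟨z, hz⟩ := exists_certificate hH
  set S := H.shortCycles with hS
  have hcard : (S.edgeSet.ncard : ℤ) ≤ 4 * (min I.ℓ I.m - I.n + I.x) := by
    have h1 := H.ncard_shortCycles_le
    have h2 := card_connectedComponent_le hH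
    have h3 : (H.edgeSet.ncard : ℤ) ≤ min I.ℓ I.m := by
      refine le_min hH.2.1 ?_
      exact_mod_cast Set.ncard_le_ncard (SimpleGraph.edgeSet_subset_edgeSet.2 hH.1)
        (Set.toFinite _)
    rw [Nat.card_fin, SimpleGraph.edgesAddComponents, ← hS] at h1
    omega
  choose y hy using fun i => exists_chosen (f := I.pairWeight) (hz.groupCand i)
  have hyg (i j) (hij : Group I.G S I.C i j) : y i = y j :=
    (hy i).unique ((chosen_congr hij _).2 (hy j))
  set Y := univ.biUnion fun i => starEdges I.G S I.C i (y i) with hY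
  set Z := univ.biUnion fun i => starEdges I.G S I.C i (z i) with hZ
  have hXe : univ.filter (· ∈ (I.trialGraph S).edgeSet) = univ.filter (· ∈ S.edgeSet) ∪ Y := by
    ext e
    induction e using Sym2.ind with | h a b
    simp only [mem_filter, mem_univ, true_and, SimpleGraph.mem_edgeSet, trialGraph_adj, mem_union,
      hY, mem_biUnion, mem_starEdges]
    by_cases hab : S.Adj a b
    · simp [hab]
    simp only [hab, false_or]
    constructor
    · rintro ⟨hne, ⟨i, hi, hv⟩ | ⟨i, hi, hv⟩⟩
      · obtain rfl := hi.unique (hy i)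
        exact ⟨i, b, ⟨⟨i, .refl _, hv⟩, hne.symm, hab⟩, rfl⟩
      · obtain rfl := hi.unique (hy i)
        exact ⟨i, a, ⟨⟨i, .refl _, hv⟩, hne, fun h => hab h.symm⟩, Sym2.eq_swap⟩
    · rintro ⟨i, w, ⟨⟨j, hj, hw⟩, hne, -⟩, he⟩
      rw [Sym2.eq_iff] at he
      have hyj := hy j
      rw [← hyg i j hj] at hyj
      rcases he with ⟨rfl, rfl⟩ | ⟨rfl, rfl⟩
      · exact ⟨hne.symm, .inl ⟨j, hyj, hw⟩⟩
      · exact ⟨hne, .inr ⟨j, hyj, hw⟩⟩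
  have hdisj (x : Fin I.c → Fin I.n) : Disjoint (univ.filter (· ∈ S.edgeSet))
      (univ.biUnion fun i => starEdges I.G S I.C i (x i)) := by
    rw [disjoint_left]
    intro e he he'
    simp only [mem_biUnion, mem_starEdges] at he'
    obtain ⟨i, -, w, ⟨-, -, hw⟩, rfl⟩ := he'
    exact hw (by simpa using he)
  have hHe : univ.filter (· ∈ S.edgeSet) ∪ Z ⊆ univ.filter (· ∈ H.edgeSet) := by
    refine union_subset (fun e he => ?_) fun e he => ?_
    · simp only [mem_filter, mem_univ, true_and] at he ⊢
      exact SimpleGraph.edgeSet_subset_edgeSet.2 hz.le_H he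
    · simp only [hZ, mem_biUnion, mem_starEdges] at he
      obtain ⟨i, -, w, ⟨⟨j, hj, hw⟩, hne, -⟩, rfl⟩ := he
      rw [hz.eq_of_group hj] at hne ⊢
      simpa using hz.adj j w hw hne
  -- One estimate serves both bounds: with `f = 1` it compares numbers of edges, with `f =
  -- pairWeight` it compares weights.
  have main {f : Sym2 (Fin I.n) → ℝ} (hf : ∀ e, 0 ≤ f e)
      (hc : ∀ i, cost I.G S I.C f i (y i) ≤ cost I.G S I.C f i (z i)) :
      ∑ e with e ∈ (I.trialGraph S).edgeSet, f e ≤ ∑ e with e ∈ H.edgeSet, f e := by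
    rw [hXe, sum_union (hdisj y)]
    calc _ ≤ ∑ e with e ∈ S.edgeSet, f e + ∑ e ∈ Z, f e := by
          gcongr ?_ + ?_
          · exact le_rfl
          · exact hz.sum_biUnion_le (fun i => (hy i).1) hyg hf hc
      _ = ∑ e ∈ univ.filter (· ∈ S.edgeSet) ∪ Z, f e := (sum_union (hdisj z)).symm
      _ ≤ _ := sum_le_sum_of_subset_of_nonneg hHe fun e _ _ => hf e
  have hcount (F : SimpleGraph (Fin I.n)) :
      (F.edgeSet.ncard : ℝ) = ∑ e with e ∈ F.edgeSet, (1 : ℝ) := by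
    rw [sum_const, nsmul_one, ← Set.ncard_coe_finset]
    simp
  refine ⟨S, hz.le_H.trans hz.le, hcard, fun i => ⟨y i, hy i⟩, le_trans ?_ hH.2.1, ?_⟩
  -- The centres `y` were chosen for weight only. The number of edges is no larger because the
  -- number of leaves is the same for all candidates of a group.
  · have := main (f := fun _ => 1) (fun _ => zero_le_one) fun i => by
      simp only [cost, sum_const, nsmul_one]
      exact_mod_cast card_leaves_le (hy i).1 (hz.groupCand i)
    rw [← hcount, ← hcount] at this
    exact_mod_cast this
  · refine le_trans ?_ hH.2.2.1
    rw [weight_eq, weight_eq]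
    exact main I.pairWeight_nonneg fun i => ((hy i).2 _ (hz.groupCand i)).1

end StarsNWS

/-! ### Relations stored in tables -/

namespace RAM

/-- The stores agree, except for the registers in `J`, the arrays in `A` and the real arrays
in `W`. -/
structure Same (J A W : List ℕ) (st s : Store) : Prop where
  reg : ∀ r, r ∉ J → st.reg r = s.reg r
  arr : ∀ a, a ∉ A → st.arr a = s.arr a
  warr : ∀ a, a ∉ W → st.warr a = s.warr a

theorem Same.refl (J A W : List ℕ) (s : Store) : Same J A W s s :=
  ⟨fun _ _ => rfl, fun _ _ => rfl, fun _ _ => rfl⟩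

theorem Same.trans {J A W J' A' W' : List ℕ} {s t u : Store} (h : Same J A W s t)
    (h' : Same J' A' W' t u) : Same (J ++ J') (A ++ A') (W ++ W') s u := by
  refine ⟨fun r hr => ?_, fun r hr => ?_, fun r hr => ?_⟩ <;>
    rw [List.mem_append, not_or] at hr
  · exact (h.reg r hr.1).trans (h'.reg r hr.2)
  · exact (h.arr r hr.1).trans (h'.arr r hr.2)
  · exact (h.warr r hr.1).trans (h'.warr r hr.2)

theorem Same.mono {J A W J' A' W' : List ℕ} {s t : Store} (h : Same J A W s t)
    (hJ : J ⊆ J') (hA : A ⊆ A') (hW : W ⊆ W') : Same J' A' W' s t :=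
  ⟨fun r hr => h.reg r fun h' => hr (hJ h'), fun r hr => h.arr r fun h' => hr (hA h'),
    fun r hr => h.warr r fun h' => hr (hW h')⟩

theorem SameA.same {J : List ℕ} {a : ℕ} {s t : Store} (h : SameA J a s t) : Same J [a] [] s t :=
  ⟨h.reg, fun a' ha' => h.arr a' (by simpa using ha'), fun a' _ => by rw [h.warr]⟩

theorem SameW.same {J : List ℕ} {a : ℕ} {s t : Store} (h : SameW J a s t) : Same J [] [a] s t :=
  ⟨h.reg, fun a' _ => by rw [h.arr], fun a' ha' => h.warr a' (by simpa using ha')⟩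

theorem same_upd (r x : ℕ) (s : Store) : Same [r] [] [] (s.upd r x) s :=
  ⟨fun r' hr' => by rw [Store.upd_reg, if_neg (by simpa using hr')], fun _ _ => rfl,
    fun _ _ => rfl⟩

/-- The relation `P` is stored in the table `a`. -/
def Rel (a : ℕ) {k l : ℕ} (P : Fin k → Fin l → Prop) (s : Store) : Prop :=
  ∀ (i : Fin k) (j : Fin l), s.arr a (s.arr 2 i + j) ≠ 0 ↔ P i j

theorem Rel.same {J A W : List ℕ} {s t : Store} {a k l : ℕ} {P : Fin k → Fin l → Prop}
    (h : Rel a P t) (hs : Same J A W s t) (ha : a ∉ A := by decide) (h2 : 2 ∉ A := by decide) :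
    Rel a P s := by
  intro i j
  rw [hs.arr a ha, hs.arr 2 h2]
  exact h i j

open Cmd in
theorem _root_.RAM.Cmd.Grid.same {J A W : List ℕ} {s t : Store} {Q : ℕ}
    (h : Grid Q t) (hs : Same J A W s t) (h2 : 2 ∉ A := by decide) : Grid Q s := by
  intro i hi
  rw [hs.arr 2 h2]
  exact h i hi

/-- A term as a truth value in a store with a stored relation. -/
theorem Rel.holds_cell {s st : Store} {a k l : ℕ} {P : Fin k → Fin l → Prop} (h : Rel a P s)
    {t u : Term} {i : Fin k} {j : Fin l} (ht : t.eval st = i) (hu : u.eval st = j)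
    (hst : st.arr = s.arr := by rfl) : (Term.cell a t u).Holds st ↔ P i j := by
  rw [Term.holds_cell, hst, ht, hu]
  exact h i j

theorem rel_table {Q a b b' k l : ℕ} {t : Term} {s : Store} {P : Fin k → Fin l → Prop}
    (hQ : Cmd.Grid Q s) (hk : s.reg b = k) (hl : s.reg b' = l) (hkQ : k ≤ Q) (hlQ : l ≤ Q)
    (h : ∀ (i : Fin k) (j : Fin l), t.Holds ((s.upd 20 i).upd 21 j) ↔ P i j)
    (ht : t.usesArr a = false := by rfl) (ha : a ≠ 2 := by decide)
    (hbn : b ≠ 20 ∧ b ≠ 21 ∧ b' ≠ 20 ∧ b' ≠ 21 := by decide) :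
    Same [20, 21] [a] [] ((Cmd.table a b b' t).den s) s ∧
      Rel a P ((Cmd.table a b b' t).den s) := by
  obtain ⟨h1, h2⟩ := Cmd.den_table (b := b) (b' := b') hQ (by omega) (by omega) ht ha hbn
  refine ⟨h1.same, fun i j => ?_⟩
  rw [h1.arr 2 ha.symm, h2 i (by omega) j (by omega)]
  exact h i j

/-! ### Transitive closure -/

/-- The algorithm of Warshall computes the transitive closure. -/
theorem warshall {k : ℕ} {R : Fin k → Fin k → Prop} (W : ℕ → Fin k → Fin k → Prop)
    (h0 : ∀ i j, W 0 i j ↔ R i j)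
    (h : ∀ t : Fin k, ∀ i j, W (t + 1) i j ↔ W t i j ∨ (W t i t ∧ W t t j)) (i j : Fin k) :
    W k i j ↔ Relation.TransGen R i j := by
  constructor
  · have : ∀ t ≤ k, ∀ i j, W t i j → Relation.TransGen R i j := by
      intro t
      induction t with
      | zero => exact fun _ i j hij => .single ((h0 i j).1 hij)
      | succ t ih =>
        intro ht i j hij
        rcases (h ⟨t, ht⟩ i j).1 hij with hij | ⟨h1, h2⟩
        · exact ih (by omega) _ _ hij
        · exact (ih (by omega) _ _ h1).trans (ih (by omega) _ _ h2)
    exact this k le_rfl i j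
  -- After `t` pivots the relation is already transitive at every intermediate vertex below `t`; for
  -- `t = k` it is transitive.
  · have htrans : ∀ t ≤ k, ∀ p : Fin k, (p : ℕ) < t → ∀ i j, W t i p → W t p j → W t i j := by
      intro t
      induction t with
      | zero => intro _ p hp; omega
      | succ t ih =>
        intro ht p hp i j h1 h2
        have hW := h ⟨t, ht⟩
        simp only [hW] at h1 h2 ⊢
        have ih := ih (by omega)
        rcases Nat.lt_succ_iff_lt_or_eq.1 hp with hp | hp
        · rcases h1 with h1 | ⟨h1, h1'⟩ <;> rcases h2 with h2 | ⟨h2, h2'⟩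
          · exact .inl (ih p hp _ _ h1 h2)
          · exact .inr ⟨ih p hp _ _ h1 h2, h2'⟩
          · exact .inr ⟨h1, ih p hp _ _ h1' h2⟩
          · exact .inr ⟨h1, h2'⟩
        · obtain rfl : p = ⟨t, ht⟩ := Fin.ext hp
          exact .inr ⟨h1.elim id fun h => h.1, h2.elim id fun h => h.2⟩
    have hmono : ∀ t ≤ k, ∀ i j, R i j → W t i j := by
      intro t
      induction t with
      | zero => exact fun _ i j => (h0 i j).2
      | succ t ih => exact fun ht i j hij => (h ⟨t, ht⟩ i j).2 (.inl (ih (by omega) i j hij))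
    intro hij
    induction hij with
    | single h => exact hmono k le_rfl _ _ h
    | tail _ h ih => exact htrans k le_rfl _ (Fin.is_lt _) _ _ ih (hmono k le_rfl _ _ h)

/-- Replace the relation in table `8` by its transitive closure, with scratch table `9`. -/
def Cmd.closure (b : ℕ) : Cmd :=
  .loop 12 b (.seq
    (.table 9 b b (.disj (.cell 8 (.var 20) (.var 21))
      (.conj (.cell 8 (.var 20) (.var 12)) (.cell 8 (.var 12) (.var 21)))))
    (.table 8 b b (.cell 9 (.var 20) (.var 21))))

theorem rel_closure {Q b k : ℕ} {s : Store} {R : Fin k → Fin k → Prop} (hQ : Cmd.Grid Q s)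
    (hk : s.reg b = k) (hkQ : k ≤ Q) (hR : Rel 8 R s)
    (hb : b ≠ 12 ∧ b ≠ 20 ∧ b ≠ 21 := by decide) :
    Same [12, 20, 21] [8, 9] [] ((Cmd.closure b).den s) s ∧
      Rel 8 (Relation.TransGen R) ((Cmd.closure b).den s) := by
  -- The relation after `t` pivots. Its value beyond `k` pivots is irrelevant and is left constant.
  let W : ℕ → Fin k → Fin k → Prop := fun t => Nat.rec R
    (fun t W i j => if ht : t < k then W i j ∨ (W i ⟨t, ht⟩ ∧ W ⟨t, ht⟩ j) else W i j) t
  have hW : ∀ t : Fin k, ∀ i j, W (t + 1) i j ↔ W t i j ∨ (W t i t ∧ W t t j) := by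
    intro t i j
    have : W (t + 1) i j = if ht : (t : ℕ) < k then
        W t i j ∨ (W t i ⟨t, ht⟩ ∧ W t ⟨t, ht⟩ j) else W t i j := rfl
    rw [this, dif_pos t.2]
  have key := iter_induct (f := (Cmd.seq
    (.table 9 b b (.disj (.cell 8 (.var 20) (.var 21))
      (.conj (.cell 8 (.var 20) (.var 12)) (.cell 8 (.var 12) (.var 21)))))
    (.table 8 b b (.cell 9 (.var 20) (.var 21)))).den) (r := 12) (K := k) (s := s)
    (fun t st => Same [12, 20, 21] [8, 9] [] st s ∧ Rel 8 (W t) st)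
    ⟨Same.refl _ _ _ _, hR⟩ (by
      rintro t ht st ⟨hst, hW'⟩
      have hs1 : Same [12, 20, 21] [8, 9] [] (st.upd 12 t) s :=
        ((same_upd 12 t st).trans hst).mono (by simp) (by simp) (by simp)
      have hb' : b ∉ [12, 20, 21] := by simp; tauto
      obtain ⟨h1, h2⟩ := rel_table (P := W (t + 1)) (a := 9) (b := b) (b' := b)
        (t := .disj (.cell 8 (.var 20) (.var 21))
          (.conj (.cell 8 (.var 20) (.var 12)) (.cell 8 (.var 12) (.var 21))))
        (hQ.same hs1) ((hs1.reg b hb').trans hk) ((hs1.reg b hb').trans hk) hkQ hkQ (by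
          intro i j
          have := hW ⟨t, ht⟩ i j
          simp only at this
          rw [this, Term.holds_disj, Term.holds_conj]
          refine or_congr (hW'.holds_cell ?_ ?_) (and_congr
            (hW'.holds_cell (j := ⟨t, ht⟩) ?_ ?_) (hW'.holds_cell (i := ⟨t, ht⟩) ?_ ?_)) <;>
            simp [Term.eval, Store.upd_reg]) rfl (by decide) (by tauto)
      have hs2 := (h1.trans hs1).mono (J' := [12, 20, 21]) (A' := [8, 9]) (W' := [])
        (by simp) (by simp) (by simp)
      obtain ⟨h3, h4⟩ := rel_table (P := W (t + 1)) (a := 8) (b := b) (b' := b)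
        (t := .cell 9 (.var 20) (.var 21))
        (hQ.same hs2) ((hs2.reg b hb').trans hk) ((hs2.reg b hb').trans hk) hkQ hkQ (by
          intro i j
          refine h2.holds_cell ?_ ?_ <;> simp [Term.eval, Store.upd_reg]) rfl (by decide) (by tauto)
      exact ⟨(h3.trans hs2).mono (by simp) (by simp) (by simp), h4⟩)
  have hden : (Cmd.closure b).den s = (iter (Cmd.seq
    (.table 9 b b (.disj (.cell 8 (.var 20) (.var 21))
      (.conj (.cell 8 (.var 20) (.var 12)) (.cell 8 (.var 12) (.var 21)))))
    (.table 8 b b (.cell 9 (.var 20) (.var 21)))).den 12 s (s.reg b)).upd 12 (s.reg b) := rfl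
  rw [hden, hk]
  refine ⟨((same_upd 12 k _).trans key.1).mono (by simp) (by simp) (by simp), ?_⟩
  have := key.2.same (same_upd 12 k _)
  intro i j
  rw [this i j]
  exact warshall W (fun _ _ => Iff.rfl) hW i j

end RAM

/-! ### The program for one trial -/

namespace RAM

theorem Rel.iff {s : Store} {a k l : ℕ} {P : Fin k → Fin l → Prop} (h : Rel a P s) (i : Fin k)
    (j : Fin l) : s.arr a (s.arr 2 i + j) ≠ 0 ↔ P i j := h i j

namespace Term

/-- Implication. -/
def imp (t u : Term) : Term := disj (neg t) u

theorem holds_imp (s : Store) (t u : Term) : (imp t u).Holds s ↔ (t.Holds s → u.Holds s) := by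
  rw [imp, holds_disj, holds_neg, imp_iff_not_or]

end Term

end RAM

namespace StarsNWS

open RAM Term SpanningStars Finset

variable (I : StarsNWS)

/-- The instance is stored in the form in which the trials use it: registers as in the input and
`4` for `n + c`; arrays `2` and `5` for the positions of rows, `6` for the graph, `7` for the
communities. -/
structure Ready (s : Store) : Prop where
  n : s.reg 0 = I.n
  c : s.reg 1 = I.c
  sign : s.reg 2 = if I.ℓ < 0 then 1 else 0
  ell : s.reg 3 = I.ℓ.natAbs
  Q : s.reg 4 = I.n + I.c
  grid : Cmd.Grid (I.n + I.c) s
  pos : ∀ i < I.n + I.c, s.arr 5 i = i * I.n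
  adj : Rel 6 I.G.Adj s
  mem : Rel 7 (fun i v => v ∈ I.C i) s
  weight : ∀ u v : Fin I.n, s.warr 0 (u * I.n + v) = I.pairWeight s(u, v)
  b : s.warr 1 0 = I.b

variable {I}

theorem Ready.same {J A W : List ℕ} {s t : Store} (h : I.Ready t) (hs : Same J A W s t)
    (hJ : ∀ r ∈ [0, 1, 2, 3, 4], r ∉ J := by decide)
    (hA : ∀ a ∈ [2, 5, 6, 7], a ∉ A := by decide)
    (hW : ∀ a ∈ [0, 1], a ∉ W := by decide) : I.Ready s where
  n := by rw [hs.reg 0 (hJ 0 (by decide))]; exact h.n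
  c := by rw [hs.reg 1 (hJ 1 (by decide))]; exact h.c
  sign := by rw [hs.reg 2 (hJ 2 (by decide))]; exact h.sign
  ell := by rw [hs.reg 3 (hJ 3 (by decide))]; exact h.ell
  Q := by rw [hs.reg 4 (hJ 4 (by decide))]; exact h.Q
  grid := h.grid.same hs (hA 2 (by decide))
  pos := by rw [hs.arr 5 (hA 5 (by decide))]; exact h.pos
  adj := h.adj.same hs (hA 6 (by decide)) (hA 2 (by decide))
  mem := h.mem.same hs (hA 7 (by decide)) (hA 2 (by decide))
  weight := by rw [hs.warr 0 (hW 0 (by decide))]; exact h.weight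
  b := by rw [hs.warr 1 (hW 1 (by decide))]; exact h.b

/-- Sizes of intersections. -/
def interTerm : Term :=
  .sum 24 0 (.ind (.conj (.cell 7 (.var 20) (.var 24)) (.cell 7 (.var 21) (.var 24))))

/-- In these terms registers `20` and `21` hold row and column. Table `14` is the guessed `S`, `16`
the intersection sizes, `17` the relation `Cand`, `18` non-freeness, `19` `LinkCand`, `8` `Group`,
`20` `GroupCand`, `21` `GroupMem` and `22` `Chosen`; the real array `2` holds the costs. -/
def candTerm : Term :=
  .conj (.cell 7 (.var 20) (.var 21)) (.conj
    (.all 24 0 (.imp (.conj (.cell 7 (.var 20) (.var 24)) (.neg (.eqv (.var 24) (.var 21))))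
      (.cell 6 (.var 21) (.var 24))))
    (.all 24 0 (.imp (.cell 7 (.var 20) (.var 24)) (.all 25 0 (.imp (.cell 7 (.var 20) (.var 25))
      (.imp (.cell 14 (.var 24) (.var 25)) (.imp (.neg (.eqv (.var 24) (.var 21)))
        (.imp (.neg (.eqv (.var 25) (.var 21))) (.cell 14 (.var 21) (.var 24))))))))))

def notFreeTerm : Term :=
  .neg (.ex 24 0 (.conj (.cell 17 (.var 20) (.var 24)) (.all 25 0
    (.imp (.cell 7 (.var 20) (.var 25)) (.imp (.cell 7 (.var 21) (.var 25))
      (.imp (.neg (.eqv (.var 25) (.var 24))) (.cell 14 (.var 24) (.var 25))))))))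

def linkCandTerm : Term :=
  .conj (.cell 17 (.var 20) (.var 21)) (.all 24 1
    (.imp (.conj (.eqv (.cell 16 (.var 20) (.var 24)) (.const 2)) (.cell 18 (.var 20) (.var 24)))
      (.cell 7 (.var 24) (.var 21))))

def tiedTerm (i j : ℕ) : Term :=
  .conj (.lt (.const 2) (.cell 16 (.var i) (.var j))) (.cell 18 (.var i) (.var j))

/-- Reflexivity and symmetry are built in, since the closure command supplies only transitivity. -/
def groupTerm : Term :=
  .disj (.eqv (.var 20) (.var 21)) (.disj (tiedTerm 20 21) (tiedTerm 21 20))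

def groupCandTerm : Term :=
  .all 24 1 (.imp (.cell 8 (.var 20) (.var 24)) (.cell 19 (.var 24) (.var 21)))

def groupMemTerm : Term :=
  .ex 24 1 (.conj (.cell 8 (.var 20) (.var 24)) (.cell 7 (.var 24) (.var 21)))

def leafTerm : Term :=
  .conj (.cell 21 (.var 20) (.var 22)) (.conj (.neg (.eqv (.var 22) (.var 21)))
    (.neg (.cell 14 (.var 21) (.var 22))))

def chosenTerm : Term :=
  .conj (.cell 20 (.var 20) (.var 21)) (.all 24 0 (.imp (.cell 20 (.var 20) (.var 24))
    (.conj (.wle 2 (.add (.get 2 (.var 20)) (.var 21)) 2 (.add (.get 2 (.var 20)) (.var 24)))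
      (.imp (.wle 2 (.add (.get 2 (.var 20)) (.var 24)) 2 (.add (.get 2 (.var 20)) (.var 21)))
        (.neg (.lt (.var 24) (.var 21)))))))

def trialGraphTerm : Term :=
  .disj (.cell 14 (.var 20) (.var 21)) (.conj (.neg (.eqv (.var 20) (.var 21)))
    (.disj (.ex 24 1 (.conj (.cell 22 (.var 24) (.var 20)) (.cell 7 (.var 24) (.var 21))))
      (.ex 24 1 (.conj (.cell 22 (.var 24) (.var 21)) (.cell 7 (.var 24) (.var 20))))))

/-- The centres, when the table `14` contains the guessed edges. -/
def centreCmd : Cmd :=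
  .seq (.table 16 1 1 interTerm) <| .seq (.table 17 1 0 candTerm) <|
  .seq (.table 18 1 1 notFreeTerm) <| .seq (.table 19 1 0 linkCandTerm) <|
  .seq (.table 8 1 1 groupTerm) <| .seq (.closure 1) <|
  .seq (.table 20 1 0 groupCandTerm) <| .seq (.table 21 1 0 groupMemTerm) <|
  .seq (.wtable 2 1 0 0 leafTerm 0 (.add (.get 5 (.var 21)) (.var 22))) <|
  .table 22 1 0 chosenTerm

variable {S : SimpleGraph (Fin I.n)}

theorem transGen_group {ι : Type*} (T : ι → ι → Prop) (i j : ι) :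
    Relation.TransGen (fun i j => i = j ∨ T i j ∨ T j i) i j ↔ Relation.EqvGen T i j := by
  constructor
  · have single {i j : ι} (h : i = j ∨ T i j ∨ T j i) : Relation.EqvGen T i j := by
      rcases h with rfl | h | h
      · exact .refl _
      · exact .rel _ _ h
      · exact .symm _ _ (.rel _ _ h)
    intro h
    induction h with
    | single h => exact single h
    | tail _ h ih => exact .trans _ _ _ ih (single h)
  · intro h
    induction h with
    | rel _ _ h => exact .single (.inr (.inl h))
    | refl _ => exact .single (.inl rfl)
    | symm _ _ _ ih =>
      have : Std.Symm fun i j => i = j ∨ T i j ∨ T j i :=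
        ⟨fun _ _ h => h.imp Eq.symm Or.symm⟩
      exact Std.Symm.symm _ _ ih
    | trans _ _ _ _ _ ih ih' => exact ih.trans ih'

theorem den_centreCmd {s : Store} (h : I.Ready s) (hS : Rel 14 S.Adj s) :
    Same [12, 20, 21, 22] [8, 9, 16, 17, 18, 19, 20, 21, 22] [2] (centreCmd.den s) s ∧
      Rel 22 (fun i z => Chosen I.G S I.C I.pairWeight i z) (centreCmd.den s) := by
  classical
  have hnQ : I.n ≤ I.n + I.c := by omega
  have hcQ : I.c ≤ I.n + I.c := by omega
  -- sizes of intersections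
  set s₁ := (Cmd.table 16 1 1 interTerm).den s with hs₁
  have h16 : Same [20, 21] [16] [] s₁ s ∧
      ∀ i j : Fin I.c, s₁.arr 16 (s₁.arr 2 i + j) = #(I.C i ∩ I.C j) := by
    obtain ⟨h1, h2⟩ := Cmd.den_table (a := 16) (b := 1) (b' := 1) (t := interTerm) h.grid
      (by rw [h.c]; omega) (by rw [h.c]; omega)
    refine ⟨h1.same, fun i j => ?_⟩
    rw [h1.arr 2 (by decide), h2 i (by rw [h.c]; omega) j (by rw [h.c]; omega), interTerm,
      Term.eval_sum_ind (k := I.n) _ _ _ _ (by simpa [Store.upd_reg] using h.n)]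
    congr 1
    ext w
    simp [-ne_eq, Term.holds_conj, Term.holds_cell, Term.eval_var, Store.upd_reg, h.mem.iff]
  obtain ⟨g₁, h16⟩ := h16
  have r₁ := h.same g₁
  have hS₁ := hS.same g₁
  -- candidates
  obtain ⟨g₂, h17⟩ := rel_table (a := 17) (b := 1) (b' := 0) (t := candTerm)
    (P := fun i z => Cand I.G S I.C i z) r₁.grid r₁.c r₁.n hcQ hnQ (by
      intro i z
      simp [-ne_eq, candTerm, Cand, Term.holds_conj, Term.holds_imp, Term.holds_neg,
        Term.holds_eqv, Term.holds_cell, Term.holds_all (k := I.n), Term.eval_var, Store.upd_reg,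
        r₁.n, r₁.mem.iff, r₁.adj.iff, hS₁.iff, Fin.val_inj])
  have r₂ := r₁.same g₂
  have hS₂ := hS₁.same g₂
  have num {J A W : List ℕ} {st : Store} (hs : Same J A W st s₁) (h16A : 16 ∉ A := by decide)
      (h2A : 2 ∉ A := by decide) (i j : Fin I.c) :
      st.arr 16 (st.arr 2 i + j) = #(I.C i ∩ I.C j) := by
    rw [hs.arr 16 h16A, hs.arr 2 h2A, h16]
  -- pairs of communities that are not free
  obtain ⟨g₃, h18⟩ := rel_table (a := 18) (b := 1) (b' := 1) (t := notFreeTerm)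
    (P := fun i j => ¬ Free I.G S I.C i j) r₂.grid r₂.c r₂.c hcQ hcQ (by
      intro i j
      simp [-ne_eq, notFreeTerm, Free, Term.holds_conj, Term.holds_imp, Term.holds_neg,
        Term.holds_eqv, Term.holds_cell, Term.holds_all (k := I.n), Term.holds_ex (k := I.n),
        Term.eval_var, Store.upd_reg, r₂.n, r₂.mem.iff, h17.iff, hS₂.iff, Fin.val_inj])
  have r₃ := r₂.same g₃
  have h17₃ := h17.same g₃
  have num₃ := num (g₃.trans g₂)
  -- candidates that respect the links
  obtain ⟨g₄, h19⟩ := rel_table (a := 19) (b := 1) (b' := 0) (t := linkCandTerm)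
    (P := fun i z => LinkCand I.G S I.C i z) r₃.grid r₃.c r₃.n hcQ hnQ (by
      intro i z
      simp [-ne_eq, linkCandTerm, LinkCand, Linked, Term.holds_conj, Term.holds_imp,
        Term.holds_eqv, Term.holds_cell, Term.holds_all (k := I.c), Term.eval_var, Term.eval_cell,
        Term.eval_const, Store.upd_reg, r₃.c, r₃.mem.iff, h17₃.iff, h18.iff, num₃])
  have r₄ := r₃.same g₄
  have h18₄ := h18.same g₄
  have num₄ := num (g₄.trans (g₃.trans g₂))
  -- groups
  obtain ⟨g₅, h8⟩ := rel_table (a := 8) (b := 1) (b' := 1) (t := groupTerm)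
    (P := fun i j => i = j ∨ Tied I.G S I.C i j ∨ Tied I.G S I.C j i)
    r₄.grid r₄.c r₄.c hcQ hcQ (by
      intro i j
      simp [-ne_eq, groupTerm, tiedTerm, Tied, Term.holds_conj, Term.holds_disj, Term.holds_lt,
        Term.holds_eqv, Term.holds_cell, Term.eval_var, Term.eval_cell, Nat.succ_le_iff,
        Term.eval_const, Store.upd_reg, h18₄.iff, num₄, Fin.val_inj])
  have r₅ := r₄.same g₅
  have h19₅ := h19.same g₅
  obtain ⟨g₆, h8⟩ := rel_closure r₅.grid r₅.c hcQ h8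
  have h8 : Rel 8 (Group I.G S I.C) _ := fun i j => (h8 i j).trans (transGen_group _ i j)
  have r₆ := r₅.same g₆
  have h19₆ := h19₅.same g₆
  -- candidates and members of groups
  obtain ⟨g₇, h20⟩ := rel_table (a := 20) (b := 1) (b' := 0) (t := groupCandTerm)
    (P := fun i z => GroupCand I.G S I.C i z) r₆.grid r₆.c r₆.n hcQ hnQ (by
      intro i z
      simp [-ne_eq, groupCandTerm, GroupCand, Term.holds_imp,
        Term.holds_cell, Term.holds_all (k := I.c), Term.eval_var, Store.upd_reg, r₆.c, h8.iff,
        h19₆.iff])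
  have r₇ := r₆.same g₇
  have h8₇ := h8.same g₇
  obtain ⟨g₈, h21⟩ := rel_table (a := 21) (b := 1) (b' := 0) (t := groupMemTerm)
    (P := fun i w => GroupMem I.G S I.C i w) r₇.grid r₇.c r₇.n hcQ hnQ (by
      intro i w
      simp [-ne_eq, groupMemTerm, GroupMem, Term.holds_conj,
        Term.holds_cell, Term.holds_ex (k := I.c), Term.eval_var, Store.upd_reg, r₇.c, h8₇.iff,
        r₇.mem.iff])
  have r₈ := r₇.same g₈
  have hS₈ := hS₂.same (g₈.trans (g₇.trans (g₆.trans (g₅.trans (g₄.trans g₃)))))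
  have h20₈ := h20.same g₈
  -- costs
  set s₈ := (Cmd.table 21 1 0 groupMemTerm).den ((Cmd.table 20 1 0 groupCandTerm).den
    ((Cmd.closure 1).den ((Cmd.table 8 1 1 groupTerm).den ((Cmd.table 19 1 0 linkCandTerm).den
    ((Cmd.table 18 1 1 notFreeTerm).den ((Cmd.table 17 1 0 candTerm).den s₁)))))) with hs₈
  obtain ⟨g₉, hcost⟩ := Cmd.den_wtable (a := 2) (a' := 0) (b := 1) (b' := 0) (b'' := 0)
    (t := leafTerm) (v := .add (.get 5 (.var 21)) (.var 22)) r₈.grid (by rw [r₈.c]; omega)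
    (by rw [r₈.n]; omega)
  set s₉ := (Cmd.wtable 2 1 0 0 leafTerm 0 (.add (.get 5 (.var 21)) (.var 22))).den s₈ with hs₉
  have g₉ := g₉.same
  have r₉ := r₈.same g₉
  have h20₉ := h20₈.same g₉
  replace hcost (i : Fin I.c) (z : Fin I.n) := hcost i (by rw [r₈.c]; omega) z (by rw [r₈.n]; omega)
  have hcost (i : Fin I.c) (z : Fin I.n) :
      s₉.warr 2 (s₉.arr 2 i + z) = cost I.G S I.C I.pairWeight i z := by
    rw [g₉.arr 2 (by decide), hcost i z, r₈.n, Finset.sum_range, cost, leaves, Finset.sum_filter]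
    refine Finset.sum_congr rfl fun w _ => if_congr ?_ ?_ rfl
    · simp [-ne_eq, leafTerm, Term.holds_conj, Term.holds_neg, Term.holds_eqv, Term.holds_cell,
        Term.eval_var, Store.upd_reg, h21.iff, hS₈.iff, Fin.val_inj]
    · simp only [Term.eval_add, Term.eval_get, Term.eval_var, Store.upd_reg, Store.upd_arr]
      simp only [reduceIte, Nat.reduceEqDiff]
      rw [r₈.pos z (by omega), r₈.weight]
  -- centres
  obtain ⟨g₁₀, h22⟩ := rel_table (a := 22) (b := 1) (b' := 0) (t := chosenTerm)
    (P := fun i z => Chosen I.G S I.C I.pairWeight i z) r₉.grid r₉.c r₉.n hcQ hnQ (by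
      intro i z
      simp [-ne_eq, chosenTerm, Chosen, Term.holds_conj, Term.holds_imp, Term.holds_neg,
        Term.holds_lt, Term.holds_wle, Term.holds_cell, Term.holds_all (k := I.n), Term.eval_var,
        Term.eval_add, Term.eval_get, Store.upd_reg, r₉.n, h20₉.iff, hcost])
  refine ⟨?_, h22⟩
  exact (g₁₀.trans (g₉.trans (g₈.trans (g₇.trans (g₆.trans (g₅.trans (g₄.trans (g₃.trans
    (g₂.trans g₁))))))))).mono (by decide) (by decide) (by decide)

/-- The number of edges of the graph in table `a`. -/
def edgesTerm (a : ℕ) : Term :=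
  .sum 24 0 (.sum 25 0 (.ind (.conj (.lt (.var 24) (.var 25)) (.cell a (.var 24) (.var 25)))))

/-- Some trial up to now is successful. -/
def verdictTerm : Term :=
  .disj (.var 10) (.conj (.all 24 1 (.ex 25 0 (.cell 22 (.var 24) (.var 25))))
    (.conj (.conj (.eqv (.var 2) (.const 0)) (.neg (.lt (.var 3) (.var 15))))
      (.wle 3 (.const 0) 1 (.const 0))))

/-- The graph of the trial, its number of edges and its weight, and the check. -/
def checkCmd : Cmd :=
  .seq (.table 23 0 0 trialGraphTerm) <|
  .seq (.assign 15 (edgesTerm 23)) <|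
  .seq (.wfill 4 (.const 0) 20 0 21 0 (.conj (.lt (.var 20) (.var 21))
    (.cell 23 (.var 20) (.var 21))) 0 (.add (.get 5 (.var 20)) (.var 21))) <|
  .seq (.wsum 3 (.const 0) 20 0 (.const 1) 4 (.var 20)) <|
  .assign 10 verdictTerm

/-- Edges as pairs in increasing order. -/
theorem sum_edges {M : Type*} [AddCommMonoid M] {n : ℕ} (H : SimpleGraph (Fin n))
    [DecidableRel H.Adj] [DecidablePred (· ∈ H.edgeSet)] (f : Sym2 (Fin n) → M) :
    ∑ e with e ∈ H.edgeSet, f e =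
      ∑ u : Fin n, ∑ v : Fin n, if (u : ℕ) < v ∧ H.Adj u v then f s(u, v) else 0 := by
  have h1 := Finset.sum_sym2_filter_not_isDiag (univ : Finset (Fin n))
    (fun e => if e ∈ H.edgeSet then f e else 0)
  rw [← Finset.sum_product' (f := fun u v : Fin n =>
    if (u : ℕ) < v ∧ H.Adj u v then f s(u, v) else 0)]
  rw [Finset.sum_filter, ← Finset.sum_subset (Finset.subset_univ
    (univ.sym2.filter fun e : Sym2 (Fin n) => ¬ e.IsDiag)), h1]
  · refine (Finset.sum_congr rfl fun p hp => ?_).trans (Finset.sum_subset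
      (s₁ := univ.offDiag.filter fun i : Fin n × Fin n => i.1 < i.2) (by simp) fun p _ hp => ?_)
    · have : p.1 < p.2 := by simpa using (Finset.mem_filter.1 hp).2
      rw [Fin.lt_def] at this
      simp [this]
    · rw [if_neg]
      intro h
      refine hp ?_
      have : p.1 < p.2 := h.1
      simp [this, this.ne]
  · intro e _ he
    rw [if_neg]
    intro he'
    refine he ?_
    simpa using H.not_isDiag_of_mem_edgeSet he'

open Classical in
theorem eval_edgesTerm {n a : ℕ} {H : SimpleGraph (Fin n)} {s : Store} (hn : s.reg 0 = n)
    (hH : Rel a H.Adj s) : (edgesTerm a).eval s = H.edgeSet.ncard := by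
  have h1 : H.edgeSet.ncard = ∑ e with e ∈ H.edgeSet, 1 := by
    rw [sum_const, smul_eq_mul, mul_one, ← Set.ncard_coe_finset]
    simp
  rw [h1, sum_edges, edgesTerm, Term.eval_sum_fin (k := n) _ _ _ _ hn]
  refine sum_congr rfl fun u _ => ?_
  rw [Term.eval_sum_fin (k := n) _ _ _ _ (by simpa [Store.upd_reg] using hn)]
  refine sum_congr rfl fun v _ => ?_
  rw [Term.eval_ind]
  refine if_congr ?_ rfl rfl
  simp [-ne_eq, Term.holds_conj, Term.holds_lt, Term.holds_cell, Term.eval_var, Store.upd_reg,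
    hH.iff]

theorem den_checkCmd {s : Store} (h : I.Ready s) (hS : Rel 14 S.Adj s)
    (h22 : Rel 22 (fun i z => Chosen I.G S I.C I.pairWeight i z) s) :
    Same [10, 15, 20, 21] [23] [3, 4] (checkCmd.den s) s ∧
      ((checkCmd.den s).reg 10 ≠ 0 ↔ s.reg 10 ≠ 0 ∨ I.Accepts S) := by
  classical
  have hnQ : I.n ≤ I.n + I.c := by omega
  obtain ⟨g₁, h23⟩ := rel_table (a := 23) (b := 0) (b' := 0) (t := trialGraphTerm)
    (P := (I.trialGraph S).Adj) h.grid h.n h.n hnQ hnQ (by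
      intro u v
      simp [-ne_eq, trialGraphTerm, trialGraph_adj, Term.holds_conj, Term.holds_disj,
        Term.holds_neg, Term.holds_eqv, Term.holds_cell, Term.holds_ex (k := I.c), Term.eval_var,
        Store.upd_reg, h.c, hS.iff, h22.iff, h.mem.iff, Fin.val_inj])
  set s₁ := (Cmd.table 23 0 0 trialGraphTerm).den s with hs₁
  have r₁ := h.same g₁
  set s₂ := s₁.upd 15 ((edgesTerm 23).eval s₁) with hs₂
  have g₂ : Same [15] [] [] s₂ s₁ := same_upd _ _ _
  have h15 : s₂.reg 15 = (I.trialGraph S).edgeSet.ncard := by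
    rw [hs₂, Store.upd_reg, if_pos rfl, eval_edgesTerm r₁.n h23]
  have r₂ := r₁.same g₂
  have h23₂ := h23.same g₂
  obtain ⟨g₃, h4, -⟩ := Cmd.den_wfill (a := 4) (u := .const 0) (r := 20) (b := 0) (r' := 21)
    (b' := 0) (t := .conj (.lt (.var 20) (.var 21)) (.cell 23 (.var 20) (.var 21))) (a' := 0)
    (v := .add (.get 5 (.var 20)) (.var 21)) rfl rfl rfl (by decide) (fun _ _ => rfl)
    (fun _ _ => rfl) (by decide) (by decide) s₂
  set s₃ := (Cmd.wfill 4 (.const 0) 20 0 21 0 (.conj (.lt (.var 20) (.var 21))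
    (.cell 23 (.var 20) (.var 21))) 0 (.add (.get 5 (.var 20)) (.var 21))).den s₂ with hs₃
  have g₃ := g₃.same
  have r₃ := r₂.same g₃
  -- Cell `u` collects the edges from `u` to larger vertices, so each edge is counted once in the
  -- total.
  replace h4 (u : Fin I.n) : s₃.warr 4 u = ∑ v : Fin I.n,
      if (u : ℕ) < v ∧ (I.trialGraph S).Adj u v then I.pairWeight s(u, v) else 0 := by
    have := h4 u (by rw [r₂.n]; omega)
    rw [Term.eval_const, zero_add] at this
    rw [this, r₂.n, Finset.sum_range]
    refine Finset.sum_congr rfl fun v _ => if_congr ?_ ?_ rfl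
    · simp [-ne_eq, Term.holds_conj, Term.holds_lt, Term.holds_cell, Term.eval_var, Store.upd_reg,
        h23₂.iff]
    · simp only [Term.eval_add, Term.eval_get, Term.eval_var, Store.upd_reg, Store.upd_arr]
      simp only [reduceIte, Nat.reduceEqDiff]
      rw [r₂.pos u (by omega), r₂.weight]
  obtain ⟨g₄, h3, -⟩ := Cmd.den_wsum (a := 3) (u := .const 0) (r := 20) (b := 0) (t := .const 1)
    (a' := 4) (v := .var 20) rfl rfl rfl (by decide) (fun _ _ => rfl) s₃
  set s₄ := (Cmd.wsum 3 (.const 0) 20 0 (.const 1) 4 (.var 20)).den s₃ with hs₄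
  have g₄ := g₄.same
  have r₄ := r₃.same g₄
  have h3 : s₄.warr 3 0 = I.weight (I.trialGraph S) := by
    rw [Term.eval_const] at h3
    rw [h3, r₃.n, Finset.sum_range, weight_eq, sum_edges]
    refine Finset.sum_congr rfl fun u _ => ?_
    rw [if_pos (show (Term.const 1).Holds _ from one_ne_zero), ← h4 u, Term.eval_var, Store.upd_reg, if_pos rfl]
  have g : Same [15, 20, 21] [23] [3, 4] s₄ s :=
    (g₄.trans (g₃.trans (g₂.trans g₁))).mono (by decide) (by decide) (by decide)
  have h22₄ := h22.same g
  have h15 : s₄.reg 15 = (I.trialGraph S).edgeSet.ncard := by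
    rw [g₄.reg 15 (by decide), g₃.reg 15 (by decide), h15]
  have hden : checkCmd.den s = s₄.upd 10 (verdictTerm.eval s₄) := rfl
  rw [hden]
  refine ⟨((same_upd _ _ _).trans g).mono (by decide) (by decide) (by decide), ?_⟩
  rw [Store.upd_reg, if_pos rfl, ← g.reg 10 (by decide)]
  change verdictTerm.Holds s₄ ↔ _
  rw [verdictTerm, Term.holds_disj]
  refine or_congr Iff.rfl ?_
  rw [Accepts, Term.holds_conj, Term.holds_conj, Term.holds_conj]
  refine and_congr ?_ (and_congr ?_ ?_)
  · simp [-ne_eq, Term.holds_all (k := I.c), Term.holds_ex (k := I.n), Term.holds_cell,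
      Term.eval_var, Store.upd_reg, r₄.n, r₄.c, h22₄.iff]
  · rw [Term.holds_eqv, Term.holds_neg, Term.holds_lt, Term.eval_var, Term.eval_var, Term.eval_var,
      Term.eval_const, r₄.sign, r₄.ell, h15]
    -- A negative `ℓ` admits no graph at all; otherwise `ℓ` equals its absolute value.
    rcases lt_or_ge I.ℓ 0 with hl | hl
    · rw [if_pos hl]
      omega
    · obtain ⟨k, hk⟩ := Int.eq_ofNat_of_zero_le hl
      rw [if_neg hl.not_gt, hk, Int.natAbs_natCast]
      omega
  · rw [Term.holds_wle, Term.eval_const, h3, r₄.b]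

end StarsNWS

/-! ### Enumeration of the trials -/

/-- A number has every finite sequence of digits. -/
theorem exists_digits {m K : ℕ} (d : Fin K → Fin m) :
    ∃ q < m ^ K, ∀ j : Fin K, q / m ^ (j : ℕ) % m = d j := by
  refine ⟨finFunctionFinEquiv d, Fin.is_lt _, fun j => ?_⟩
  rw [← finFunctionFinEquiv_symm_apply_val, Equiv.symm_apply_apply]

theorem dvd_succ_iff {m : ℕ} (hm : 0 < m) (q : ℕ) : m ∣ q + 1 ↔ q % m + 1 = m := by
  have h := Nat.mod_lt q hm
  rw [Nat.dvd_iff_mod_eq_zero, Nat.add_mod]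
  rcases Nat.lt_or_ge (q % m + 1) m with h' | h'
  · rw [Nat.add_mod_mod, Nat.mod_eq_of_lt h']
    omega
  · rw [Nat.add_mod_mod, show q % m + 1 = m by omega, Nat.mod_self]
    omega

/-- This is the carry rule: the carry reaches digit `j` exactly when all lower digits are `m - 1`.
If `m ^ j` divides `q + 1`, the quotient of `q + 1` is one more than that of `q`, so the next digit
is tested by `dvd_succ_iff`. -/
theorem pow_dvd_succ_iff {m : ℕ} (hm : 0 < m) (q j : ℕ) :
    m ^ j ∣ q + 1 ↔ ∀ i < j, q / m ^ i % m + 1 = m := by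
  induction j with
  | zero => simp
  | succ j ih =>
    have key : m ^ (j + 1) ∣ q + 1 ↔ m ^ j ∣ q + 1 ∧ q / m ^ j % m + 1 = m := by
      have hpos : 0 < m ^ j := Nat.pow_pos hm
      constructor
      · intro h
        have h1 : m ^ j ∣ q + 1 := (pow_dvd_pow m j.le_succ).trans h
        refine ⟨h1, ?_⟩
        rw [← dvd_succ_iff hm, ← Nat.succ_div_of_dvd h1]
        rw [pow_succ] at h
        exact Nat.dvd_div_of_mul_dvd h
      · rintro ⟨h1, h2⟩
        rw [← dvd_succ_iff hm, ← Nat.succ_div_of_dvd h1] at h2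
        rw [pow_succ]
        exact Nat.mul_dvd_of_dvd_div h1 h2
    rw [key, ih]
    constructor
    · rintro ⟨h1, h2⟩ i hi
      rcases Nat.lt_succ_iff_lt_or_eq.1 hi with hi | rfl
      · exact h1 i hi
      · exact h2
    · exact fun h => ⟨fun i hi => h i (by omega), h j (by omega)⟩

/-- The digits of the successor. -/
theorem digit_succ {m : ℕ} (hm : 0 < m) (q j : ℕ) [Decidable (∀ i < j, q / m ^ i % m + 1 = m)]
    {e : ℕ} (he : e = q / m ^ j % m + if ∀ i < j, q / m ^ i % m + 1 = m then 1 else 0) :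
    (q + 1) / m ^ j % m = if e = m then 0 else e := by
  have hlt := Nat.mod_lt (q / m ^ j) hm
  -- The quotient by `m ^ j` grows, by one, exactly when `m ^ j` divides `q + 1`, that is, when a
  -- carry arrives.
  rw [Nat.succ_div]
  simp only [pow_dvd_succ_iff hm]
  by_cases h : ∀ i < j, q / m ^ i % m + 1 = m
  · rw [if_pos h] at he ⊢
    split_ifs with h'
    · rw [← Nat.dvd_iff_mod_eq_zero, dvd_succ_iff hm]
      omega
    · rw [Nat.add_mod, Nat.add_mod_mod, Nat.mod_eq_of_lt (by omega), he]
  · rw [if_neg h] at he ⊢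
    rw [if_neg (by omega), add_zero, he, add_zero]

theorem card_filter_lt_lt {α : Type*} [LinearOrder α] {E : Finset α} {a : α} (ha : a ∈ E) :
    (E.filter (· < a)).card < E.card :=
  Finset.card_lt_card (Finset.filter_ssubset.2 ⟨a, ha, lt_irrefl a⟩)

theorem card_filter_lt_inj {α : Type*} [LinearOrder α] {E : Finset α} {a b : α} (ha : a ∈ E)
    (hb : b ∈ E) (h : (E.filter (· < a)).card = (E.filter (· < b)).card) : a = b := by
  have key : ∀ {a b : α}, a ∈ E → a < b → (E.filter (· < a)).card < (E.filter (· < b)).card := by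
    intro a b ha hab
    refine Finset.card_lt_card ⟨fun x hx => ?_, fun h => ?_⟩
    · rw [Finset.mem_filter] at hx ⊢
      exact ⟨hx.1, hx.2.trans hab⟩
    · exact lt_irrefl a (Finset.mem_filter.1 (h (Finset.mem_filter.2 ⟨ha, hab⟩))).2
  rcases lt_trichotomy a b with hab | hab | hab
  · exact absurd h (key ha hab).ne
  · exact hab
  · exact absurd h (key hb hab).ne'

/-! ### Numbering the edges and decoding numbers into guesses -/

namespace StarsNWS

open RAM Finset

variable (I : StarsNWS)

open Classical in
/-- The edges as increasing pairs, in lexicographic order. -/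
noncomputable def pairs : Finset (Fin I.n ×ₗ Fin I.n) :=
  {p | (ofLex p).1 < (ofLex p).2 ∧ I.G.Adj (ofLex p).1 (ofLex p).2}

open Classical in
theorem sum_pairs (P : Fin I.n → Fin I.n → Prop) [∀ u v, Decidable (P u v)] :
    #{p ∈ I.pairs | P (ofLex p).1 (ofLex p).2} = ∑ u : Fin I.n, ∑ v : Fin I.n,
      if ((u : ℕ) < v ∧ I.G.Adj u v) ∧ P u v then 1 else 0 := by
  rw [← Fintype.sum_prod_type', pairs, filter_filter, card_filter]
  exact Fintype.sum_equiv ofLex _ _ fun p => rfl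

theorem card_pairs : #I.pairs = I.m := by
  classical
  have h := I.sum_pairs fun _ _ => True
  simp only [and_true, filter_true] at h
  rw [h, ← sum_edges I.G fun _ => 1, sum_const, smul_eq_mul, mul_one, m, ← Set.ncard_coe_finset]
  simp

open Classical in
/-- The number of edges before a pair. -/
noncomputable def rank (u v : Fin I.n) : ℕ := #{p ∈ I.pairs | p < toLex (u, v)}

open Classical in
theorem rank_eq (u v : Fin I.n) : I.rank u v = ∑ u' : Fin I.n, ∑ v' : Fin I.n,
    if ((u' : ℕ) < v' ∧ I.G.Adj u' v') ∧ (u' < u ∨ u' = u ∧ v' < v) then 1 else 0 := by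
  rw [← I.sum_pairs fun u' v' => u' < u ∨ u' = u ∧ v' < v]
  exact congrArg card (filter_congr fun p _ => Prod.Lex.lt_iff)

/-- The graph whose edges are those with the given ranks. -/
def rankGraph (D : Set ℕ) : SimpleGraph (Fin I.n) where
  Adj u v := I.G.Adj u v ∧ ((u < v ∧ I.rank u v ∈ D) ∨ (v < u ∧ I.rank v u ∈ D))
  symm := ⟨fun _ _ h => ⟨h.1.symm, h.2.symm⟩⟩
  loopless := ⟨fun _ h => h.1.ne rfl⟩

/-- The graph of the trial with number `q`, for at most `K` edges; the last trial is empty. -/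
def guess (K q : ℕ) : SimpleGraph (Fin I.n) :=
  I.rankGraph {d | q < max 1 I.m ^ K ∧ ∃ j < K, d = q / max 1 I.m ^ j % max 1 I.m}

variable {I}

theorem guess_le (K q : ℕ) : I.guess K q ≤ I.G := fun _ _ h => h.1

theorem rank_lt {u v : Fin I.n} (h : I.G.Adj u v) (huv : u < v) : I.rank u v < I.m := by
  rw [← card_pairs]
  exact card_filter_lt_lt (by simp [pairs, h, huv])

theorem rank_inj {u v u' v' : Fin I.n} (h : I.G.Adj u v) (huv : u < v) (h' : I.G.Adj u' v')
    (huv' : u' < v') (he : I.rank u v = I.rank u' v') : u = u' ∧ v = v' := by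
  have := card_filter_lt_inj (E := I.pairs) (by simp [pairs, h, huv]) (by simp [pairs, h', huv']) he
  simpa using this

/-- The `K` digits name edges with repetition allowed, so every nonempty set of at most `K` edges
arises from some digit sequence. The empty set is covered by the one additional number `max 1 m ^
K`. -/
theorem exists_guess {K : ℕ} {S : SimpleGraph (Fin I.n)} (hS : S ≤ I.G) (hK : S.edgeSet.ncard ≤ K) :
    ∃ q ≤ max 1 I.m ^ K, I.guess K q = S := by
  classical
  have hadj {D : Set ℕ} (hD : ∀ u v, I.G.Adj u v → u < v → (I.rank u v ∈ D ↔ S.Adj u v)) :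
      I.rankGraph D = S := by
    ext u v
    constructor
    · rintro ⟨h, ⟨h1, h2⟩ | ⟨h1, h2⟩⟩
      · exact (hD u v h h1).1 h2
      · exact ((hD v u h.symm h1).1 h2).symm
    · intro h
      refine ⟨hS h, ?_⟩
      rcases lt_or_gt_of_ne h.ne with h1 | h1
      · exact .inl ⟨h1, (hD u v (hS h) h1).2 h⟩
      · exact .inr ⟨h1, (hD v u (hS h).symm h1).2 h.symm⟩
  let P := {p : Fin I.n × Fin I.n // p.1 < p.2 ∧ S.Adj p.1 p.2}
  by_cases hP : Nonempty P
  · have hcard : Fintype.card P ≤ K := by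
      refine le_trans ?_ hK
      rw [← Nat.card_eq_fintype_card, ← Nat.card_coe_set_eq]
      refine Nat.card_le_card_of_injective
        (fun p : P => (⟨s(p.1.1, p.1.2), p.2.2⟩ : S.edgeSet)) fun p p' hpp => ?_
      have := Subtype.ext_iff.1 hpp
      simp only [Sym2.eq_iff] at this
      rcases this with h | h
      · exact Subtype.ext (Prod.ext h.1 h.2)
      · have h1 := p.2.1
        have h2 := p'.2.1
        rw [h.1, h.2] at h1
        exact absurd h1 h2.asymm
    -- Surplus digits repeat edges: a left inverse of an injection of the edges into the positions
    -- is surjective. Nonemptiness of `P` is needed here.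
    obtain ⟨f, hf⟩ : ∃ f : Fin K → P, Function.Surjective f := by
      let g : P ↪ Fin K := (Fintype.equivFin P).toEmbedding.trans (Fin.castLEEmb hcard)
      exact ⟨Function.invFun g, Function.invFun_surjective g.injective⟩
    obtain ⟨q, hq, hd⟩ := exists_digits (m := max 1 I.m) fun j =>
      ⟨I.rank (f j).1.1 (f j).1.2,
        (rank_lt (hS (f j).2.2) (f j).2.1).trans_le (le_max_right _ _)⟩
    refine ⟨q, hq.le, hadj fun u v h huv => ?_⟩
    constructor
    · rintro ⟨-, j, hj, hr⟩
      have := hd ⟨j, hj⟩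
      simp only at this
      rw [this] at hr
      obtain ⟨rfl, rfl⟩ := rank_inj h huv (hS (f ⟨j, hj⟩).2.2) (f ⟨j, hj⟩).2.1 hr
      exact (f ⟨j, hj⟩).2.2
    · intro h
      obtain ⟨j, hj⟩ := hf ⟨(u, v), huv, h⟩
      refine ⟨hq, j, j.2, ?_⟩
      rw [hd j, hj]
  · refine ⟨_, le_rfl, hadj fun u v _ huv => ⟨fun h => absurd h.1 (lt_irrefl _), fun h => ?_⟩⟩
    exact absurd ⟨⟨(u, v), huv, h⟩⟩ hP

end StarsNWS

/-! ### Preparation -/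

/-- Each component is represented by its least vertex, which turns the count into a bounded sum that
the machine can evaluate. -/
theorem SimpleGraph.card_connectedComponent_eq {n : ℕ} (H : SimpleGraph (Fin n))
    [DecidablePred fun v => ∀ u < v, ¬ H.Reachable u v] :
    Nat.card H.ConnectedComponent = (Finset.univ.filter fun v => ∀ u < v, ¬ H.Reachable u v).card := by
  rw [← Fintype.card_subtype, ← Nat.card_eq_fintype_card]
  symm
  refine Nat.card_eq_of_bijective
    (fun v : {v // ∀ u < v, ¬ H.Reachable u v} => H.connectedComponentMk v) ⟨fun v w h => ?_, ?_⟩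
  · have h := SimpleGraph.ConnectedComponent.exact h
    rcases lt_trichotomy v.1 w.1 with h' | h' | h'
    · exact absurd h (w.2 _ h')
    · exact Subtype.ext h'
    · exact absurd h.symm (v.2 _ h')
  · intro c
    obtain ⟨v, rfl⟩ := c.exists_rep
    obtain ⟨w, hw, hmin⟩ := WellFounded.has_min (wellFounded_lt (α := Fin n))
      {w | H.Reachable w v} ⟨v, .rfl⟩
    exact ⟨⟨w, fun u hu huw => hmin u (huw.trans hw) hu⟩, SimpleGraph.ConnectedComponent.sound hw⟩

namespace StarsNWS

open RAM Term Finset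

variable (I : StarsNWS)

/-- A vertex in no community is not related to itself by the transitive closure, hence the
restriction to distinct vertices. -/
theorem transGen_share {u v : Fin I.n} (h : u ≠ v) :
    Relation.TransGen (fun u v => ∃ i : Fin I.c, u ∈ I.C i ∧ v ∈ I.C i) u v ↔
      I.communityGraph.Reachable u v := by
  rw [SimpleGraph.reachable_iff_reflTransGen]
  constructor
  · intro h'
    have key {u v} (h : ∃ i : Fin I.c, u ∈ I.C i ∧ v ∈ I.C i) :
        Relation.ReflTransGen I.communityGraph.Adj u v := by
      by_cases huv : u = v
      · rw [huv]
      · exact .single ((SimpleGraph.fromRel_adj _ _ _).2 ⟨huv, .inl h⟩)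
    clear h
    induction h' with
    | single h => exact key h
    | tail _ h ih => exact ih.trans (key h)
  · intro h'
    rcases Relation.reflTransGen_iff_eq_or_transGen.1 h' with h' | h'
    · exact absurd h'.symm h
    · refine Relation.TransGen.mono (fun u v huv => ?_) _ _ h'
      rcases ((SimpleGraph.fromRel_adj _ _ _).1 huv).2 with ⟨i, h1, h2⟩ | ⟨i, h1, h2⟩
      · exact ⟨i, h1, h2⟩
      · exact ⟨i, h2, h1⟩

def rankTerm : Term :=
  .sum 24 0 (.sum 25 0 (.ind (.conj (.conj (.lt (.var 24) (.var 25)) (.cell 6 (.var 24) (.var 25)))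
    (.disj (.lt (.var 24) (.var 20)) (.conj (.eqv (.var 24) (.var 20))
      (.lt (.var 25) (.var 21)))))))

/-- Bring the input into the form that the trials use. -/
def loadCmd : Cmd :=
  .seq (.fill 2 (.const 0) 20 4 (.sum 24 4 (.sum 25 4 (.lt (.var 24) (.var 20))))) <|
  .seq (.fill 5 (.const 0) 20 4 (.sum 24 4 (.sum 25 0 (.lt (.var 24) (.var 20))))) <|
  .seq (.table 6 0 0 (.get 0 (.add (.get 5 (.var 20)) (.var 21)))) <|
  .table 7 1 0 (.get 1 (.add (.get 5 (.var 20)) (.var 21)))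

/-- The number of components and the number of edges. -/
def countCmd : Cmd :=
  .seq (.table 8 0 0 (.ex 24 1 (.conj (.cell 7 (.var 24) (.var 20)) (.cell 7 (.var 24) (.var 21))))) <|
  .seq (.closure 0) <|
  .seq (.assign 13 (.sum 24 0 (.ind (.all 25 0 (.imp (.lt (.var 25) (.var 24))
    (.neg (.cell 8 (.var 25) (.var 24)))))))) <|
  .seq (.table 11 0 0 rankTerm) <|
  .assign 6 (edgesTerm 6)

/-- The machine cannot multiply, so the row positions are computed by counting the pairs whose first
entry is below `i`. -/
theorem sum_range_if_lt {i Q : ℕ} (hi : i ≤ Q) (k : ℕ) :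
    ∑ x ∈ range Q, (if x < i then k else 0) = i * k := by
  rw [← sum_filter, sum_const, smul_eq_mul]
  congr 1
  rw [show (range Q).filter (· < i) = range i by ext x; simp; omega, card_range]

theorem den_loadCmd {s : Store} (hs : Same [4] [] [] s I.input) (hQ : s.reg 4 = I.n + I.c) :
    Same [20, 21] [2, 5, 6, 7] [] (loadCmd.den s) s ∧ I.Ready (loadCmd.den s) := by
  classical
  have r0 : s.reg 0 = I.n := hs.reg 0 (by decide)
  have r1 : s.reg 1 = I.c := hs.reg 1 (by decide)
  obtain ⟨g₁, h2, -⟩ := Cmd.den_fill (a := 2) (u := .const 0) (r := 20) (b := 4)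
    (t := .sum 24 4 (.sum 25 4 (.lt (.var 24) (.var 20)))) rfl rfl (fun _ _ => rfl) s
  set s₁ := (Cmd.fill 2 (.const 0) 20 4 (.sum 24 4 (.sum 25 4 (.lt (.var 24) (.var 20))))).den s
    with hs₁
  have g₁ := g₁.same
  have grid : Cmd.Grid (I.n + I.c) s₁ := by
    intro i hi
    have := h2 i (hQ ▸ hi)
    rw [Term.eval_const, zero_add] at this
    rw [this]
    simp [Term.eval, Store.upd_reg, hQ, sum_range_if_lt hi.le]
  have q1 : s₁.reg 4 = I.n + I.c := (g₁.reg 4 (by decide)).trans hQ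
  have n1 : s₁.reg 0 = I.n := (g₁.reg 0 (by decide)).trans r0
  obtain ⟨g₂, h5, -⟩ := Cmd.den_fill (a := 5) (u := .const 0) (r := 20) (b := 4)
    (t := .sum 24 4 (.sum 25 0 (.lt (.var 24) (.var 20)))) rfl rfl (fun _ _ => rfl) s₁
  set s₂ := (Cmd.fill 5 (.const 0) 20 4 (.sum 24 4 (.sum 25 0 (.lt (.var 24) (.var 20))))).den s₁
    with hs₂
  have g₂ := g₂.same
  have pos : ∀ i < I.n + I.c, s₂.arr 5 i = i * I.n := by
    intro i hi
    have := h5 i (q1 ▸ hi)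
    rw [Term.eval_const, zero_add] at this
    rw [this]
    simp [Term.eval, Store.upd_reg, q1, n1, sum_range_if_lt hi.le]
  have G₂ := g₂.trans g₁
  have grid := grid.same g₂
  -- A cell of an input matrix determines its row and column, because columns are below `n`.
  have hn : ∀ (v v' : Fin I.n) (i i' : ℕ), i * I.n + v = i' * I.n + v' → i = i' ∧ v = v' := by
    intro v v' i i' h
    have h1 : i = i' := by
      have : (v + i * I.n) / I.n = (v' + i' * I.n) / I.n := by rw [add_comm _ (i * _), add_comm _ (i' * _), h]
      rwa [Nat.add_mul_div_right _ _ v.pos, Nat.add_mul_div_right _ _ v.pos,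
        Nat.div_eq_of_lt v.2, Nat.div_eq_of_lt v'.2, zero_add, zero_add] at this
    subst h1
    exact ⟨rfl, Fin.ext (by omega)⟩
  obtain ⟨g₃, h6⟩ := rel_table (a := 6) (b := 0) (b' := 0) (k := I.n) (l := I.n)
    (t := .get 0 (.add (.get 5 (.var 20)) (.var 21))) (P := I.G.Adj) (s := s₂)
    grid ((G₂.reg 0 (by decide)).trans r0) ((G₂.reg 0 (by decide)).trans r0) (by omega) (by omega)
    (by
      intro u v
      simp only [Term.Holds, Term.eval_add, Term.eval_get, Term.eval_var, Store.upd_reg,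
        Store.upd_arr]
      simp only [reduceIte, Nat.reduceEqDiff]
      rw [pos u (by omega), G₂.arr 0 (by decide), hs.arr 0 (by decide)]
      simp only [input, reduceIte, ne_eq, ite_eq_right_iff, one_ne_zero, imp_false, not_not]
      constructor
      · rintro ⟨u', v', h, hadj⟩
        obtain ⟨h1, rfl⟩ := hn _ _ _ _ h
        rwa [Fin.ext h1]
      · exact fun h => ⟨u, v, rfl, h⟩)
  have G₃ := g₃.trans G₂
  have pos := g₃.arr 5 (by decide) ▸ pos
  obtain ⟨g₄, h7⟩ := rel_table (a := 7) (b := 1) (b' := 0) (k := I.c) (l := I.n)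
    (t := .get 1 (.add (.get 5 (.var 20)) (.var 21))) (P := fun i v => v ∈ I.C i)
    (grid.same g₃) ((G₃.reg 1 (by decide)).trans r1) ((G₃.reg 0 (by decide)).trans r0)
    (by omega) (by omega)
    (by
      intro u v
      simp only [Term.Holds, Term.eval_add, Term.eval_get, Term.eval_var, Store.upd_reg,
        Store.upd_arr]
      simp only [reduceIte, Nat.reduceEqDiff]
      rw [pos u (by omega), G₃.arr 1 (by decide), hs.arr 1 (by decide)]
      simp only [input, reduceIte, ne_eq, ite_eq_right_iff, one_ne_zero, imp_false, not_not]
      constructor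
      · rintro ⟨u', v', h, hadj⟩
        obtain ⟨h1, rfl⟩ := hn _ _ _ _ h
        rwa [Fin.ext h1]
      · exact fun h => ⟨u, v, rfl, h⟩)
  have G₄ := g₄.trans G₃
  have G : Same [20, 21] [2, 5, 6, 7] [] (loadCmd.den s) s :=
    G₄.mono (by decide) (by decide) (by decide)
  refine ⟨G, ?_⟩
  have Gi := G.trans hs
  exact
    { n := Gi.reg 0 (by decide)
      c := Gi.reg 1 (by decide)
      sign := Gi.reg 2 (by decide)
      ell := Gi.reg 3 (by decide)
      Q := (G.reg 4 (by decide)).trans hQ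
      grid := (grid.same g₃).same g₄
      pos := g₄.arr 5 (by decide) ▸ pos
      adj := h6.same g₄
      mem := h7
      weight := fun u v => by
        rw [Gi.warr 0 (by decide)]
        simp only [input, reduceIte]
        unfold pairWeight
        split_ifs with h
        · rw [Finset.sum_eq_single ⟨s(u, v), h⟩]
          · rw [if_pos ⟨u, v, rfl, rfl⟩]
          · intro e _ he
            rw [if_neg]
            rintro ⟨u', v', h', he'⟩
            obtain ⟨h1, rfl⟩ := hn _ _ _ _ h'
            obtain rfl := Fin.ext h1
            exact he (Subtype.ext he')
          · exact fun h' => absurd (mem_univ _) h'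
        · refine Finset.sum_eq_zero fun e _ => if_neg ?_
          rintro ⟨u', v', h', he'⟩
          obtain ⟨h1, rfl⟩ := hn _ _ _ _ h'
          obtain rfl := Fin.ext h1
          exact h (he' ▸ e.2)
      b := by
        rw [Gi.warr 1 (by decide)]
        simp [input] }

theorem den_countCmd {s : Store} (h : I.Ready s) :
    Same [6, 12, 13, 20, 21] [8, 9, 11] [] (countCmd.den s) s ∧ (countCmd.den s).reg 6 = I.m ∧
      (countCmd.den s).reg 13 = I.x ∧ ∀ u v : Fin I.n,
        (countCmd.den s).arr 11 ((countCmd.den s).arr 2 u + v) = I.rank u v := by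
  classical
  have hnQ : I.n ≤ I.n + I.c := by omega
  obtain ⟨g₁, h8⟩ := rel_table (a := 8) (b := 0) (b' := 0)
    (t := .ex 24 1 (.conj (.cell 7 (.var 24) (.var 20)) (.cell 7 (.var 24) (.var 21))))
    (P := fun u v => ∃ i : Fin I.c, u ∈ I.C i ∧ v ∈ I.C i) h.grid h.n h.n hnQ hnQ (by
      intro u v
      simp [-ne_eq, Term.holds_conj, Term.holds_cell, Term.holds_ex (k := I.c), Term.eval_var,
        Store.upd_reg, h.c, h.mem.iff])
  have r₁ := h.same g₁
  obtain ⟨g₂, h8⟩ := rel_closure (b := 0) r₁.grid r₁.n hnQ h8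
  set s₂ := (Cmd.closure 0).den ((Cmd.table 8 0 0 (.ex 24 1 (.conj
    (.cell 7 (.var 24) (.var 20)) (.cell 7 (.var 24) (.var 21))))).den s) with hs₂
  have r₂ := r₁.same g₂
  set s₃ := s₂.upd 13 ((Term.sum 24 0 (.ind (.all 25 0 (.imp (.lt (.var 25) (.var 24))
    (.neg (.cell 8 (.var 25) (.var 24))))))).eval s₂) with hs₃
  have g₃ : Same [13] [] [] s₃ s₂ := same_upd _ _ _
  have r₃ := r₂.same g₃
  have hx : s₃.reg 13 = I.x := by
    rw [hs₃, Store.upd_reg, if_pos rfl, Term.eval_sum_ind (k := I.n) _ _ _ _ r₂.n, x,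
      SimpleGraph.card_connectedComponent_eq]
    congr 1
    refine filter_congr fun v _ => ?_
    rw [Term.holds_all (k := I.n) _ _ _ _ (by simpa [Store.upd_reg] using r₂.n)]
    refine forall_congr' fun u => ?_
    simp only [Term.holds_imp, Term.holds_lt, Term.holds_neg, Term.holds_cell, Term.eval_var,
      Store.upd_reg, Store.upd_arr, reduceIte, Nat.reduceEqDiff, h8.iff, Fin.val_fin_lt]
    exact imp_congr_right fun huv => not_congr (I.transGen_share huv.ne)
  obtain ⟨g₄, h11⟩ := Cmd.den_table (a := 11) (b := 0) (b' := 0) (t := rankTerm) r₃.grid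
    (by rw [r₃.n]; omega) (by rw [r₃.n]; omega)
  set s₄ := (Cmd.table 11 0 0 rankTerm).den s₃ with hs₄
  have g₄ := g₄.same
  have r₄ := r₃.same g₄
  have g : Same [6, 12, 13, 20, 21] [8, 9, 11] [] (countCmd.den s) s :=
    ((same_upd _ _ _).trans (g₄.trans (g₃.trans (g₂.trans g₁)))).mono (by decide) (by decide)
      (by decide)
  have g₅ : Same [6] [] [] (countCmd.den s) s₄ := same_upd _ _ _
  refine ⟨g, eval_edgesTerm r₄.n r₄.adj, ?_, fun u v => ?_⟩
  · rw [g₅.reg 13 (by decide), g₄.reg 13 (by decide), hx]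
  · rw [g₅.arr 11 (by decide), g₅.arr 2 (by decide), g₄.arr 2 (by decide),
      h11 u (by rw [r₃.n]; omega) v (by rw [r₃.n]; omega), rankTerm,
      Term.eval_sum_fin (k := I.n) _ _ _ _ (by simpa [Store.upd_reg] using r₃.n)]
    rw [I.rank_eq]
    refine sum_congr rfl fun u' _ => ?_
    rw [Term.eval_sum_fin (k := I.n) _ _ _ _ (by simpa [Store.upd_reg] using r₃.n)]
    refine sum_congr rfl fun v' _ => ?_
    rw [Term.eval_ind]
    refine if_congr ?_ rfl rfl
    simp [-ne_eq, Term.holds_conj, Term.holds_disj, Term.holds_lt, Term.holds_eqv, Term.holds_cell,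
      Term.eval_var, Store.upd_reg, r₃.adj.iff, Fin.val_inj]

end StarsNWS

/-! ### The loop over all trials -/

namespace StarsNWS

open RAM Term Finset

variable (I : StarsNWS)

/-- A bound on the feedback edge number of solutions. -/
noncomputable def budget : ℕ := (min I.ℓ I.m - I.n + I.x).toNat

theorem x_le : I.x ≤ I.n := by
  classical
  rw [x, SimpleGraph.card_connectedComponent_eq]
  exact (card_le_univ _).trans_eq (Fintype.card_fin _)

/-- The numbers that control the enumeration of the trials. -/
structure Counted (s : Store) : Prop where
  ready : I.Ready s
  rank : ∀ u v : Fin I.n, s.arr 11 (s.arr 2 u + v) = I.rank u v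
  edges : s.reg 5 = 4 * I.budget
  radix : s.reg 7 = max 1 I.m

variable {I}

theorem Counted.same {J A W : List ℕ} {s t : Store} (h : I.Counted t) (hs : Same J A W s t)
    (hJ : ∀ r ∈ [0, 1, 2, 3, 4, 5, 7], r ∉ J := by decide)
    (hA : ∀ a ∈ [2, 5, 6, 7, 11], a ∉ A := by decide)
    (hW : ∀ a ∈ [0, 1], a ∉ W := by decide) : I.Counted s where
  ready := h.ready.same hs (fun r hr => hJ r (by revert hr; simp; tauto))
    (fun r hr => hA r (by revert hr; simp; tauto)) hW
  rank := by rw [hs.arr 2 (hA 2 (by decide)), hs.arr 11 (hA 11 (by decide))]; exact h.rank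
  edges := by rw [hs.reg 5 (hJ 5 (by decide))]; exact h.edges
  radix := by rw [hs.reg 7 (hJ 7 (by decide))]; exact h.radix

/-- The number of edges to be guessed and the number of choices for each of them. -/
def budgetCmd : Cmd :=
  .seq (.assign 7 (.add (.var 6) (.lt (.var 6) (.const 1)))) <|
  -- With truncated subtraction, `m - (m - |ℓ|)` is the minimum of `m` and `|ℓ|`. The value is wrong
  -- for negative `ℓ` and is then reset to `0`.
  .seq (.assign 14 (.sub (.add (.sub (.var 6) (.sub (.var 6) (.var 3))) (.var 13)) (.var 0))) <|
  .seq (.ite (.var 2) (.assign 14 (.const 0))) <|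
  .assign 5 (.add (.add (.var 14) (.var 14)) (.add (.var 14) (.var 14)))

def setupCmd : Cmd := .seq loadCmd <| .seq countCmd budgetCmd

theorem den_budgetCmd {s : Store} (h : I.Ready s) (hm : s.reg 6 = I.m) (hx : s.reg 13 = I.x) :
    Same [5, 7, 14] [] [] (budgetCmd.den s) s ∧ (budgetCmd.den s).reg 5 = 4 * I.budget ∧
      (budgetCmd.den s).reg 7 = max 1 I.m := by
  have hxn := I.x_le
  have h2 := h.sign
  have h0 := h.n
  have h3 := h.ell
  refine ⟨?_, ?_, ?_⟩
  · have hite (t : Store) : Same [14] [] [] ((Cmd.ite (.var 2) (.assign 14 (.const 0))).den t) t := by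
      rw [Cmd.den]
      split_ifs
      · exact Same.refl _ _ _ _
      · exact same_upd _ _ _
    exact ((same_upd 5 _ _).trans ((hite _).trans ((same_upd 14 _ _).trans (same_upd 7 _ s)))).mono
      (by decide) (by decide) (by decide)
  · rcases lt_or_ge I.ℓ 0 with hl | hl
    · have : I.budget = 0 := by
        rw [budget]
        omega
      simp [budgetCmd, Cmd.den, Term.eval, Store.upd_reg, h2, hl, this]
    · obtain ⟨k, hk⟩ := Int.eq_ofNat_of_zero_le hl
      have h3 : s.reg 3 = k := by rw [h3, hk, Int.natAbs_natCast]
      have : I.budget = I.m - (I.m - k) + I.x - I.n := by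
        rw [budget, hk]
        omega
      simp [budgetCmd, Cmd.den, Term.eval, Store.upd_reg, h2, hl.not_gt, this, hm, hx, h3, h0]
      omega
  · rw [budgetCmd, Cmd.den, Cmd.den_reg _ rfl]
    simp only [Cmd.den, Term.eval, Store.upd_reg, hm, reduceIte]
    split_ifs <;> omega

theorem den_setupCmd {s : Store} (hs : Same [4] [] [] s I.input) (hQ : s.reg 4 = I.n + I.c) :
    Same [5, 6, 7, 12, 13, 14, 20, 21] [2, 5, 6, 7, 8, 9, 11] [] (setupCmd.den s) s ∧
      I.Counted (setupCmd.den s) := by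
  obtain ⟨g₁, r₁⟩ := den_loadCmd I hs hQ
  obtain ⟨g₂, hm, hx, hr⟩ := den_countCmd I r₁
  have r₂ := r₁.same g₂
  obtain ⟨g₃, h5, h7⟩ := den_budgetCmd r₂ hm hx
  rw [setupCmd, Cmd.den, Cmd.den]
  refine ⟨(g₃.trans (g₂.trans g₁)).mono (by decide) (by decide) (by decide), r₂.same g₃, ?_, h5, h7⟩
  rw [g₃.arr 11 (by decide), g₃.arr 2 (by decide)]
  exact hr

/-- The number of trials. -/
def powCmd : Cmd :=
  .seq (.assign 8 (.const 1)) <| .seq (.loop 16 5 (.assign 8 (.sum 24 7 (.var 8)))) <|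
  .assign 9 (.add (.var 8) (.const 1))

/-- Each round replaces register `8` by a sum of as many copies of itself as the radix. Sum and loop
are bounded by radix and number of digits, which are small, although the result is not. Register `9`
counts one trial more, for the empty guess. -/
theorem den_powCmd (s : Store) : Same [8, 9, 16] [] [] (powCmd.den s) s ∧
    (powCmd.den s).reg 8 = s.reg 7 ^ s.reg 5 ∧ (powCmd.den s).reg 9 = s.reg 7 ^ s.reg 5 + 1 := by
  have key := iter_induct (f := (Cmd.assign 8 (.sum 24 7 (.var 8))).den) (r := 16) (K := s.reg 5)
    (s := s.upd 8 1) (fun k st => Same [8, 9, 16] [] [] st s ∧ st.reg 8 = s.reg 7 ^ k)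
    ⟨(same_upd _ _ _).mono (by decide) (by decide) (by decide), by simp [Store.upd_reg]⟩ (by
      rintro k - st ⟨h1, h2⟩
      refine ⟨((same_upd _ _ _).trans ((same_upd _ _ _).trans h1)).mono (by decide) (by decide)
        (by decide), ?_⟩
      simp [Cmd.den, Term.eval, Store.upd_reg, h2, h1.reg 7 (by decide), pow_succ, mul_comm])
  have hden : powCmd.den s = ((iter (Cmd.assign 8 (.sum 24 7 (.var 8))).den 16 (s.upd 8 1)
      (s.reg 5)).upd 16 (s.reg 5)).upd 9 ((iter (Cmd.assign 8 (.sum 24 7 (.var 8))).den 16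
      (s.upd 8 1) (s.reg 5)).reg 8 + 1) := by
    simp [powCmd, Cmd.den, Term.eval, Store.upd_reg]
  rw [hden]
  refine ⟨((same_upd _ _ _).trans ((same_upd _ _ _).trans key.1)).mono (by decide) (by decide)
    (by decide), ?_, ?_⟩
  · simp [Store.upd_reg, key.2]
  · simp [Store.upd_reg, key.2]

/-- The guessed edges. -/
def guessTerm : Term :=
  .conj (.cell 6 (.var 20) (.var 21)) (.disj
    (.conj (.lt (.var 20) (.var 21)) (.conj (.lt (.var 11) (.var 8))
      (.ex 24 5 (.eqv (.cell 11 (.var 20) (.var 21)) (.get 12 (.var 24))))))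
    (.conj (.lt (.var 21) (.var 20)) (.conj (.lt (.var 11) (.var 8))
      (.ex 24 5 (.eqv (.cell 11 (.var 21) (.var 20)) (.get 12 (.var 24)))))))

/-- A digit of the successor, before the reduction. -/
def carryTerm (r : ℕ) : Term :=
  .add (.get 12 (.var 20)) (.ind (.all r 5 (.imp (.lt (.var r) (.var 20))
    (.eqv (.add (.get 12 (.var r)) (.const 1)) (.var 7)))))

/-- Increase the number with the digits in array `12`. -/
def succCmd : Cmd :=
  .seq (.fill 13 (.const 0) 20 5
    -- The sum is the radix if the digit has reached it and `0` otherwise, so the subtraction resets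
    -- an overflowing digit. Inside the sum level `24` is taken, hence `carryTerm 25`. Array `13` is
    -- needed because the carries refer to the old digits.
    (.sub (carryTerm 24) (.sum 24 7 (.ind (.eqv (carryTerm 25) (.var 7)))))) <|
  .fill 12 (.const 0) 20 5 (.get 13 (.var 20))

def trialCmd : Cmd :=
  .seq (.table 14 0 0 guessTerm) <| .seq centreCmd <| .seq checkCmd succCmd

theorem eval_carryTerm {s : Store} {K m q j r : ℕ} (hK : s.reg 5 = K) (hm : s.reg 7 = m)
    (hd : ∀ i < K, s.arr 12 i = q / m ^ i % m) (hj : s.reg 20 = j) (hjK : j < K)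
    [Decidable (∀ i < j, q / m ^ i % m + 1 = m)] (hr : r ≠ 20 ∧ r ≠ 7 := by decide) :
    (carryTerm r).eval s = q / m ^ j % m + if ∀ i < j, q / m ^ i % m + 1 = m then 1 else 0 := by
  classical
  rw [carryTerm, Term.eval_add, Term.eval_ind, Term.eval_get, Term.eval_var, hj, hd j hjK]
  congr 1
  refine if_congr ?_ rfl rfl
  rw [Term.holds_all (k := K) _ _ _ _ hK, Fin.forall_iff]
  simp only [Term.holds_imp, Term.holds_lt, Term.holds_eqv, Term.eval_add, Term.eval_get,
    Term.eval_var, Term.eval_const, Store.upd_reg, Store.upd_arr, hj, hm, if_true, hr.1.symm,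
    hr.2.symm, if_false]
  constructor
  · intro h i hi
    have := h i (hi.trans hjK) hi
    rwa [hd i (hi.trans hjK)] at this
  · intro h i hi hij
    rw [hd i hi]
    exact h i hij

theorem den_succCmd {s : Store} {K m q : ℕ} (hK : s.reg 5 = K) (hm : s.reg 7 = m) (hm0 : 0 < m)
    (hd : ∀ j < K, s.arr 12 j = q / m ^ j % m) :
    Same [20] [12, 13] [] (succCmd.den s) s ∧
      ∀ j < K, (succCmd.den s).arr 12 j = (q + 1) / m ^ j % m := by
  classical
  obtain ⟨g₁, h13, -⟩ := Cmd.den_fill (a := 13) (u := .const 0) (r := 20) (b := 5)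
    (t := .sub (carryTerm 24) (.sum 24 7 (.ind (.eqv (carryTerm 25) (.var 7))))) rfl rfl
    (fun _ _ => rfl) s
  set s₁ := (Cmd.fill 13 (.const 0) 20 5
    (.sub (carryTerm 24) (.sum 24 7 (.ind (.eqv (carryTerm 25) (.var 7)))))).den s
  have g₁ := g₁.same
  obtain ⟨g₂, h12, -⟩ := Cmd.den_fill (a := 12) (u := .const 0) (r := 20) (b := 5)
    (t := .get 13 (.var 20)) rfl rfl (fun _ _ => rfl) s₁
  refine ⟨(g₂.same.trans g₁).mono (by decide) (by decide) (by decide), fun j hj => ?_⟩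
  have e1 := h12 j (by rw [g₁.reg 5 (by decide), hK]; exact hj)
  have e2 := h13 j (by rw [hK]; exact hj)
  rw [Term.eval_const, zero_add] at e1 e2
  have hc := eval_carryTerm (r := 24) (s := s.upd 20 j) (by simpa [Store.upd_reg] using hK)
    (by simpa [Store.upd_reg] using hm) hd (by simp [Store.upd_reg]) hj
  have hc' (x : ℕ) := eval_carryTerm (r := 25) (s := (s.upd 20 j).upd 24 x)
    (by simpa [Store.upd_reg] using hK)
    (by simpa [Store.upd_reg] using hm) hd (by simp [Store.upd_reg]) hj
  change (succCmd.den s).arr 12 j = _ at e1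
  rw [e1, Term.eval_get, Term.eval_var, Store.upd_reg, if_pos rfl, Store.upd_arr, e2,
    digit_succ hm0 q j rfl, Term.eval_sub, Term.eval_sum, hc]
  simp only [Term.eval_ind, Term.holds_eqv, hc', Term.eval_var, Store.upd_reg, Nat.reduceEqDiff,
    reduceIte, hm, sum_const, card_range, smul_eq_mul]
  split_ifs <;> omega

/-- The memory state before the trial with number `q`. -/
structure Trying (I : StarsNWS) (q : ℕ) (s : Store) : Prop where
  counted : I.Counted s
  trials : s.reg 8 = max 1 I.m ^ (4 * I.budget)
  digits : ∀ j < 4 * I.budget, s.arr 12 j = q / max 1 I.m ^ j % max 1 I.m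
  answer : s.reg 10 ≠ 0 ↔ ∃ p < q, I.Accepts (I.guess (4 * I.budget) p)

theorem Trying.step {q : ℕ} {s : Store} (h : I.Trying q s) :
    I.Trying (q + 1) (trialCmd.den (s.upd 11 q)) := by
  have g₀ : Same [11] [] [] (s.upd 11 q) s := same_upd _ _ _
  have h11 : (s.upd 11 q).reg 11 = q := by rw [Store.upd_reg, if_pos rfl]
  set s₀ := s.upd 11 q
  have c₀ := h.counted.same g₀
  have h8 := (g₀.reg 8 (by decide)).trans h.trials
  have h12 : ∀ j < 4 * I.budget, s₀.arr 12 j = q / max 1 I.m ^ j % max 1 I.m := h.digits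
  obtain ⟨g₁, hS⟩ := rel_table (a := 14) (b := 0) (b' := 0) (t := guessTerm)
    (P := (I.guess (4 * I.budget) q).Adj) c₀.ready.grid c₀.ready.n c₀.ready.n (by omega) (by omega)
    (by
      intro u v
      have key (w w' : Fin I.n) : I.rank w w' ∈ {d | q < max 1 I.m ^ (4 * I.budget) ∧
          ∃ j < 4 * I.budget, d = q / max 1 I.m ^ j % max 1 I.m} ↔
          q < max 1 I.m ^ (4 * I.budget) ∧ ∃ j : Fin (4 * I.budget), I.rank w w' = s₀.arr 12 j := by
        rw [Set.mem_ofPred_eq, Fin.exists_iff]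
        refine and_congr_right fun _ => exists_congr fun j => ?_
        constructor
        · exact fun ⟨hj, hr⟩ => ⟨hj, hr.trans (h12 j hj).symm⟩
        · exact fun ⟨hj, hr⟩ => ⟨hj, hr.trans (h12 j hj)⟩
      simp only [guess, rankGraph, key]
      simp [-ne_eq, guessTerm, Term.holds_conj, Term.holds_disj, Term.holds_eqv, Term.holds_lt,
        Term.holds_cell, Term.holds_ex (k := 4 * I.budget), Term.eval_var, Term.eval_get,
        Term.eval_cell, Store.upd_reg, c₀.edges, c₀.ready.adj.iff, h8, h11, c₀.rank])
  have c₁ := c₀.same g₁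
  obtain ⟨g₂, hC⟩ := den_centreCmd c₁.ready hS
  have c₂ := c₁.same g₂
  obtain ⟨g₃, hans⟩ := den_checkCmd c₂.ready (hS.same g₂) hC
  have c₃ := c₂.same g₃
  have G := g₃.trans (g₂.trans g₁)
  obtain ⟨g₄, hd⟩ := den_succCmd (q := q) c₃.edges c₃.radix (by omega)
    (by rw [G.arr 12 (by decide)]; exact h12)
  rw [trialCmd, Cmd.den, Cmd.den, Cmd.den]
  refine ⟨c₃.same g₄, ?_, hd, ?_⟩
  · rw [g₄.reg 8 (by decide), G.reg 8 (by decide), h8]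
  · rw [g₄.reg 10 (by decide), hans, g₂.reg 10 (by decide), g₁.reg 10 (by decide),
      g₀.reg 10 (by decide), h.answer]
    constructor
    · rintro (⟨p, hp, h⟩ | h)
      · exact ⟨p, by omega, h⟩
      · exact ⟨q, by omega, h⟩
    · rintro ⟨p, hp, hacc⟩
      rcases Nat.lt_succ_iff_lt_or_eq.1 hp with hp | rfl
      · exact .inl ⟨p, hp, hacc⟩
      · exact .inr hacc

/-- All trials together decide the instance. -/
theorem isYes_iff : I.IsYes ↔
    ∃ q < max 1 I.m ^ (4 * I.budget) + 1, I.Accepts (I.guess (4 * I.budget) q) := by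
  constructor
  · intro h
    obtain ⟨S, hS, hcard, hacc⟩ := exists_accepts h
    -- Truncating the bound to a natural number loses nothing, since a number of edges is not
    -- negative.
    obtain ⟨q, hq, rfl⟩ := exists_guess (K := 4 * I.budget) hS (by rw [budget]; omega)
    exact ⟨q, by omega, hacc⟩
  · rintro ⟨q, -, h⟩
    exact h.isYes (guess_le _ _)

theorem budget_le_t : I.budget ≤ I.t := by
  rw [budget, t]
  omega

/-- This is the purpose of the minimum with `m` in `budget`: `ℓ` itself may exceed every polynomial
in the size, whereas `m - n + x` is at most `m` because `x ≤ n`. -/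
theorem budget_le_size : I.budget ≤ I.size := by
  have := I.x_le
  rw [budget, size]
  omega

/-- The algorithm. -/
def algorithm : Program :=
  .seq (Cmd.assign 4 (.add (.var 0) (.var 1))).comp <| .seq setupCmd.comp <| .seq powCmd.comp <|
  -- The loop over the trials is not a command: its bound, register `9`, is not polynomially small.
  .seq (forProg 11 9 trialCmd.comp) (Cmd.assign 0 (.ind (.var 10))).comp

/-- The lists name all registers that bound sums or loops. Register `3` with `|ℓ|` and registers `8`
and `9` with the numbers of trials are absent, which is what makes the time polynomial. -/
theorem wf_setupCmd : setupCmd.WF (fun r => r = 0 || r = 1 || r = 4) = true := by rfl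

theorem wf_powCmd : powCmd.WF (fun r => r = 5 || r = 7) = true := by rfl

theorem wf_trialCmd :
    trialCmd.WF (fun r => r = 0 || r = 1 || r = 4 || r = 5 || r = 7) = true := by rfl

theorem Counted.reg_le {s : Store} (h : I.Counted s) {r : ℕ}
    (hr : (r = 0 || r = 1 || r = 4 || r = 5 || r = 7) = true) : s.reg r ≤ 4 * I.size := by
  have hB := budget_le_size (I := I)
  have hn : I.n + I.c ≤ I.size := by rw [size]; omega
  have hm : max 1 I.m ≤ I.size := by rw [size]; omega
  simp only [Bool.or_eq_true, decide_eq_true_eq] at hr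
  rcases hr with (((rfl | rfl) | rfl) | rfl) | rfl
  · rw [h.ready.n]; omega
  · rw [h.ready.c]; omega
  · rw [h.ready.Q]; omega
  · rw [h.edges]; omega
  · rw [h.radix]; omega

/-- The running time of the algorithm, `N` bounding the small registers, per trial. -/
def trialTime (N : ℕ) : ℕ :=
  (Cmd.assign 4 (.add (.var 0) (.var 1))).time (fun _ => N) + setupCmd.time (fun _ => N) +
    powCmd.time (fun _ => N) + (trialCmd.time (fun _ => N) + trialCmd.time (fun _ => N)) +
    (Cmd.assign 0 (.ind (.var 10))).time (fun _ => N) + 22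

/-- From `M + 1 ≤ 2 * M` the cost of a trial is counted twice; the constant is `22 = 2 * 8 + 6`. -/
theorem trialTime_arith (a₁ a₂ a₃ a₄ a₅ : ℕ) {M : ℕ} (hM : 1 ≤ M) :
    a₁ + (a₂ + (a₃ + ((M + 1) * (a₄ + 8) + 6 + a₅))) ≤
      M * (a₁ + a₂ + a₃ + (a₄ + a₄) + a₅ + 22) := by
  nlinarith [Nat.mul_le_mul_right a₁ hM, Nat.mul_le_mul_right a₂ hM, Nat.mul_le_mul_right a₃ hM,
    Nat.mul_le_mul_right a₄ hM, Nat.mul_le_mul_right a₅ hM]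

theorem trialTime_le : ∃ a k : ℕ, ∀ N, 1 ≤ N → trialTime N ≤ a * N ^ k := by
  have mono {isB : ℕ → Bool} {P : Cmd} (h : P.WF isB = true) :
      PolyBounded (fun _ => true) fun β => P.time β := by
    obtain ⟨a, k, h⟩ := P.time_le h
    exact ⟨a, k, fun β N hN hβ => h β N hN fun b _ => hβ b rfl⟩
  have h1 : (Cmd.assign 4 (.add (.var 0) (.var 1))).WF (fun _ => false) = true := rfl
  have h5 : (Cmd.assign 0 (.ind (.var 10))).WF (fun _ => false) = true := rfl
  obtain ⟨a, k, h⟩ := (((((mono h1).add_add (mono wf_setupCmd) 0).add_add (mono wf_powCmd) 0).add_add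
    ((mono wf_trialCmd).add_add (mono wf_trialCmd) 0) 0).add_add (mono h5) 22)
  refine ⟨a, k, fun N hN => ?_⟩
  have := h (fun _ => N) N hN fun _ _ => le_rfl
  simp only [add_zero] at this
  exact this

theorem solvedBy_algorithm (I : StarsNWS) :
    I.SolvedBy algorithm (max 1 I.m ^ (4 * I.t) * trialTime (4 * I.size)) := by
  classical
  set N := 4 * I.size with hN
  set M := max 1 I.m ^ (4 * I.budget) with hM
  set s₁ := (Cmd.assign 4 (.add (.var 0) (.var 1))).den I.input with hs₁
  have g₁ : Same [4] [] [] s₁ I.input := same_upd _ _ _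
  have hQ : s₁.reg 4 = I.n + I.c := rfl
  have hn : I.n + I.c ≤ I.size := by rw [size]; omega
  obtain ⟨g₂, c₂⟩ := den_setupCmd g₁ hQ
  set s₂ := setupCmd.den s₁ with hs₂
  obtain ⟨g₃, h8, h9⟩ := den_powCmd s₂
  set s₃ := powCmd.den s₂ with hs₃
  rw [c₂.radix, c₂.edges, ← hM] at h8 h9
  have c₃ := c₂.same g₃
  have G := g₃.trans (g₂.trans g₁)
  have htry (q : ℕ) : I.Trying q (iter trialCmd.den 11 s₃ q) := by
    -- Before the first trial array `12` is still all zero, which is the digit sequence of `0`, and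
    -- register `10` records no success.
    refine iter_induct (fun q s => I.Trying q s) ⟨c₃, h8, fun j _ => ?_, ?_⟩ fun q _ s h => h.step
    · rw [G.arr 12 (by decide), Nat.zero_div, Nat.zero_mod]
      rfl
    · rw [G.reg 10 (by decide)]
      simp [input]
  have r₁ := Cmd.runs (β := fun _ => N) (isB := fun _ => false)
    (.assign 4 (.add (.var 0) (.var 1))) rfl I.input (by simp)
  have r₂ := Cmd.runs (β := fun _ => N) setupCmd wf_setupCmd s₁ (by
    intro b hb
    simp only [Bool.or_eq_true, decide_eq_true_eq] at hb
    have h0 : s₁.reg 0 = I.n := rfl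
    have h1 : s₁.reg 1 = I.c := rfl
    rcases hb with (rfl | rfl) | rfl <;> omega)
  have r₃ := Cmd.runs (β := fun _ => N) powCmd wf_powCmd s₂ fun b hb => c₂.reg_le (by
    simp only [Bool.or_eq_true, decide_eq_true_eq] at hb ⊢
    omega)
  have r₄ := Runs.forProg (iter trialCmd.den 11 s₃) (b := 9) (r := 11) (K := M + 1)
    (P := trialCmd.comp) (T := trialCmd.time fun _ => N) (by decide) (by decide) (by decide)
    (fun k _ => by
      rw [Cmd.iter_reg (by decide) (fun s => trialCmd.den_reg rfl s), h9])
    (fun k _ => by rw [iter, trialCmd.den_reg rfl, Store.upd_reg, if_pos rfl])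
    (fun k _ => Cmd.runs trialCmd wf_trialCmd _ fun b hb =>
      ((htry k).counted.same (same_upd 11 k _)).reg_le hb)
  set s₄ := (iter trialCmd.den 11 s₃ (M + 1)).upd 11 (M + 1) with hs₄
  have r₅ := Cmd.runs (β := fun _ => N) (isB := fun _ => false)
    (.assign 0 (.ind (.var 10))) rfl s₄ (by simp)
  obtain ⟨s, T, he, hT, ha⟩ := (r₁.seq (r₂.seq (r₃.seq (r₄.seq r₅)))) I.input (.refl _ _)
  have hans : s.reg 0 = if I.IsYes then 1 else 0 := by
    rw [ha.reg 0 (by decide), Cmd.den, Store.upd_reg, if_pos rfl, Term.eval_ind]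
    refine if_congr ?_ rfl rfl
    rw [isYes_iff, ← hM, ← (htry (M + 1)).answer, Term.Holds, Term.eval_var,
      hs₄, Store.upd_reg, if_neg (by decide)]
  refine ⟨s, T, he, ?_, fun h => by rw [hans, if_pos h], fun h => by rw [hans, if_neg h]⟩
  have hM1 : 1 ≤ M := Nat.one_le_pow _ _ (by omega)
  have hMt : M ≤ max 1 I.m ^ (4 * I.t) :=
    Nat.pow_le_pow_right (by omega) (Nat.mul_le_mul_left _ budget_le_t)
  refine hT.trans (le_trans ?_ (Nat.mul_le_mul_right _ hMt))
  exact trialTime_arith _ _ _ _ _ hM1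

end StarsNWS

theorem mainTheorem3 :
    ∃ (P : RAM.Program) (a k : ℕ),
      (∀ I : StarsNWS, I.SolvedBy P ((max 1 I.m) ^ (4 * I.t) * (a * I.size ^ k))) ∧
      (∀ I : StarsNWS, I.t = 0 → I.SolvedBy P (a * I.size ^ k)) := by
  obtain ⟨a, k, h⟩ := StarsNWS.trialTime_le
  -- The small registers are bounded by four times the size, since the number of guessed edges is
  -- four times the budget; this contributes the factor `4 ^ k`.
  have main (I : StarsNWS) : I.SolvedBy StarsNWS.algorithm
      ((max 1 I.m) ^ (4 * I.t) * (a * 4 ^ k * I.size ^ k)) := by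
    obtain ⟨s, T, he, hT, hs⟩ := StarsNWS.solvedBy_algorithm I
    refine ⟨s, T, he, hT.trans (Nat.mul_le_mul_left _ ?_), hs⟩
    refine (h _ (by rw [StarsNWS.size]; omega)).trans_eq ?_
    rw [mul_pow, mul_assoc]
  refine ⟨StarsNWS.algorithm, a * 4 ^ k, k, main, fun I hI => ?_⟩
  have := main I
  rwa [hI, mul_zero, pow_zero, one_mul] at this
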